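/- Let $N=p^mq^n$, where $p,q$ are distinct primes and $m,n\ge 0$ are integers, and let $\zeta_N=e^{2\pi i/N}$. A non-empty set $A\subseteq\mathbb{Z}_N=\mathbb{Z}/N\mathbb{Z}$ is called spectral if there is a set $B\subseteq\mathbb{Z}_N$ with $|B|=|A|$ such that the exponential functions $e_b(x)=\zeta_N^{bx}$, $b\in B$, are pairwise orthogonal on $A$, that is, $$\sum_{a\in A}\zeta_N^{a(b-b')}=0\qquad\text{for all } b,b'\in B,\ b\ne b'.$$ A set $A\subseteq\mathbb{Z}_N$ tiles $\mathbb{Z}_N$ (by translations) if there is a set $T\subseteq\mathbb{Z}_N$ such that every element of $\mathbb{Z}_N$ can be written uniquely as $a+t$ with $a\in A$ and $t\in T$. Suppose that at least one of the following two conditions holds: 1. $p<q$, and moreover $m\le 9$ or $n\le 6$; 2. $p^{m-2}<q^4$. Then every non-empty spectral set $A\subseteq\mathbb{Z}_N$ tiles $\mathbb{Z}_N$. -/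

import Mathlib

namespace Fuglede

/-- `B` is a spectrum of `A ⊆ ℤ_N`: it has the same cardinality as `A`, and the exponential functions
`e_b(x) = ζ_N ^ (b * x)`, `b ∈ B`, `ζ_N = exp (2πi / N)`, are pairwise orthogonal on `A`, that is,
`⟨e_b, e_b'⟩_A = ∑ a ∈ A, ζ_N ^ (a * (b - b')) = 0` for `b ≠ b'`.
Here `ZMod.stdAddChar (k : ZMod N)` is Mathlib's `ζ_N ^ k = exp (2πi k / N)`. -/
def IsSpectrum {N : ℕ} [NeZero N] (A B : Finset (ZMod N)) : Prop :=
  A.card = B.card ∧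
    ∀ b ∈ B, ∀ b' ∈ B, b ≠ b' → ∑ a ∈ A, (ZMod.stdAddChar (a * (b - b')) : ℂ) = 0

/-- `A ⊆ ℤ_N` is spectral if it has a spectrum `B ⊆ ℤ_N`. -/
def IsSpectral {N : ℕ} [NeZero N] (A : Finset (ZMod N)) : Prop :=
  ∃ B : Finset (ZMod N), IsSpectrum A B

/-- `A ⊆ ℤ_N` tiles `ℤ_N` by translations: for some `T ⊆ ℤ_N`, every element of `ℤ_N` is in a
unique way the sum of an element of `A` and an element of `T`. -/
def Tiles {N : ℕ} (A : Finset (ZMod N)) : Prop :=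
  ∃ T : Finset (ZMod N), ∀ x : ZMod N,
    ∃! y : ZMod N × ZMod N, y.1 ∈ A ∧ y.2 ∈ T ∧ y.1 + y.2 = x

end Fuglede

/-! Write residues modulo `N` by their base-`p` and base-`q` digits. The sum over `A` of a character
of order `p ^ i * q ^ j` vanishes for one such character iff for all of them, since they are Galois
conjugate, so its vanishing is a statement `Bal A i j` about counts in digit cells. The order of a
difference `b - b'` depends only on the levels at which the digits first differ. A spectral pair
thus becomes a symmetric condition `SP m n A B` on two finite families of digit sequences.

The proof shows more than tiling: some sets of levels `K`, `L` exist such that `A` has the right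
size and no two of its points first differ at levels in `K ∪ {m}` and `L ∪ {n}` (`DigitTile`). The
residues whose digits are supported on `K`, `L` are then a tiling complement (`DigitTile.tiles`).
This goes by induction on `m + n` (`SP.digitTile`). A digit at which one family never branches can
be deleted, together with the complementary digit of the other (`SP.delU`). A free digit can be
fixed by an arbitrary choice function and then deleted (`SP.sub`). In both cases digit tiles lift
back. What remains are irreducible pairs, where every level branches and no digit is free, in both
families and for both primes.

Irreducible pairs need large exponents (`Irr.exponent_le`). Follow the top `q`-digit of `A` from the
deepest `p`-level upwards, and at the same time the first `q`-digit ("colour") of `B` from the root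
downwards. At each level either the two are balanced (a run), or two-coloured nodes of `B` do not
branch (a gap). Non-constant cells of `A` take only the values `0` and a power of `p`. Their support
must grow from `1` to `q`, by at most a factor `p` at each gap with mixed balance, so there are many
such gaps (`SP.exists_side`). Against this, the mass of a node of `A` times that of a node of `B` at
the complementary level is divisible by `|A|`, because the quotient is the trace of a projection
(`SP.dvd_mul`). Comparing `p`-adic valuations gives `k + k' + 3 * c ≤ m` for the first gaps `k`,
`k'` of the two sides and any lower bound `c` for the exponents `x` with `q ≤ p ^ x`. Moreover `k,
k' ≥ max 2 c`. The resulting `3 * c + 4 ≤ m` and `5 * c ≤ m`, and their analogues for `n`,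
contradict the assumed range. -/

namespace Fuglede

open Finset
open scoped Classical

variable {p q m n : ℕ} {α β : Type}

/-! ### Digit families, balance and combinatorial spectral pairs -/

/-- A finite family of points, each given by a sequence of `p`-digits and one of `q`-digits. -/
structure Fam (p q : ℕ) (α : Type) where
  S : Finset α
  u : α → ℕ → ZMod p
  v : α → ℕ → ZMod q

/-- The family with the roles of the two primes exchanged. -/
def Fam.swap (F : Fam p q α) : Fam q p α := ⟨F.S, F.v, F.u⟩

/-- Indicator of agreement on the first `k` digits. -/
noncomputable def ind (k : ℕ) (x y : ℕ → ZMod p) : ℤ := if ∀ t < k, y t = x t then 1 else 0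

/-- The test functions of level `i`: the constant `1` for `i = 0`, otherwise differences of the
indicators of two siblings. -/
def Test (u : α → ℕ → ZMod p) : ℕ → (α → ℤ) → Prop
  | 0, w => w = fun _ => 1
  | k + 1, w => ∃ x x' : ℕ → ZMod p, (∀ t < k, x t = x' t) ∧
      w = fun a => ind (k + 1) x (u a) - ind (k + 1) x' (u a)

/-- All products of test functions of levels `i` and `j` sum to zero over the family. -/
def Bal (F : Fam p q α) (i j : ℕ) : Prop :=
  ∀ w, Test F.u i w → ∀ z, Test F.v j z → ∑ a ∈ F.S, w a * z a = 0

/-- The first index, capped at `m`, at which the two sequences differ is `k`. -/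
def Agr (m k : ℕ) (x x' : ℕ → ZMod p) : Prop :=
  (∀ t < k, x t = x' t) ∧ k ≤ m ∧ (k < m → x k ≠ x' k)

/-- The combinatorial form of one half of a spectral pair. -/
def HalfSP (m n : ℕ) (A : Fam p q α) (B : Fam p q β) : Prop :=
  ∀ a ∈ A.S, ∀ a' ∈ A.S, a ≠ a' → ∀ k l, Agr m k (A.u a) (A.u a') → Agr n l (A.v a) (A.v a') →
    Bal B (m - k) (n - l)

/-- The combinatorial form of a spectral pair. -/
structure SP (m n : ℕ) (A : Fam p q α) (B : Fam p q β) : Prop where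
  card_eq : A.S.card = B.S.card
  nonempty : A.S.Nonempty
  left : HalfSP m n A B
  right : HalfSP m n B A

/-- No two points of the family first differ at levels in `K ∪ {m}` and `L ∪ {n}`. -/
def Avoid (m n : ℕ) (F : Fam p q α) (K L : Finset ℕ) : Prop :=
  ∀ a ∈ F.S, ∀ a' ∈ F.S, a ≠ a' → ∀ k l, Agr m k (F.u a) (F.u a') → Agr n l (F.v a) (F.v a') →
    ¬ ((k = m ∨ k ∈ K) ∧ (l = n ∨ l ∈ L))

/-- Reflection of a set of levels. -/
def star (m : ℕ) (K : Finset ℕ) : Finset ℕ := (range m).filter fun k => m - 1 - k ∈ K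

/-- The family is a system of representatives modulo a digit subgroup, and so is its dual. -/
def DigitTile (m n : ℕ) (A : Fam p q α) (B : Fam p q β) : Prop :=
  ∃ K L : Finset ℕ, K ⊆ range m ∧ L ⊆ range n ∧
    A.S.card * (p ^ K.card * q ^ L.card) = p ^ m * q ^ n ∧
    Avoid m n A K L ∧ Avoid m n B (star m K) (star n L)

theorem mem_star {K : Finset ℕ} {k : ℕ} : k ∈ star m K ↔ k < m ∧ m - 1 - k ∈ K := by
  simp [star]

theorem star_subset (K : Finset ℕ) : star m K ⊆ range m := filter_subset _ _

theorem star_star {K : Finset ℕ} (h : K ⊆ range m) : star m (star m K) = K := by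
  ext k
  simp only [mem_star]
  constructor
  · rintro ⟨h1, h2, h3⟩
    rwa [show m - 1 - (m - 1 - k) = k by omega] at h3
  · intro hk
    have := mem_range.1 (h hk)
    refine ⟨this, by omega, ?_⟩
    rwa [show m - 1 - (m - 1 - k) = k by omega]

theorem card_star {K : Finset ℕ} (h : K ⊆ range m) : (star m K).card = K.card := by
  have key : ∀ K' : Finset ℕ, (star m K').card ≤ K'.card := fun K' => by
    refine card_le_card_of_injOn (fun k => m - 1 - k) (fun k hk => (mem_star.1 hk).2) ?_
    intro a ha b hb hab
    have ha' := (mem_star.1 ha).1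
    have hb' := (mem_star.1 hb).1
    simp only at hab
    omega
  refine le_antisymm (key K) ?_
  conv_lhs => rw [← star_star h]
  exact key _

theorem ind_self (k : ℕ) (x : ℕ → ZMod p) : ind k x x = 1 := by simp [ind]

theorem ind_zero (x y : ℕ → ZMod p) : ind 0 x y = 1 := by simp [ind]

theorem ind_nonneg (k : ℕ) (x y : ℕ → ZMod p) : 0 ≤ ind k x y := by
  unfold ind; split_ifs <;> simp

theorem ind_congr {k : ℕ} {x x' : ℕ → ZMod p} (h : ∀ t < k, x t = x' t) (y : ℕ → ZMod p) :
    ind k x y = ind k x' y := by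
  unfold ind
  congr 1
  exact propext (forall₂_congr fun t ht => by rw [h t ht])

theorem ind_congr_right {k : ℕ} {y y' : ℕ → ZMod p} (h : ∀ t < k, y t = y' t) (x : ℕ → ZMod p) :
    ind k x y = ind k x y' := by
  unfold ind
  congr 1
  exact propext (forall₂_congr fun t ht => by rw [h t ht])

theorem ind_succ (k : ℕ) (x y : ℕ → ZMod p) :
    ind (k + 1) x y = if y k = x k then ind k x y else 0 := by
  unfold ind
  by_cases h : y k = x k
  · simp only [h, if_true]
    congr 1
    exact propext ⟨fun H t ht => H t (by omega), fun H t ht => by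
      rcases Nat.lt_succ_iff_lt_or_eq.1 ht with h' | rfl
      · exact H t h'
      · exact h⟩
  · rw [if_neg h, if_neg]
    exact fun H => h (H k (by omega))

theorem ind_update (k : ℕ) (x y : ℕ → ZMod p) (c : ZMod p) :
    ind (k + 1) (Function.update x k c) y = if y k = c then ind k x y else 0 := by
  rw [ind_succ, Function.update_self]
  congr 1
  exact ind_congr (fun t ht => Function.update_of_ne ht.ne _ _) y

theorem update_agree (k : ℕ) (x : ℕ → ZMod p) (c c' : ZMod p) :
    ∀ t < k, Function.update x k c t = Function.update x k c' t := fun t ht => by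
  rw [Function.update_of_ne ht.ne, Function.update_of_ne ht.ne]

theorem sum_ind_update [NeZero p] (k : ℕ) (x y : ℕ → ZMod p) :
    ∑ c, ind (k + 1) (Function.update x k c) y = ind k x y := by
  simp [ind_update]

theorem ind_eq_one {k : ℕ} {x y : ℕ → ZMod p} : ind k x y = 1 ↔ ∀ t < k, y t = x t := by
  unfold ind; split_ifs with h <;> simp [h]
  simpa using h

theorem ind_eq_zero {k : ℕ} {x y : ℕ → ZMod p} : ind k x y = 0 ↔ ¬ ∀ t < k, y t = x t := by
  unfold ind; split_ifs with h <;> simp [h]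
  simpa using h

theorem exists_agr (m : ℕ) (x x' : ℕ → ZMod p) : ∃ k, Agr m k x x' := by
  by_cases h : ∀ t < m, x t = x' t
  · exact ⟨m, h, le_rfl, fun h => absurd h (lt_irrefl _)⟩
  · push Not at h
    have hk := Nat.find_spec h
    refine ⟨Nat.find h, fun t ht => ?_, hk.1.le, fun _ => hk.2⟩
    by_contra hne
    exact Nat.find_min h ht ⟨ht.trans hk.1, hne⟩

theorem Agr.symm {k : ℕ} {x x' : ℕ → ZMod p} (h : Agr m k x x') : Agr m k x' x :=
  ⟨fun t ht => (h.1 t ht).symm, h.2.1, fun hk => (h.2.2 hk).symm⟩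

theorem Agr.eq {k k' : ℕ} {x x' : ℕ → ZMod p} (h : Agr m k x x') (h' : Agr m k' x x') :
    k = k' := by
  rcases lt_trichotomy k k' with hlt | rfl | hlt
  · exact absurd (h'.1 k hlt) (h.2.2 (hlt.trans_le h'.2.1))
  · rfl
  · exact absurd (h.1 k' hlt) (h'.2.2 (hlt.trans_le h.2.1))

theorem agr_self (m : ℕ) (x : ℕ → ZMod p) : Agr m m x x :=
  ⟨fun _ _ => rfl, le_rfl, fun h => absurd h (lt_irrefl _)⟩

theorem Bal.swap {F : Fam p q α} {i j : ℕ} (h : Bal F i j) : Bal F.swap j i :=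
  fun w hw z hz => by
    rw [← h z hz w hw]
    exact sum_congr rfl fun a _ => mul_comm _ _

theorem HalfSP.swap {A : Fam p q α} {B : Fam p q β} (h : HalfSP m n A B) :
    HalfSP n m A.swap B.swap :=
  fun a ha a' ha' hne k l hk hl => (h a ha a' ha' hne l k hl hk).swap

theorem SP.swap {A : Fam p q α} {B : Fam p q β} (h : SP m n A B) : SP n m A.swap B.swap :=
  ⟨h.card_eq, h.nonempty, h.left.swap, h.right.swap⟩

theorem SP.symm {A : Fam p q α} {B : Fam p q β} (h : SP m n A B) : SP m n B A :=
  ⟨h.card_eq.symm, card_pos.1 (h.card_eq ▸ card_pos.2 h.nonempty), h.right, h.left⟩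

theorem Avoid.swap {F : Fam p q α} {K L : Finset ℕ} (h : Avoid m n F K L) :
    Avoid n m F.swap L K :=
  fun a ha a' ha' hne k l hk hl hkl => h a ha a' ha' hne l k hl hk ⟨hkl.2, hkl.1⟩

theorem DigitTile.swap {A : Fam p q α} {B : Fam p q β} (h : DigitTile m n A B) :
    DigitTile n m A.swap B.swap := by
  obtain ⟨K, L, hK, hL, hc, h1, h2⟩ := h
  exact ⟨L, K, hL, hK, by rw [mul_comm (q ^ _), mul_comm (q ^ _)]; exact hc, h1.swap, h2.swap⟩

theorem DigitTile.symm {A : Fam p q α} {B : Fam p q β} (hAB : A.S.card = B.S.card)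
    (h : DigitTile m n A B) : DigitTile m n B A := by
  obtain ⟨K, L, hK, hL, hc, h1, h2⟩ := h
  refine ⟨star m K, star n L, star_subset _, star_subset _, ?_, h2, ?_⟩
  · rw [card_star hK, card_star hL, ← hAB, hc]
  · rwa [star_star hK, star_star hL]

theorem not_bal_zero {F : Fam p q α} (h : F.S.Nonempty) : ¬ Bal F 0 0 := fun hb => by
  have := hb _ rfl _ rfl
  simp at this
  simp [this] at h

/-! ### Equidistribution and divisibility along the digit tree -/

theorem sum_ind_refine [NeZero p] (S : Finset α) (u : α → ℕ → ZMod p) (f : α → ℤ) (k : ℕ)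
    (x : ℕ → ZMod p) : ∑ a ∈ S, ind k x (u a) * f a =
      ∑ c, ∑ a ∈ S, ind (k + 1) (Function.update x k c) (u a) * f a := by
  rw [sum_comm]
  refine sum_congr rfl fun a _ => ?_
  rw [← sum_mul, sum_ind_update]

theorem null_mono [NeZero p] {S : Finset α} {u : α → ℕ → ZMod p} {f : α → ℤ} {k : ℕ}
    (h : ∀ x, ∑ a ∈ S, ind k x (u a) * f a = 0) {i : ℕ} (hi : i ≤ k) (x : ℕ → ZMod p) :
    ∑ a ∈ S, ind i x (u a) * f a = 0 := by
  induction k with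
  | zero => obtain rfl : i = 0 := by omega
            exact h x
  | succ k ih =>
    rcases Nat.lt_succ_iff_lt_or_eq.1 (Nat.lt_succ_of_le hi) with hlt | rfl
    · refine ih (fun x => ?_) (by omega)
      rw [sum_ind_refine]
      exact sum_eq_zero fun c _ => h _
    · exact h x

theorem test_null [NeZero p] {S : Finset α} {u : α → ℕ → ZMod p} {f : α → ℤ} {k : ℕ}
    (h : ∀ x, ∑ a ∈ S, ind k x (u a) * f a = 0) {i : ℕ} (hi : i ≤ k) {w : α → ℤ}
    (hw : Test u i w) : ∑ a ∈ S, w a * f a = 0 := by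
  cases i with
  | zero =>
    rw [← null_mono h hi 0]
    exact sum_congr rfl fun a _ => by rw [hw, ind_zero]
  | succ i =>
    obtain ⟨x, x', -, rfl⟩ := hw
    simp only [sub_mul, sum_sub_distrib]
    rw [null_mono h hi, null_mono h hi, sub_zero]

theorem equi_of_test {S : Finset α} {u : α → ℕ → ZMod p} {f : α → ℤ} {k : ℕ}
    (h : ∀ w, Test u (k + 1) w → ∑ a ∈ S, w a * f a = 0) (x x' : ℕ → ZMod p)
    (hx : ∀ t < k, x t = x' t) :
    ∑ a ∈ S, ind (k + 1) x (u a) * f a = ∑ a ∈ S, ind (k + 1) x' (u a) * f a := by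
  have := h _ ⟨x, x', hx, rfl⟩
  simpa only [sub_mul, sum_sub_distrib, sub_eq_zero] using this

theorem sum_eq_mul_of_test [NeZero p] {S : Finset α} {u : α → ℕ → ZMod p} {f : α → ℤ} {k : ℕ}
    (h : ∀ w, Test u (k + 1) w → ∑ a ∈ S, w a * f a = 0) (x : ℕ → ZMod p) :
    ∑ a ∈ S, ind k x (u a) * f a = p * ∑ a ∈ S, ind (k + 1) x (u a) * f a := by
  rw [sum_ind_refine, sum_congr rfl fun c _ => equi_of_test h (Function.update x k c) x
    fun t ht => Function.update_of_ne ht.ne _ _]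
  simp

/-- Going down the tree, each level in `D` splits a node sum into `p` equal parts and contributes a
factor `p`; at the other levels divisibility passes through the sum over the children. -/
theorem pow_dvd_of_test [NeZero p] {S : Finset α} {u : α → ℕ → ZMod p} {f : α → ℤ}
    {D : Finset ℕ} (h : ∀ k ∈ D, ∀ w, Test u (k + 1) w → ∑ a ∈ S, w a * f a = 0) (d i : ℕ)
    (x : ℕ → ZMod p) :
    (p : ℤ) ^ (D.filter fun t => i ≤ t ∧ t < i + d).card ∣ ∑ a ∈ S, ind i x (u a) * f a := by
  induction d generalizing i x with
  | zero =>
    rw [filter_false_of_mem fun t _ => by omega]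
    simp
  | succ d ih =>
    by_cases hi : i ∈ D
    · have : D.filter (fun t => i ≤ t ∧ t < i + (d + 1)) =
          insert i (D.filter fun t => i + 1 ≤ t ∧ t < i + 1 + d) := by
        ext t
        simp only [mem_filter, mem_insert]
        constructor
        · rintro ⟨h1, h2, h3⟩
          rcases h2.eq_or_lt with rfl | h2
          · exact Or.inl rfl
          · exact Or.inr ⟨h1, by omega, by omega⟩
        · rintro (rfl | ⟨h1, h2, h3⟩)
          · exact ⟨hi, le_rfl, by omega⟩
          · exact ⟨h1, by omega, by omega⟩
      rw [this, card_insert_of_notMem (by simp), pow_succ', sum_eq_mul_of_test (h i hi)]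
      exact mul_dvd_mul_left _ (ih _ _)
    · have : D.filter (fun t => i ≤ t ∧ t < i + (d + 1)) =
          D.filter fun t => i + 1 ≤ t ∧ t < i + 1 + d := by
        ext t
        simp only [mem_filter]
        constructor
        · rintro ⟨h1, h2, h3⟩
          have : t ≠ i := fun e => hi (e ▸ h1)
          exact ⟨h1, by omega, by omega⟩
        · rintro ⟨h1, h2, h3⟩
          exact ⟨h1, by omega, by omega⟩
      rw [this, sum_ind_refine]
      exact dvd_sum fun c _ => ih _ _

theorem card_le_of_separated [NeZero p] [NeZero q] {S : Finset α} {u : α → ℕ → ZMod p}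
    {v : α → ℕ → ZMod q} {I J : Finset ℕ}
    (h : ∀ a ∈ S, ∀ a' ∈ S, (∀ t ∈ I, u a t = u a' t) → (∀ t ∈ J, v a t = v a' t) → a = a') :
    S.card ≤ p ^ I.card * q ^ J.card := by
  have := card_le_card_of_injOn (s := S) (t := (univ : Finset ((I → ZMod p) × (J → ZMod q))))
    (fun a => (fun t => u a t, fun t => v a t)) (fun _ _ => mem_univ _) (by
      intro a ha a' ha' e
      simp only [Prod.mk.injEq] at e
      exact h a ha a' ha' (fun t ht => congrFun e.1 ⟨t, ht⟩) fun t ht => congrFun e.2 ⟨t, ht⟩)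
  simpa [ZMod.card] using this

/-! ### Size and balanced levels of digit tiles -/

theorem card_eq_of_mul (hp : 0 < p) (hq : 0 < q) {c : ℕ} {K L : Finset ℕ} (hK : K ⊆ range m)
    (hL : L ⊆ range n) (hc : c * (p ^ K.card * q ^ L.card) = p ^ m * q ^ n) :
    c = p ^ (m - K.card) * q ^ (n - L.card) := by
  have hKm : K.card ≤ m := by simpa using card_le_card hK
  have hLn : L.card ≤ n := by simpa using card_le_card hL
  apply Nat.eq_of_mul_eq_mul_right (show 0 < p ^ K.card * q ^ L.card by positivity)
  rw [hc]
  calc p ^ m * q ^ n = p ^ (m - K.card + K.card) * q ^ (n - L.card + L.card) := by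
        rw [Nat.sub_add_cancel hKm, Nat.sub_add_cancel hLn]
    _ = _ := by rw [pow_add, pow_add]; ring

/-- Points whose digit `k` is a prescribed function of the earlier digits are separated by the
remaining digits outside `K` and `L`, so there are at most `|F| / p` of them. The `p` shifts of the
prescription partition `F`, hence equality holds throughout. -/
theorem bal_of_notMem [hp : Fact p.Prime] [hq : Fact q.Prime] {F : Fam p q α}
    {K L : Finset ℕ} (hK : K ⊆ range m) (hL : L ⊆ range n)
    (hc : F.S.card * (p ^ K.card * q ^ L.card) = p ^ m * q ^ n) (hF : Avoid m n F K L) {k : ℕ}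
    (hk : k < m) (hkK : k ∉ K) : Bal F (k + 1) 0 := by
  have hp0 := hp.out.pos
  have hcard := card_eq_of_mul hp0 hq.out.pos hK hL hc
  have hle : ∀ c : (ℕ → ZMod p) → ZMod p, (∀ x x', (∀ t < k, x t = x' t) → c x = c x') →
      p * (F.S.filter fun a => F.u a k = c (F.u a)).card ≤ F.S.card := fun c hcc => by
    have h1 : (F.S.filter fun a => F.u a k = c (F.u a)).card ≤
        p ^ (range m \ insert k K).card * q ^ (range n \ L).card := by
      refine card_le_of_separated (u := F.u) (v := F.v) fun a ha a' ha' h1 h2 => ?_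
      simp only [mem_filter] at ha ha'
      by_contra hne
      obtain ⟨k', hk'⟩ := exists_agr m (F.u a) (F.u a')
      obtain ⟨l', hl'⟩ := exists_agr n (F.v a) (F.v a')
      refine hF a ha.1 a' ha'.1 hne k' l' hk' hl' ⟨?_, ?_⟩
      · rcases hk'.2.1.eq_or_lt with e | hlt
        · exact Or.inl e
        · right
          by_contra hkK'
          have hkk : k' ≠ k := by
            rintro rfl
            exact hk'.2.2 hlt (by rw [ha.2, ha'.2]; exact hcc _ _ hk'.1)
          exact hk'.2.2 hlt (h1 k' (by simp [hlt, hkk, hkK']))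
      · rcases hl'.2.1.eq_or_lt with e | hlt
        · exact Or.inl e
        · right
          by_contra hlL
          exact hl'.2.2 hlt (h2 l' (by simp [hlt, hlL]))
    have hIK : (range m \ insert k K).card + 1 = m - K.card := by
      rw [card_sdiff_of_subset (insert_subset (by simpa using hk) hK),
        card_insert_of_notMem hkK, card_range]
      have : (insert k K).card ≤ m := by
        simpa using card_le_card (insert_subset (by simpa using hk) hK)
      rw [card_insert_of_notMem hkK] at this
      omega
    have hJ : (range n \ L).card = n - L.card := by
      rw [card_sdiff_of_subset hL, card_range]
    calc _ ≤ p * (p ^ (range m \ insert k K).card * q ^ (range n \ L).card) :=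
          Nat.mul_le_mul_left _ h1
      _ = F.S.card := by rw [hcard, ← hIK, hJ, pow_succ]; ring
  have heq : ∀ c : (ℕ → ZMod p) → ZMod p, (∀ x x', (∀ t < k, x t = x' t) → c x = c x') →
      p * (F.S.filter fun a => F.u a k = c (F.u a)).card = F.S.card := fun c hcc => by
    have hsum : ∑ e : ZMod p, p * (F.S.filter fun a => F.u a k = c (F.u a) + e).card =
        ∑ e : ZMod p, F.S.card := by
      rw [← mul_sum, sum_const, card_univ, ZMod.card, smul_eq_mul]
      congr 1
      rw [card_eq_sum_card_fiberwise (f := fun a => F.u a k - c (F.u a)) (t := univ)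
        fun _ _ => mem_coe.2 (mem_univ _)]
      refine sum_congr rfl fun e _ => ?_
      congr 1
      exact filter_congr fun a _ => by rw [sub_eq_iff_eq_add']
    have h2 := (sum_eq_sum_iff_of_le fun e _ => hle (fun x => c x + e) fun x x' h => by
      rw [hcc x x' h]).1 hsum 0 (mem_univ _)
    simpa using h2
  rintro w ⟨x, x', hx, rfl⟩ z rfl
  have hval : ∀ c : (ℕ → ZMod p) → ZMod p, (∀ x x', (∀ t < k, x t = x' t) → c x = c x') →
      (p : ℤ) * ∑ a ∈ F.S, (if F.u a k = c (F.u a) then 1 else 0) = F.S.card := fun c hcc => by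
    have := heq c hcc
    rw [sum_boole]
    exact_mod_cast this
  have hind : ∀ y y' : ℕ → ZMod p, (∀ t < k, y t = y' t) → ∀ e : ZMod p,
      (if ∀ t < k, y t = x t then e else 0) = (if ∀ t < k, y' t = x t then e else 0) := by
    intro y y' hy e
    congr 1
    exact propext (forall₂_congr fun t ht => by rw [hy t ht])
  -- Two prescriptions that differ only on the node of `x` select equally many points; the
  -- difference of their indicators is the test function.
  have e1 := hval (fun y => if ∀ t < k, y t = x t then x k else 0)
    fun y y' hy => hind y y' hy _
  have e2 := hval (fun y => if ∀ t < k, y t = x t then x' k else 0)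
    fun y y' hy => hind y y' hy _
  have hp' : (p : ℤ) ≠ 0 := by exact_mod_cast hp0.ne'
  have e3 := mul_left_cancel₀ hp' (e1.trans e2.symm)
  rw [← sub_eq_zero, ← sum_sub_distrib] at e3
  rw [← e3]
  refine sum_congr rfl fun a _ => ?_
  beta_reduce
  rw [mul_one, ind_succ, ind_succ, ← ind_congr hx]
  by_cases ha : ∀ t < k, F.u a t = x t
  · rw [ind_eq_one.2 ha, if_pos ha, if_pos ha]
  · rw [ind_eq_zero.2 ha, if_neg ha, if_neg ha]
    simp

/-- In a digit tile the levels of equidistribution are the levels outside `K`. -/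
theorem bal_iff_notMem [hp : Fact p.Prime] [hq : Fact q.Prime] (hpq : p ≠ q) {F : Fam p q α}
    {K L : Finset ℕ} (hK : K ⊆ range m) (hL : L ⊆ range n)
    (hc : F.S.card * (p ^ K.card * q ^ L.card) = p ^ m * q ^ n) (hF : Avoid m n F K L) {k : ℕ}
    (hk : k < m) : Bal F (k + 1) 0 ↔ k ∉ K := by
  refine ⟨fun hb hkK => ?_, bal_of_notMem hK hL hc hF hk⟩
  have hdvd := pow_dvd_of_test (S := F.S) (u := F.u) (f := fun _ => 1)
    (D := insert k (range m \ K)) (fun t ht w hw => by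
      rcases mem_insert.1 ht with rfl | ht
      · exact hb w hw _ rfl
      · have hmem := mem_sdiff.1 ht
        exact bal_of_notMem hK hL hc hF (mem_range.1 hmem.1) hmem.2 w hw _ rfl) m 0 0
  have hKm : K.card ≤ m := by simpa using card_le_card hK
  rw [filter_true_of_mem, card_insert_of_notMem (by simp [hkK]), card_sdiff_of_subset hK,
    card_range] at hdvd
  · simp only [ind_zero, mul_one, sum_const, nsmul_eq_mul] at hdvd
    rw [card_eq_of_mul hp.out.pos hq.out.pos hK hL hc] at hdvd
    have h1 : p ^ (m - K.card + 1) ∣ p ^ (m - K.card) * q ^ (n - L.card) := by exact_mod_cast hdvd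
    rw [pow_succ] at h1
    have h2 := Nat.dvd_of_mul_dvd_mul_left (pow_pos hp.out.pos _) h1
    exact hpq ((Nat.prime_dvd_prime_iff_eq hp.out hq.out).1 (hp.out.dvd_of_dvd_pow h2))
  · intro t ht
    rcases mem_insert.1 ht with rfl | ht
    · omega
    · have := mem_range.1 (mem_sdiff.1 ht).1
      omega

/-! ### First reduction: deleting a digit that never branches -/

/-- Deletion of a digit. -/
def del (k : ℕ) (x : ℕ → ZMod p) (t : ℕ) : ZMod p := if t < k then x t else x (t + 1)

/-- Insertion of a digit. -/
def ins (k : ℕ) (c : ZMod p) (x : ℕ → ZMod p) (t : ℕ) : ZMod p :=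
  if t < k then x t else if t = k then c else x (t - 1)

/-- The family with one `p`-digit deleted. -/
def Fam.delU (F : Fam p q α) (k : ℕ) : Fam p q α := ⟨F.S, fun a => del k (F.u a), F.v⟩

/-- The subfamily of the points whose `d`-th `p`-digit is the one chosen by `s`. -/
noncomputable def Fam.sub (F : Fam p q α) (d : ℕ) (s : (ℕ → ZMod p) → ZMod p) : Fam p q α :=
  ⟨F.S.filter fun a => F.u a d = s (F.u a), F.u, F.v⟩

theorem ind_del_of_le {i k : ℕ} (h : i ≤ k) (x y : ℕ → ZMod p) : ind i x (del k y) = ind i x y :=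
  ind_congr_right (fun t ht => by simp [del, ht.trans_le h]) x

theorem ind_del_of_ge {i k : ℕ} (h : k ≤ i) (x y : ℕ → ZMod p) (c : ZMod p) :
    ind (i + 1) (ins k c x) y = if y k = c then ind i x (del k y) else 0 := by
  by_cases hc : y k = c
  · rw [if_pos hc]
    unfold ind
    congr 1
    refine propext ⟨fun H t ht => ?_, fun H t ht => ?_⟩
    · unfold del
      split_ifs with h1
      · rw [H t (by omega), ins, if_pos h1]
      · rw [H (t + 1) (by omega), ins, if_neg (by omega), if_neg (by omega)]
        rfl
    · unfold ins
      split_ifs with h1 h2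
      · simpa [del, h1] using H t (by omega)
      · rw [h2, hc]
      · have := H (t - 1) (by omega)
        rw [del, if_neg (by omega), Nat.sub_add_cancel (by omega)] at this
        exact this
  · rw [if_neg hc, ind_eq_zero]
    intro H
    apply hc
    rw [H k (by omega)]
    simp [ins]

theorem test_del_of_le {u : α → ℕ → ZMod p} {i k : ℕ} (h : i ≤ k) {w : α → ℤ}
    (hw : Test (fun a => del k (u a)) i w) : Test u i w := by
  cases i with
  | zero => exact hw
  | succ i =>
    obtain ⟨x, x', hx, rfl⟩ := hw
    exact ⟨x, x', hx, funext fun a => by simp only [ind_del_of_le h]⟩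

theorem Bal.del_of_le {F : Fam p q α} {i j k : ℕ} (hb : Bal F i j) (h : i ≤ k) :
    Bal (F.delU k) i j :=
  fun w hw z hz => hb w (test_del_of_le h hw) z hz

theorem ins_agree {k i : ℕ} (h : k ≤ i) {x x' : ℕ → ZMod p} (hx : ∀ t < i, x t = x' t)
    (c : ZMod p) : ∀ t < i + 1, ins k c x t = ins k c x' t := by
  intro t ht
  unfold ins
  split_ifs
  · exact hx t (by omega)
  · rfl
  · exact hx _ (by omega)

/-- Summing over all values of the deleted digit turns test functions one level higher into a test
function of the shortened digits. -/
theorem Bal.del_of_lt [NeZero p] {F : Fam p q α} {i j k : ℕ} (hb : Bal F (i + 1) j) (h : k < i) :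
    Bal (F.delU k) i j := by
  intro w hw z hz
  cases i with
  | zero => omega
  | succ i =>
    obtain ⟨x, x', hx, rfl⟩ := hw
    have key : ∀ c, ∑ a ∈ F.S, (ind (i + 2) (ins k c x) (F.u a) - ind (i + 2) (ins k c x') (F.u a))
        * z a = 0 := fun c => hb _ ⟨_, _, ins_agree (by omega) hx c, rfl⟩ z hz
    rw [← sum_eq_zero fun c (_ : c ∈ univ) => key c, sum_comm]
    refine sum_congr rfl fun a _ => ?_
    simp only [ind_del_of_ge h.le]
    rw [← sum_mul]
    simp [Fam.delU, sum_sub_distrib]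

theorem agr_del {k l : ℕ} (hk : k ≤ m) {x x' : ℕ → ZMod p} (h : Agr m l (del k x) (del k x')) :
    ∃ κ, Agr (m + 1) κ x x' ∧ (κ < k ∧ l = κ ∨ κ = k ∧ k ≤ l ∨ k < κ ∧ l + 1 = κ) := by
  obtain ⟨κ, hκ⟩ := exists_agr (m + 1) x x'
  refine ⟨κ, hκ, ?_⟩
  rcases lt_trichotomy κ k with hlt | rfl | hlt
  · refine Or.inl ⟨hlt, h.eq ⟨fun t ht => ?_, by omega, fun _ => ?_⟩⟩
    · simp only [del, ht.trans hlt, if_true]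
      exact hκ.1 t ht
    · simp only [del, hlt, if_true]
      exact hκ.2.2 (by omega)
  · refine Or.inr (Or.inl ⟨rfl, ?_⟩)
    by_contra hlt
    refine h.2.2 (by omega) ?_
    simp only [del, if_pos (not_le.1 hlt)]
    exact hκ.1 l (by omega)
  · refine Or.inr (Or.inr ⟨hlt, ?_⟩)
    have := h.eq (k' := κ - 1) ⟨fun t ht => ?_, ?_, fun hm => ?_⟩
    · omega
    · unfold del
      split_ifs
      · exact hκ.1 t (by omega)
      · exact hκ.1 _ (by omega)
    · have := hκ.2.1; omega
    · rw [del, del, if_neg (by omega), if_neg (by omega), Nat.sub_add_cancel (by omega)]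
      exact hκ.2.2 (by omega)

/-- If no pair first differs at digit `k`, then the digit `k` carries no information. -/
theorem null_of_determined [hp : Fact p.Prime] {B : Fam p q β} {k j : ℕ}
    (hB : ∀ b ∈ B.S, ∀ b' ∈ B.S, (∀ t < k, B.u b t = B.u b' t) → B.u b k = B.u b' k)
    (hb : Bal B (k + 1) j) {z : β → ℤ} (hz : Test B.v j z) (x : ℕ → ZMod p) :
    ∑ b ∈ B.S, ind k x (B.u b) * z b = 0 := by
  by_cases h : ∃ b ∈ B.S, ∀ t < k, B.u b t = x t
  · obtain ⟨b, hbS, hbx⟩ := h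
    have e1 : ∀ b' ∈ B.S, ind k x (B.u b') = ind (k + 1) (B.u b) (B.u b') := by
      intro b' hb'
      rw [ind_succ, ← ind_congr hbx]
      split_ifs with h1
      · rfl
      · rw [ind_eq_zero]
        exact fun H => h1 (hB b' hb' b hbS H)
    have e2 : ∀ b' ∈ B.S, ind (k + 1) (Function.update (B.u b) k (B.u b k + 1)) (B.u b') = 0 := by
      intro b' hb'
      rw [ind_update, ite_eq_right_iff]
      intro h1
      rw [ind_eq_zero]
      intro H
      rw [hB b' hb' b hbS H] at h1
      exact one_ne_zero (left_eq_add.1 h1)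
    rw [sum_congr rfl fun b' hb' => by rw [e1 b' hb']]
    rw [equi_of_test (S := B.S) (f := z) (fun w hw => hb w hw z hz) (B.u b)
      (Function.update (B.u b) k (B.u b k + 1))
      fun t ht => (Function.update_of_ne ht.ne _ _).symm]
    exact sum_eq_zero fun b' hb' => by rw [e2 b' hb', zero_mul]
  · push Not at h
    refine sum_eq_zero fun b hb' => ?_
    rw [ind_eq_zero.2, zero_mul]
    intro H
    obtain ⟨t, ht, hne⟩ := h b hb'
    exact hne (H t ht)

theorem determined_of_not_agr {B : Fam p q β} {k : ℕ} (hk : k ≤ m)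
    (hB : ∀ b ∈ B.S, ∀ b' ∈ B.S, ¬ Agr (m + 1) k (B.u b) (B.u b')) :
    ∀ b ∈ B.S, ∀ b' ∈ B.S, (∀ t < k, B.u b t = B.u b' t) → B.u b k = B.u b' k :=
  fun b hb b' hb' h => by_contra fun hne => hB b hb b' hb' ⟨h, by omega, fun _ => hne⟩

/-- The critical pairs of `A` are those that first differ at the deleted digit, since their new
first difference may lie anywhere beyond. For them digit `k` of `B` is both balanced and determined
by the earlier digits, so all node sums up to level `k` vanish, and any balance that could be
demanded holds. -/
theorem SP.delU [hp : Fact p.Prime] {A : Fam p q α} {B : Fam p q β} (h : SP (m + 1) n A B) {k : ℕ}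
    (hk : k ≤ m) (hB : ∀ b ∈ B.S, ∀ b' ∈ B.S, ¬ Agr (m + 1) k (B.u b) (B.u b')) :
    SP m n (A.delU (m - k)) (B.delU k) where
  card_eq := h.card_eq
  nonempty := h.nonempty
  left := by
    intro a ha a' ha' hne κ l hκ hl
    obtain ⟨κ', hκ', hc⟩ := agr_del (by omega) hκ
    have hb := h.left a ha a' ha' hne κ' l hκ' hl
    have := hκ.2.1
    rcases hc with ⟨h1, rfl⟩ | ⟨rfl, h1⟩ | ⟨h1, rfl⟩
    · refine Bal.del_of_lt ?_ (by omega)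
      rwa [show m - κ + 1 = m + 1 - κ by omega]
    · rw [show m + 1 - (m - k) = k + 1 by omega] at hb
      intro w hw z hz
      exact test_null (null_of_determined (determined_of_not_agr hk hB) hb hz) (by omega)
        (test_del_of_le (by omega) hw)
    · refine Bal.del_of_le ?_ (by omega)
      rwa [show m - κ = m + 1 - (κ + 1) by omega]
  right := by
    intro b hb b' hb' hne κ l hκ hl
    obtain ⟨κ', hκ', hc⟩ := agr_del (by omega) hκ
    have hbal := h.right b hb b' hb' hne κ' l hκ' hl
    have := hκ.2.1
    rcases hc with ⟨h1, rfl⟩ | ⟨rfl, h1⟩ | ⟨h1, rfl⟩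
    · refine Bal.del_of_lt ?_ (by omega)
      rwa [show m - κ + 1 = m + 1 - κ by omega]
    · exact absurd hκ' (hB b hb b' hb')
    · refine Bal.del_of_le ?_ (by omega)
      rwa [show m - κ = m + 1 - (κ + 1) by omega]

/-- Levels below `d` stay, the others move up by one. -/
def up (d t : ℕ) : ℕ := if t < d then t else t + 1

theorem up_injective (d : ℕ) : Function.Injective (up d) := by
  intro a b h
  unfold up at h
  split_ifs at h <;> omega

theorem up_ne (d t : ℕ) : up d t ≠ d := by
  unfold up
  split_ifs <;> omega

theorem up_lt {d t : ℕ} (h : t < m) : up d t < m + 1 := by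
  unfold up
  split_ifs <;> omega

theorem DigitTile.of_delU [hp : Fact p.Prime] [hq : Fact q.Prime] (hpq : p ≠ q)
    {A : Fam p q α} {B : Fam p q β} (h : SP (m + 1) n A B) {k : ℕ} (hk : k ≤ m)
    (hB : ∀ b ∈ B.S, ∀ b' ∈ B.S, ¬ Agr (m + 1) k (B.u b) (B.u b'))
    (hT : DigitTile m n (A.delU (m - k)) (B.delU k)) : DigitTile (m + 1) n A B := by
  obtain ⟨K, L, hK, hL, hc, h1, h2⟩ := hT
  have hnot : m - k ∉ K.image (up (m - k)) := by
    simp only [mem_image, not_exists, not_and]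
    exact fun t _ => up_ne _ _
  refine ⟨insert (m - k) (K.image (up (m - k))), L, ?_, hL, ?_, ?_, ?_⟩
  · intro t ht
    simp only [mem_insert, mem_image] at ht
    rcases ht with rfl | ⟨t, ht, rfl⟩
    · simp
    · exact mem_range.2 (up_lt (mem_range.1 (hK ht)))
  · rw [card_insert_of_notMem hnot, card_image_of_injective _ (up_injective _), pow_succ, pow_succ]
    calc _ = A.S.card * (p ^ K.card * q ^ L.card) * p := by ring
      _ = p ^ m * q ^ n * p := by rw [← hc]; rfl
      _ = _ := by ring
  · intro a ha a' ha' hne κ l hκ hl ⟨h3, h4⟩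
    obtain ⟨κ', hκ'⟩ := exists_agr m (del (m - k) (A.u a)) (del (m - k) (A.u a'))
    obtain ⟨κ₁, hκ₁, hcs⟩ := agr_del (by omega) hκ'
    obtain rfl := hκ₁.eq hκ
    have := hκ.2.1
    have := hκ'.2.1
    by_cases hd : κ₁ = m - k
    · subst hd
      have hb := h.left a ha a' ha' hne _ _ hκ hl
      rw [show m + 1 - (m - k) = k + 1 by omega] at hb
      -- The same collapse lowers the `p`-level to `0`. This leaves a balance of `B` in the
      -- `q`-digits alone, at a level which its digit tile forbids, or at level `0`, where it would
      -- make `B` empty.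
      have hb0 : Bal (B.delU k) 0 (n - l) := fun w hw z hz =>
        test_null (null_of_determined (determined_of_not_agr hk hB) hb hz) (Nat.zero_le _) (test_del_of_le (Nat.zero_le _) hw)
      rcases h4 with rfl | h4
      · rw [Nat.sub_self] at hb0
        exact not_bal_zero h.symm.nonempty hb0
      · have hln := mem_range.1 (hL h4)
        rw [show n - l = (n - 1 - l) + 1 by omega] at hb0
        have hc' : (B.delU k).swap.S.card * (q ^ (star n L).card * p ^ (star m K).card) =
            q ^ n * p ^ m := by
          rw [card_star hK, card_star hL, mul_comm (q ^ n), ← hc, mul_comm (q ^ _)]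
          congr 1
          exact h.card_eq.symm
        have h5 := (bal_iff_notMem hpq.symm (star_subset L) (star_subset K) hc' h2.swap
          (k := n - 1 - l) (by omega)).1 hb0.swap
        refine h5 (mem_star.2 ⟨by omega, ?_⟩)
        rwa [show n - 1 - (n - 1 - l) = l by omega]
    · refine h1 a ha a' ha' hne κ' l hκ' hl ⟨?_, h4⟩
      simp only [mem_insert, mem_image, hd, false_or] at h3
      rcases h3 with h3 | ⟨t, ht, h3⟩
      · left; omega
      · right
        have : t = κ' := by unfold up at h3; split_ifs at h3 <;> omega
        rwa [← this]
  · intro b hb b' hb' hne κ l hκ hl ⟨h3, h4⟩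
    obtain ⟨κ', hκ'⟩ := exists_agr m (del k (B.u b)) (del k (B.u b'))
    obtain ⟨κ₁, hκ₁, hcs⟩ := agr_del (by omega) hκ'
    obtain rfl := hκ₁.eq hκ
    have := hκ.2.1
    have := hκ'.2.1
    have hd : κ₁ ≠ k := by
      rintro rfl
      exact hB b hb b' hb' hκ
    refine h2 b hb b' hb' hne κ' l hκ' hl ⟨?_, h4⟩
    simp only [mem_star, mem_insert, mem_image] at h3
    rcases h3 with h3 | ⟨h3, h3' | ⟨t, ht, h3'⟩⟩
    · left; omega
    · omega
    · right
      have htm := mem_range.1 (hK ht)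
      have : t = m - 1 - κ' ∧ κ' < m := by unfold up at h3'; split_ifs at h3' <;> omega
      rw [mem_star, ← this.1]
      exact ⟨this.2, ht⟩

/-! ### Second reduction: slicing along a free digit -/

/-- Digit `d` is free: at every cell the counts do not depend on it. -/
def Free (n : ℕ) (F : Fam p q α) (d : ℕ) : Prop := ∀ j ≤ n, Bal F (d + 1) j

/-- Level `0` makes the total zero; each further level makes the children of a node equal, and they
add up to zero. -/
theorem ind_null [NeZero q] {S : Finset α} {v : α → ℕ → ZMod q} {f : α → ℤ}
    (h : ∀ j ≤ n, ∀ z, Test v j z → ∑ a ∈ S, z a * f a = 0) {j : ℕ} (hj : j ≤ n)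
    (y : ℕ → ZMod q) : ∑ a ∈ S, ind j y (v a) * f a = 0 := by
  induction j generalizing y with
  | zero => simpa [ind_zero] using h 0 hj _ rfl
  | succ j ih =>
    have h1 := sum_eq_mul_of_test (fun z hz => h (j + 1) hj z hz) y
    rw [ih (by omega)] at h1
    have hq : (q : ℤ) ≠ 0 := by exact_mod_cast NeZero.ne q
    exact (mul_eq_zero.1 h1.symm).resolve_left hq

theorem Free.ind_eq [NeZero q] {F : Fam p q α} {d : ℕ} (h : Free n F d) {j : ℕ} (hj : j ≤ n)
    {x x' : ℕ → ZMod p} (hx : ∀ t < d, x t = x' t) (y : ℕ → ZMod q) :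
    ∑ a ∈ F.S, ind (d + 1) x (F.u a) * ind j y (F.v a) =
      ∑ a ∈ F.S, ind (d + 1) x' (F.u a) * ind j y (F.v a) := by
  have := ind_null (S := F.S) (v := F.v)
    (f := fun a => ind (d + 1) x (F.u a) - ind (d + 1) x' (F.u a))
    (fun j hj z hz => by
      rw [← h j hj _ ⟨x, x', hx, rfl⟩ z hz]
      exact sum_congr rfl fun a _ => mul_comm _ _) hj y
  rw [← sub_eq_zero, ← sum_sub_distrib, ← this]
  exact sum_congr rfl fun a _ => by ring

/-- A free digit can be changed without leaving a `q`-node, so `a'` can be replaced by a point that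
branches off at `d` and keeps its `q`-level. -/
theorem Free.exists_agr [hp : Fact p.Prime] [NeZero q] {F : Fam p q α} {d : ℕ}
    (h : Free n F d) (hd : d < m) {a a' : α} (ha' : a' ∈ F.S)
    (haa : ∀ t < d + 1, F.u a' t = F.u a t) {l : ℕ} (hl : Agr n l (F.v a) (F.v a')) :
    ∃ a'' ∈ F.S, Agr m d (F.u a) (F.u a'') ∧ Agr n l (F.v a) (F.v a'') := by
  have key : ∀ j ≤ n, ∃ a'' ∈ F.S, (∀ t < d, F.u a t = F.u a'' t) ∧ F.u a d ≠ F.u a'' d ∧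
      ∀ t < j, F.v a'' t = F.v a' t := by
    intro j hj
    have h1 := h.ind_eq hj (x := F.u a) (x' := Function.update (F.u a) d (F.u a d + 1))
      (fun t ht => (Function.update_of_ne ht.ne _ _).symm) (F.v a')
    have h2 : 0 < ∑ b ∈ F.S, ind (d + 1) (F.u a) (F.u b) * ind j (F.v a') (F.v b) := by
      refine sum_pos' (fun b _ => mul_nonneg (ind_nonneg _ _ _) (ind_nonneg _ _ _)) ⟨a', ha', ?_⟩
      rw [ind_eq_one.2 haa, ind_self]
      norm_num
    rw [h1] at h2
    obtain ⟨b, hb, hne⟩ := exists_ne_zero_of_sum_ne_zero h2.ne'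
    have hu : ind (d + 1) (Function.update (F.u a) d (F.u a d + 1)) (F.u b) ≠ 0 :=
      left_ne_zero_of_mul hne
    have hv : ind j (F.v a') (F.v b) ≠ 0 := right_ne_zero_of_mul hne
    rw [Ne, ind_eq_zero, not_not] at hu hv
    refine ⟨b, hb, fun t ht => ?_, ?_, hv⟩
    · rw [hu t (by omega), Function.update_of_ne ht.ne]
    · rw [hu d (by omega), Function.update_self]
      exact fun e => one_ne_zero (left_eq_add.1 e)
  by_cases hln : l = n
  · subst hln
    obtain ⟨b, hb, h1, h2, h3⟩ := key l le_rfl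
    exact ⟨b, hb, ⟨h1, hd.le, fun _ => h2⟩, fun t ht => by rw [h3 t ht, hl.1 t ht], le_rfl,
      fun h => absurd h (lt_irrefl _)⟩
  · have hln' : l < n := lt_of_le_of_ne hl.2.1 hln
    obtain ⟨b, hb, h1, h2, h3⟩ := key (l + 1) hln'
    exact ⟨b, hb, ⟨h1, hd.le, fun _ => h2⟩,
      fun t ht => by rw [h3 t (by omega), hl.1 t ht], hl.2.1,
      fun h => by rw [h3 l (by omega)]; exact hl.2.2 h⟩

section sub

variable {F : Fam p q α} {d : ℕ} {s : (ℕ → ZMod p) → ZMod p}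

/-- The `p` children of a node of level `d` carry equal sums, so whichever one `s` selects carries
exactly one `p`-th. -/
theorem sub_sum_ind [NeZero p] (hs : ∀ x x', (∀ t < d, x t = x' t) → s x = s x') {z : α → ℤ}
    (h : ∀ w, Test F.u (d + 1) w → ∑ a ∈ F.S, w a * z a = 0) {i : ℕ} (hi : i ≤ d)
    (x : ℕ → ZMod p) :
    (p : ℤ) * ∑ a ∈ (F.sub d s).S, ind i x (F.u a) * z a = ∑ a ∈ F.S, ind i x (F.u a) * z a := by
  have top : ∀ x, (p : ℤ) * ∑ a ∈ (F.sub d s).S, ind d x (F.u a) * z a =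
      ∑ a ∈ F.S, ind d x (F.u a) * z a := by
    intro x
    rw [sum_eq_mul_of_test h, ← equi_of_test h (Function.update x d (s x)) x
      fun t ht => Function.update_of_ne ht.ne _ _]
    congr 1
    change ∑ a ∈ F.S.filter _, _ = _
    rw [sum_filter]
    refine sum_congr rfl fun a _ => ?_
    rw [ind_update]
    by_cases hx : ∀ t < d, F.u a t = x t
    · rw [hs _ _ hx]
      split_ifs <;> simp
    · rw [ind_eq_zero.2 hx]
      simp
  induction hn : d - i generalizing i x with
  | zero =>
    obtain rfl : i = d := by omega
    exact top x
  | succ k ih =>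
    rw [sum_ind_refine, sum_ind_refine F.S, mul_sum]
    exact sum_congr rfl fun c _ => ih (by omega) _ (by omega)

theorem Bal.sub_of_le [NeZero p] (hs : ∀ x x', (∀ t < d, x t = x' t) → s x = s x') {i j : ℕ}
    (hd : Bal F (d + 1) j) (hi : i ≤ d) (hb : Bal F i j) : Bal (F.sub d s) i j := by
  intro w hw z hz
  have hz' : ∀ w, Test F.u (d + 1) w → ∑ a ∈ F.S, w a * z a = 0 := fun w hw => hd w hw z hz
  have hp : (p : ℤ) ≠ 0 := by exact_mod_cast NeZero.ne p
  have key : (p : ℤ) * ∑ a ∈ (F.sub d s).S, w a * z a = ∑ a ∈ F.S, w a * z a := by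
    cases i with
    | zero =>
      have := sub_sum_ind hs hz' hi 0
      simp only [ind_zero] at this
      obtain rfl := hw
      exact this
    | succ i =>
      obtain ⟨x, x', -, rfl⟩ := hw
      simp only [sub_mul, sum_sub_distrib, mul_sub]
      exact congrArg₂ _ (sub_sum_ind hs hz' hi x) (sub_sum_ind hs hz' hi x')
  rw [hb w hw z hz] at key
  exact (mul_eq_zero.1 key).resolve_left hp

/-- Siblings above level `d + 1` share digit `d`, so the slice contains both nodes entirely or
misses both. -/
theorem Bal.sub_of_gt (hs : ∀ x x', (∀ t < d, x t = x' t) → s x = s x') {i j : ℕ}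
    (hi : d + 1 < i) (hb : Bal F i j) : Bal (F.sub d s) i j := by
  intro w hw z hz
  obtain ⟨i, rfl⟩ : ∃ k, i = k + 1 := ⟨i - 1, by omega⟩
  obtain ⟨x, x', hx, rfl⟩ := hw
  have key : ∀ x : ℕ → ZMod p, ∑ a ∈ (F.sub d s).S, ind (i + 1) x (F.u a) * z a =
      if x d = s x then ∑ a ∈ F.S, ind (i + 1) x (F.u a) * z a else 0 := by
    intro x
    change ∑ a ∈ F.S.filter _, _ = _
    have hcond : ∀ a, (∀ t < i + 1, F.u a t = x t) → (F.u a d = s (F.u a) ↔ x d = s x) := by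
      intro a ha
      rw [ha d (by omega), hs (F.u a) x fun t ht => ha t (by omega)]
    rw [sum_filter]
    split_ifs with hc
    · refine sum_congr rfl fun a _ => ?_
      by_cases ha : ∀ t < i + 1, F.u a t = x t
      · rw [if_pos ((hcond a ha).2 hc)]
      · rw [ind_eq_zero.2 ha]; simp
    · refine sum_eq_zero fun a _ => ?_
      by_cases ha : ∀ t < i + 1, F.u a t = x t
      · rw [if_neg fun h => hc ((hcond a ha).1 h)]
      · rw [ind_eq_zero.2 ha]; simp
  have h0 := hb _ ⟨x, x', hx, rfl⟩ z hz
  simp only [sub_mul, sum_sub_distrib] at h0 ⊢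
  change ∑ a ∈ (F.sub d s).S, ind (i + 1) x (F.u a) * z a -
    ∑ a ∈ (F.sub d s).S, ind (i + 1) x' (F.u a) * z a = 0
  rw [key, key, hx d (by omega), hs x x' fun t ht => hx t (by omega)]
  split_ifs
  · exact h0
  · simp

end sub

theorem mem_sub {F : Fam p q α} {d : ℕ} {s : (ℕ → ZMod p) → ZMod p} {a : α} :
    a ∈ (F.sub d s).S ↔ a ∈ F.S ∧ F.u a d = s (F.u a) := mem_filter

/-- Freeness in `A` forces on `B` the balance at the complementary digit `m - d` that is needed to
slice `B` there. -/
theorem SP.bal_of_free [hp : Fact p.Prime] [NeZero q] {A : Fam p q α} {B : Fam p q β}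
    (h : SP (m + 1) n A B) {d : ℕ} (hd : d ≤ m) (hF : Free n A d) {a a' : α} (ha : a ∈ A.S)
    (ha' : a' ∈ A.S) {l : ℕ} (haa : ∀ t < d + 1, A.u a' t = A.u a t)
    (hl : Agr n l (A.v a) (A.v a')) : Bal B (m - d + 1) (n - l) := by
  obtain ⟨b, hb, h1, h2⟩ := hF.exists_agr (m := m + 1) (by omega) ha' haa hl
  have := h.left a ha b hb (fun e => h1.2.2 (by omega) (by rw [e])) d l h1 h2
  rwa [show m - d + 1 = m + 1 - d by omega]

theorem SP.sub [hp : Fact p.Prime] [NeZero q] {A : Fam p q α} {B : Fam p q β}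
    (h : SP (m + 1) n A B) {d : ℕ} (hd : d ≤ m) (hF : Free n A d)
    {s r : (ℕ → ZMod p) → ZMod p} (hs : ∀ x x', (∀ t < d, x t = x' t) → s x = s x')
    (hr : ∀ x x', (∀ t < m - d, x t = x' t) → r x = r x') :
    SP m n ((A.sub d s).delU d) ((B.sub (m - d) r).delU (m - d)) := by
  have hp0 : (p : ℤ) ≠ 0 := by exact_mod_cast hp.out.ne_zero
  have cardA : (p : ℤ) * (A.sub d s).S.card = A.S.card := by
    have := sub_sum_ind (F := A) hs (z := fun _ => 1)
      (fun w hw => hF 0 (Nat.zero_le _) w hw _ rfl) (Nat.zero_le _) 0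
    simpa [ind_zero] using this
  have cardB : (p : ℤ) * (B.sub (m - d) r).S.card = B.S.card := by
    obtain ⟨a, ha⟩ := h.nonempty
    have hb := h.bal_of_free hd hF ha ha (fun _ _ => rfl) (agr_self n (A.v a))
    rw [Nat.sub_self] at hb
    have := sub_sum_ind (F := B) hr (z := fun _ => 1)
      (fun w hw => hb w hw _ rfl) (Nat.zero_le _) 0
    simpa [ind_zero] using this
  refine ⟨?_, ?_, ?_, ?_⟩
  · have : (p : ℤ) * (A.sub d s).S.card = p * (B.sub (m - d) r).S.card := by
      rw [cardA, cardB, h.card_eq]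
    exact_mod_cast mul_left_cancel₀ hp0 this
  · rw [← card_pos]
    refine Nat.pos_of_ne_zero fun h0 => ?_
    change (A.sub d s).S.card = 0 at h0
    rw [h0] at cardA
    have := card_pos.2 h.nonempty
    rw [Nat.cast_zero, mul_zero] at cardA
    omega
  · intro a ha a' ha' hne κ l hκ hl
    obtain ⟨ha, has⟩ := mem_sub.1 ha
    obtain ⟨ha', has'⟩ := mem_sub.1 ha'
    obtain ⟨κ', hκ', hc⟩ := agr_del hd hκ
    have hb := h.left a ha a' ha' hne κ' l hκ' hl
    have := hκ.2.1
    rcases hc with ⟨h1, rfl⟩ | ⟨rfl, h1⟩ | ⟨h1, rfl⟩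
    · refine Bal.del_of_lt (Bal.sub_of_gt hr (by omega) ?_) (by omega)
      rwa [show m - κ + 1 = m + 1 - κ by omega]
    · exact absurd (has.trans ((hs _ _ hκ'.1).trans has'.symm)) (hκ'.2.2 (by omega))
    · refine Bal.del_of_le (Bal.sub_of_le hr ?_ (by omega) ?_) (by omega)
      · exact h.bal_of_free hd hF ha ha' (fun t ht => (hκ'.1 t (by omega)).symm) hl
      · rwa [show m - κ = m + 1 - (κ + 1) by omega]
  · intro b hb b' hb' hne κ l hκ hl
    obtain ⟨hb, hbr⟩ := mem_sub.1 hb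
    obtain ⟨hb', hbr'⟩ := mem_sub.1 hb'
    obtain ⟨κ', hκ', hc⟩ := agr_del (by omega) hκ
    have hbal := h.right b hb b' hb' hne κ' l hκ' hl
    have := hκ.2.1
    rcases hc with ⟨h1, rfl⟩ | ⟨rfl, h1⟩ | ⟨h1, rfl⟩
    · refine Bal.del_of_lt (Bal.sub_of_gt hs (by omega) ?_) (by omega)
      rwa [show m - κ + 1 = m + 1 - κ by omega]
    · exact absurd (hbr.trans ((hr _ _ hκ'.1).trans hbr'.symm)) (hκ'.2.2 (by omega))
    · refine Bal.del_of_le (Bal.sub_of_le hs (hF _ (by omega)) (by omega) ?_) (by omega)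
      rwa [show m - κ = m + 1 - (κ + 1) by omega]

/-- The digit levels of a digit tile are determined by either member of the pair. -/
theorem level_eq [hp : Fact p.Prime] [hq : Fact q.Prime] (hpq : p ≠ q) {F : Fam p q α}
    {K L K' L' : Finset ℕ} (hK : K ⊆ range m) (hL : L ⊆ range n) (hK' : K' ⊆ range m)
    (hL' : L' ⊆ range n)
    (hc : F.S.card * (p ^ K.card * q ^ L.card) = p ^ m * q ^ n) (hF : Avoid m n F K L)
    (hc' : F.S.card * (p ^ K'.card * q ^ L'.card) = p ^ m * q ^ n) (hF' : Avoid m n F K' L') :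
    K = K' := by
  ext t
  constructor <;> intro ht
  · have htm := mem_range.1 (hK ht)
    have h1 := bal_iff_notMem hpq hK hL hc hF htm
    have h2 := bal_iff_notMem hpq hK' hL' hc' hF' htm
    tauto
  · have htm := mem_range.1 (hK' ht)
    have h1 := bal_iff_notMem hpq hK hL hc hF htm
    have h2 := bal_iff_notMem hpq hK' hL' hc' hF' htm
    tauto

theorem levels_eq [hp : Fact p.Prime] [hq : Fact q.Prime] (hpq : p ≠ q) {F : Fam p q α}
    {K L K' L' : Finset ℕ} (hK : K ⊆ range m) (hL : L ⊆ range n) (hK' : K' ⊆ range m)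
    (hL' : L' ⊆ range n)
    (hc : F.S.card * (p ^ K.card * q ^ L.card) = p ^ m * q ^ n) (hF : Avoid m n F K L)
    (hc' : F.S.card * (p ^ K'.card * q ^ L'.card) = p ^ m * q ^ n) (hF' : Avoid m n F K' L') :
    K = K' ∧ L = L' := by
  refine ⟨level_eq hpq hK hL hK' hL' hc hF hc' hF', ?_⟩
  refine level_eq hpq.symm (F := F.swap) hL hK hL' hK' ?_ hF.swap ?_ hF'.swap
  · rw [mul_comm (q ^ _), mul_comm (q ^ _)]; exact hc
  · rw [mul_comm (q ^ _), mul_comm (q ^ _)]; exact hc'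

/-- Two points that do not first differ at `d` lie in a common slice, so avoidance in all slices
suffices, provided that `K` and `L` are the same for all of them. Each member of a pair determines
the levels; varying `s` against `r = 0` and then `r` against `s = 0` therefore keeps them fixed. -/
theorem DigitTile.of_sub [hp : Fact p.Prime] [hq : Fact q.Prime] (hpq : p ≠ q)
    {A : Fam p q α} {B : Fam p q β} (h : SP (m + 1) n A B) {d : ℕ} (hd : d ≤ m) (hF : Free n A d)
    (hT : ∀ s r : (ℕ → ZMod p) → ZMod p, (∀ x x', (∀ t < d, x t = x' t) → s x = s x') →
      (∀ x x', (∀ t < m - d, x t = x' t) → r x = r x') →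
      DigitTile m n ((A.sub d s).delU d) ((B.sub (m - d) r).delU (m - d))) :
    DigitTile (m + 1) n A B := by
  have hcA : ∀ s : (ℕ → ZMod p) → ZMod p, (∀ x x', (∀ t < d, x t = x' t) → s x = s x') →
      A.S.card = p * (A.sub d s).S.card := fun s hs => by
    have := sub_sum_ind (F := A) hs (z := fun _ => 1)
      (fun w hw => hF 0 (Nat.zero_le _) w hw _ rfl) (Nat.zero_le _) 0
    simp only [ind_zero, mul_one, sum_const, nsmul_eq_mul] at this
    exact_mod_cast this.symm
  have hsp := fun s r hs hr => SP.sub (s := s) (r := r) h hd hF hs hr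
  obtain ⟨K, L, hK, hL, hc, h1, h2⟩ := hT 0 0 (fun _ _ _ => rfl) (fun _ _ _ => rfl)
  -- the levels do not depend on the choice functions
  have hB0 : ∀ s : (ℕ → ZMod p) → ZMod p, (∀ x x', (∀ t < d, x t = x' t) → s x = s x') →
      ((A.sub d s).delU d).S.card * (p ^ K.card * q ^ L.card) = p ^ m * q ^ n ∧
      Avoid m n ((A.sub d s).delU d) K L := by
    intro s hs
    obtain ⟨K', L', hK', hL', hc', h1', h2'⟩ := hT s 0 hs (fun _ _ _ => rfl)
    have e := levels_eq hpq (F := (B.sub (m - d) 0).delU (m - d)) (star_subset K) (star_subset L)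
      (star_subset K') (star_subset L')
      (by rw [card_star hK, card_star hL,
            ← (hsp 0 0 (fun _ _ _ => rfl) (fun _ _ _ => rfl)).card_eq, hc]) h2
      (by rw [card_star hK', card_star hL', ← (hsp s 0 hs (fun _ _ _ => rfl)).card_eq, hc']) h2'
    have e1 : K = K' := by rw [← star_star hK, e.1, star_star hK']
    have e2 : L = L' := by rw [← star_star hL, e.2, star_star hL']
    subst e1 e2
    exact ⟨hc', h1'⟩
  have hAll : ∀ r : (ℕ → ZMod p) → ZMod p, (∀ x x', (∀ t < m - d, x t = x' t) → r x = r x') →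
      Avoid m n ((B.sub (m - d) r).delU (m - d)) (star m K) (star n L) := by
    intro r hr
    obtain ⟨K', L', hK', hL', hc', h1', h2'⟩ := hT 0 r (fun _ _ _ => rfl) hr
    obtain ⟨rfl, rfl⟩ := levels_eq hpq hK hL hK' hL' hc h1 hc' h1'
    exact h2'
  have hnot : d ∉ K.image (up d) := by
    simp only [mem_image, not_exists, not_and]
    exact fun t _ => up_ne _ _
  have hch : ∀ (e : ℕ) (x x' : ℕ → ZMod p), ∀ y y' : ℕ → ZMod p, (∀ t < e, y t = y' t) →
      (if ∀ t < e, y t = x t then x e else x' e) =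
        (if ∀ t < e, y' t = x t then x e else x' e) := by
    intro e x x' y y' hy
    congr 1
    exact propext (forall₂_congr fun t ht => by rw [hy t ht])
  refine ⟨K.image (up d), L, ?_, hL, ?_, ?_, ?_⟩
  · intro t ht
    obtain ⟨t', ht', rfl⟩ := mem_image.1 ht
    exact mem_range.2 (up_lt (mem_range.1 (hK ht')))
  · rw [card_image_of_injective _ (up_injective _), hcA 0 fun _ _ _ => rfl, mul_assoc, pow_succ',
      mul_assoc, ← hc]
    rfl
  · intro a ha a' ha' hne κ l hκ hl ⟨h3, h4⟩
    have hκd : κ ≠ d := by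
      rintro rfl
      rcases h3 with h3 | h3
      · omega
      · exact hnot h3
    have hs := hch d (A.u a) (A.u a')
    set s : (ℕ → ZMod p) → ZMod p := fun y => if ∀ t < d, y t = A.u a t then A.u a d else A.u a' d
      with hsdef
    have has : a ∈ (A.sub d s).S := mem_sub.2 ⟨ha, by simp [hsdef]⟩
    have has' : a' ∈ (A.sub d s).S := by
      refine mem_sub.2 ⟨ha', ?_⟩
      simp only [hsdef]
      split_ifs with hc
      · by_contra hne'
        exact hκd (hκ.eq ⟨fun t ht => (hc t ht).symm, by omega, fun _ e => hne' e.symm⟩)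
      · rfl
    obtain ⟨κ', hκ'⟩ := exists_agr m (del d (A.u a)) (del d (A.u a'))
    obtain ⟨κ₁, hκ₁, hcs⟩ := agr_del hd hκ'
    obtain rfl := hκ₁.eq hκ
    have := hκ.2.1
    have := hκ'.2.1
    refine (hB0 s hs).2 a has a' has' hne κ' l hκ' hl ⟨?_, h4⟩
    rcases h3 with h3 | h3
    · left; omega
    · right
      obtain ⟨t, ht, h3⟩ := mem_image.1 h3
      have : t = κ' := by unfold up at h3; split_ifs at h3 <;> omega
      rwa [← this]
  · intro b hb b' hb' hne κ l hκ hl ⟨h3, h4⟩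
    have hκd : κ ≠ m - d := by
      rintro rfl
      rcases h3 with h3 | h3
      · omega
      · have := (mem_star.1 h3).2
        rw [show m + 1 - 1 - (m - d) = d by omega] at this
        exact hnot this
    have hr := hch (m - d) (B.u b) (B.u b')
    set r : (ℕ → ZMod p) → ZMod p :=
      fun y => if ∀ t < m - d, y t = B.u b t then B.u b (m - d) else B.u b' (m - d) with hrdef
    have hbr : b ∈ (B.sub (m - d) r).S := mem_sub.2 ⟨hb, by simp [hrdef]⟩
    have hbr' : b' ∈ (B.sub (m - d) r).S := by
      refine mem_sub.2 ⟨hb', ?_⟩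
      simp only [hrdef]
      split_ifs with hc
      · by_contra hne'
        exact hκd (hκ.eq ⟨fun t ht => (hc t ht).symm, by omega, fun _ e => hne' e.symm⟩)
      · rfl
    obtain ⟨κ', hκ'⟩ := exists_agr m (del (m - d) (B.u b)) (del (m - d) (B.u b'))
    obtain ⟨κ₁, hκ₁, hcs⟩ := agr_del (by omega) hκ'
    obtain rfl := hκ₁.eq hκ
    have := hκ.2.1
    have := hκ'.2.1
    refine hAll r hr b hbr b' hbr' hne κ' l hκ' hl ⟨?_, h4⟩
    rcases h3 with h3 | h3
    · left; omega
    · right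
      obtain ⟨h3, h3'⟩ := mem_star.1 h3
      obtain ⟨t, ht, h3'⟩ := mem_image.1 h3'
      have htm := mem_range.1 (hK ht)
      have : t = m - 1 - κ' ∧ κ' < m := by unfold up at h3'; split_ifs at h3' <;> omega
      rw [mem_star, ← this.1]
      exact ⟨this.2, ht⟩

/-! ### Irreducible pairs and the induction -/

/-- Every `p`-level is a level of first difference, and no `p`-digit is free. -/
structure Rich (m n : ℕ) (F : Fam p q α) : Prop where
  exists_agr : ∀ k < m, ∃ a ∈ F.S, ∃ a' ∈ F.S, Agr m k (F.u a) (F.u a')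
  not_free : ∀ d < m, ¬ Free n F d

/-- An irreducible spectral pair. -/
structure Irr (m n : ℕ) (A : Fam p q α) (B : Fam p q β) : Prop where
  pA : Rich m n A
  pB : Rich m n B
  qA : Rich n m A.swap
  qB : Rich n m B.swap

theorem Irr.symm {A : Fam p q α} {B : Fam p q β} (h : Irr m n A B) : Irr m n B A :=
  ⟨h.pB, h.pA, h.qB, h.qA⟩

theorem Irr.swap {A : Fam p q α} {B : Fam p q β} (h : Irr m n A B) : Irr n m A.swap B.swap :=
  ⟨h.qA, h.qB, h.pA, h.pB⟩

theorem digitTile_of_not_rich [hp : Fact p.Prime] [hq : Fact q.Prime] (hpq : p ≠ q)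
    {A : Fam p q α} {B : Fam p q β} (h : SP (m + 1) n A B) (hB : ¬ Rich (m + 1) n B)
    (ih : ∀ (A' : Fam p q α) (B' : Fam p q β), SP m n A' B' → DigitTile m n A' B') :
    DigitTile (m + 1) n A B := by
  by_cases hB' : ∀ k < m + 1, ∃ a ∈ B.S, ∃ a' ∈ B.S, Agr (m + 1) k (B.u a) (B.u a')
  · have : ∃ d < m + 1, Free n B d := by
      by_contra hd
      push Not at hd
      exact hB ⟨hB', hd⟩
    obtain ⟨d, hd, hF⟩ := this
    refine DigitTile.symm h.card_eq.symm (DigitTile.of_sub hpq h.symm (by omega) hF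
      fun s r hs hr => ?_)
    have hsp := h.symm.sub (by omega) hF hs hr
    exact (ih _ _ hsp.symm).symm hsp.card_eq.symm
  · push Not at hB'
    obtain ⟨k, hk, hB'⟩ := hB'
    have hsp := h.delU (k := k) (by omega) hB'
    exact DigitTile.of_delU hpq h (by omega) hB' (ih _ _ hsp)

theorem digitTile_of_not_rich' [hp : Fact p.Prime] [hq : Fact q.Prime] (hpq : p ≠ q)
    {A : Fam p q α} {B : Fam p q β} (h : SP m n A B) (hB : ¬ Rich m n B)
    (ih : ∀ m', m = m' + 1 → ∀ (A' : Fam p q α) (B' : Fam p q β), SP m' n A' B' →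
      DigitTile m' n A' B') : DigitTile m n A B := by
  cases m with
  | zero => exact absurd ⟨fun k hk => absurd hk (by omega), fun k hk => absurd hk (by omega)⟩ hB
  | succ m => exact digitTile_of_not_rich hpq h hB (ih m rfl)

/-- If there are no irreducible pairs below given exponents, spectral pairs are digit tiles. -/
theorem SP.digitTile [hp : Fact p.Prime] [hq : Fact q.Prime] (hpq : p ≠ q) {P : ℕ → ℕ → Prop}
    (hP : ∀ m n, P (m + 1) n → P m n) (hP' : ∀ m n, P m (n + 1) → P m n)
    (hI : ∀ m n (A : Fam p q α) (B : Fam p q α), 0 < m + n → P m n → SP m n A B →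
      ¬ Irr m n A B) (hmn : P m n) (A B : Fam p q α) (h : SP m n A B) : DigitTile m n A B := by
  induction hs : m + n using Nat.strong_induction_on generalizing m n A B with
  | h s ih =>
    rcases Nat.eq_zero_or_pos (m + n) with h0 | h0
    · obtain ⟨rfl, rfl⟩ : m = 0 ∧ n = 0 := by omega
      have huniq : ∀ {F G : Fam p q α}, SP 0 0 F G → ∀ a ∈ F.S, ∀ a' ∈ F.S, a = a' := by
        intro F G hFG a ha a' ha'
        by_contra hne
        have := hFG.left a ha a' ha' hne 0 0 ⟨by simp, le_rfl, by simp⟩ ⟨by simp, le_rfl, by simp⟩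
        exact not_bal_zero hFG.symm.nonempty this
      refine ⟨∅, ∅, by simp, by simp, ?_, fun a ha a' ha' hne => absurd (huniq h a ha a' ha') hne,
        fun a ha a' ha' hne => absurd (huniq h.symm a ha a' ha') hne⟩
      obtain ⟨a, ha⟩ := h.nonempty
      simp [card_eq_one.2 ⟨a, eq_singleton_iff_unique_mem.2 ⟨ha, fun b hb => huniq h b hb a ha⟩⟩]
    · have ihp : ∀ m', m = m' + 1 → ∀ (A' : Fam p q α) (B' : Fam p q α), SP m' n A' B' →
          DigitTile m' n A' B' := by
        rintro m' rfl A' B' h'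
        exact ih (m' + n) (by omega) (hP _ _ hmn) A' B' h' rfl
      have ihq : ∀ n', n = n' + 1 → ∀ (A' : Fam q p α) (B' : Fam q p α), SP n' m A' B' →
          DigitTile n' m A' B' := by
        rintro n' rfl A' B' h'
        exact (ih (m + n') (by omega) (hP' _ _ hmn) A'.swap B'.swap h'.swap rfl).swap
      by_contra hT
      refine hI m n A B h0 hmn h ⟨?_, ?_, ?_, ?_⟩ <;> by_contra hR
      · exact hT (DigitTile.symm h.card_eq.symm
          (digitTile_of_not_rich' hpq h.symm hR fun m' e A' B' h' => ihp m' e A' B' h'))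
      · exact hT (digitTile_of_not_rich' hpq h hR ihp)
      · refine hT (DigitTile.swap (DigitTile.symm ?_
          (digitTile_of_not_rich' hpq.symm h.symm.swap hR ihq)))
        exact h.card_eq.symm
      · exact hT (DigitTile.swap (digitTile_of_not_rich' hpq.symm h.swap hR ihq))

/-! ### Passage between the cyclic group and digit families -/

/-- The base-`p` digits of a natural number, as residues. -/
def dig (p x t : ℕ) : ZMod p := ((x / p ^ t : ℕ) : ZMod p)

theorem dig_agree {x y k : ℕ} :
    (∀ t < k, dig p x t = dig p y t) ↔ x ≡ y [MOD p ^ k] := by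
  induction k with
  | zero => simp [Nat.modEq_one]
  | succ k ih =>
    have : (∀ t < k + 1, dig p x t = dig p y t) ↔
        (∀ t < k, dig p x t = dig p y t) ∧ dig p x k = dig p y k := by
      constructor
      · exact fun h => ⟨fun t ht => h t (by omega), h k (by omega)⟩
      · rintro ⟨h1, h2⟩ t ht
        rcases Nat.lt_succ_iff_lt_or_eq.1 ht with h | rfl
        · exact h1 t h
        · exact h2
    rw [this, ih, dig, dig, ZMod.natCast_eq_natCast_iff]
    constructor
    · rintro ⟨h1, h2⟩
      unfold Nat.ModEq at *
      rw [Nat.mod_pow_succ, Nat.mod_pow_succ, h1, h2]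
    · intro h
      have h1 : x ≡ y [MOD p ^ k] := h.of_mul_right p
      refine ⟨h1, ?_⟩
      unfold Nat.ModEq at *
      rw [Nat.mod_pow_succ, Nat.mod_pow_succ, h1] at h
      rcases Nat.eq_zero_or_pos (p ^ k) with h0 | h0
      · rw [h0]; simp
      · exact Nat.eq_of_mul_eq_mul_left h0 (Nat.add_left_cancel h)

theorem agr_dig {x y k : ℕ} : Agr m k (dig p x) (dig p y) ↔
    x ≡ y [MOD p ^ k] ∧ k ≤ m ∧ (k < m → ¬ x ≡ y [MOD p ^ (k + 1)]) := by
  unfold Agr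
  rw [dig_agree]
  refine and_congr_right fun h => and_congr_right fun _ => imp_congr_right fun _ => ?_
  rw [← dig_agree, not_iff_not]
  constructor
  · intro hk t ht
    rcases Nat.lt_succ_iff_lt_or_eq.1 ht with h' | rfl
    · exact dig_agree.2 h t h'
    · exact hk
  · exact fun h => h k (by omega)

theorem exists_dig [NeZero p] (x : ℕ → ZMod p) (k : ℕ) : ∃ X : ℕ, ∀ t < k, dig p X t = x t := by
  have : ∃ X : ℕ, X < p ^ k ∧ ∀ t < k, dig p X t = x t := by
    induction k with
    | zero => exact ⟨0, by simp, by simp⟩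
    | succ k ih =>
      obtain ⟨X, hX, h⟩ := ih
      have hp := NeZero.pos p
      refine ⟨X + p ^ k * (x k).val, ?_, fun t ht => ?_⟩
      · have := ZMod.val_lt (x k)
        calc X + p ^ k * (x k).val < p ^ k * ((x k).val + 1) := by rw [mul_add]; omega
          _ ≤ p ^ k * p := Nat.mul_le_mul_left _ this
          _ = _ := (pow_succ _ _).symm
      · rcases Nat.lt_succ_iff_lt_or_eq.1 ht with h' | rfl
        · rw [← h t h']
          have : X + p ^ k * (x k).val ≡ X [MOD p ^ k] := by simp [Nat.ModEq]
          exact dig_agree.2 this t h'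
        · rw [dig, Nat.add_mul_div_left _ _ (pow_pos hp _), Nat.div_eq_of_lt hX]
          simp
  obtain ⟨X, -, h⟩ := this
  exact ⟨X, h⟩

/-- Test functions of level `i` are combinations of primitive characters of order `p ^ i`. -/
theorem test_fourier [hp : Fact p.Prime] {f : α → ℕ} {i : ℕ} {w : α → ℤ}
    (hw : Test (fun a => dig p (f a)) i w) :
    ∃ (T : Finset ℕ) (θ c : ℕ → ℂ), (∀ s ∈ T, IsPrimitiveRoot (θ s) (p ^ i)) ∧
      ∀ a, (w a : ℂ) = ∑ s ∈ T, c s * θ s ^ f a := by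
  cases i with
  | zero =>
    refine ⟨{0}, 1, 1, fun s _ => by simp, fun a => ?_⟩
    obtain rfl := hw
    simp
  | succ k =>
    obtain ⟨x, x', hx, rfl⟩ := hw
    obtain ⟨X, hX⟩ := exists_dig x (k + 1)
    obtain ⟨X', hX'⟩ := exists_dig x' (k + 1)
    have hP : p ^ (k + 1) ≠ 0 := pow_ne_zero _ hp.out.ne_zero
    have hPC : ((p ^ (k + 1) : ℕ) : ℂ) ≠ 0 := by exact_mod_cast hP
    obtain ⟨ζ, hζ⟩ : ∃ ζ : ℂ, IsPrimitiveRoot ζ (p ^ (k + 1)) :=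
      ⟨_, Complex.isPrimitiveRoot_exp _ hP⟩
    have hζ0 : ζ ≠ 0 := hζ.ne_zero hP
    have hmod : ∀ a b : ℕ, ζ ^ a = ζ ^ b ↔ a ≡ b [MOD p ^ (k + 1)] := fun a b => by
      rw [(hζ.isOfFinOrder hP).pow_eq_pow_iff_modEq, ← hζ.eq_orderOf]
    have horth : ∀ a X : ℕ, ∑ s ∈ range (p ^ (k + 1)), ((ζ ^ s) ^ X)⁻¹ * (ζ ^ s) ^ a =
        if a ≡ X [MOD p ^ (k + 1)] then ((p ^ (k + 1) : ℕ) : ℂ) else 0 := by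
      intro a X
      have : ∀ s, ((ζ ^ s) ^ X)⁻¹ * (ζ ^ s) ^ a = ((ζ ^ X)⁻¹ * ζ ^ a) ^ s := fun s => by
        rw [mul_pow, inv_pow, ← pow_mul, ← pow_mul, ← pow_mul, ← pow_mul, mul_comm s, mul_comm s]
      simp only [this]
      split_ifs with h
      · rw [(hmod _ _).2 h, inv_mul_cancel₀ (pow_ne_zero _ hζ0)]
        simp
      · have hne : (ζ ^ X)⁻¹ * ζ ^ a ≠ 1 := fun e => h ((hmod _ _).1
          ((inv_mul_eq_one₀ (pow_ne_zero _ hζ0)).1 e).symm)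
        rw [geom_sum_eq hne, mul_pow, inv_pow, ← pow_mul, ← pow_mul, mul_comm X, mul_comm a,
          pow_mul, pow_mul, hζ.pow_eq_one]
        simp
    have hind : ∀ (x : ℕ → ZMod p) (X : ℕ), (∀ t < k + 1, dig p X t = x t) → ∀ a : α,
        ((ind (k + 1) x (dig p (f a)) : ℤ) : ℂ) = ((p ^ (k + 1) : ℕ) : ℂ)⁻¹ *
          ∑ s ∈ range (p ^ (k + 1)), ((ζ ^ s) ^ X)⁻¹ * (ζ ^ s) ^ f a := by
      intro x X hX a
      rw [horth, ← ind_congr hX, ind]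
      simp only [dig_agree]
      split_ifs
      · rw [inv_mul_cancel₀ hPC]; simp
      · simp
    have hXX : X ≡ X' [MOD p ^ k] := dig_agree.1 fun t ht => by
      rw [hX t (by omega), hX' t (by omega), hx t ht]
    -- Since `X` and `X'` agree modulo `p ^ k`, the coefficients with `p ∣ s` cancel; the remaining
    -- powers of `ζ` are primitive.
    refine ⟨(range (p ^ (k + 1))).filter fun s => ¬ p ∣ s, fun s => ζ ^ s,
      fun s => ((p ^ (k + 1) : ℕ) : ℂ)⁻¹ * (((ζ ^ s) ^ X)⁻¹ - ((ζ ^ s) ^ X')⁻¹),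
      fun s hs => ?_, fun a => ?_⟩
    · have := (mem_filter.1 hs).2
      exact hζ.pow_of_coprime s (Nat.Coprime.pow_right _
        ((Nat.Prime.coprime_iff_not_dvd hp.out).2 this).symm)
    · push_cast
      have e1 := hind x X hX a
      have e2 := hind x' X' hX' a
      beta_reduce at e1 e2 ⊢
      rw [e1, e2, ← mul_sub, ← sum_sub_distrib, mul_sum, sum_filter]
      refine sum_congr rfl fun s _ => ?_
      split_ifs with hs
      · obtain ⟨r, rfl⟩ := hs
        have : (ζ ^ (p * r)) ^ X = (ζ ^ (p * r)) ^ X' := by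
          rw [← pow_mul, ← pow_mul, hmod, mul_assoc, mul_assoc, pow_succ']
          exact (hXX.mul_left r).mul_left' p
        rw [this]
        simp
      · push_cast; ring

/-- Both roots have the same cyclotomic polynomial as minimal polynomial over `ℚ`. -/
theorem vanishing_conj {d : ℕ} (hd : 0 < d) {S : Finset α} {f : α → ℕ} {η η' : ℂ}
    (hη : IsPrimitiveRoot η d) (hη' : IsPrimitiveRoot η' d) (h : ∑ a ∈ S, η ^ f a = 0) :
    ∑ a ∈ S, η' ^ f a = 0 := by
  set F : Polynomial ℚ := ∑ a ∈ S, Polynomial.X ^ f a with hF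
  have ev : ∀ x : ℂ, Polynomial.aeval x F = ∑ a ∈ S, x ^ f a := fun x => by simp [hF]
  rw [← ev] at h ⊢
  have h1 := minpoly.dvd ℚ η h
  rw [← Polynomial.cyclotomic_eq_minpoly_rat hη hd, Polynomial.cyclotomic_eq_minpoly_rat hη' hd]
    at h1
  obtain ⟨G, hG⟩ := h1
  rw [hG, map_mul, minpoly.aeval, zero_mul]

/-- Expand both test functions into characters. Orders `p ^ i` and `q ^ j` are coprime, so every
product is a primitive root of the same order as `η`, and its sum vanishes by conjugacy. -/
theorem bal_of_vanishing [hp : Fact p.Prime] [hq : Fact q.Prime] (hpq : p ≠ q) {S : Finset α}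
    {f : α → ℕ} {i j : ℕ} {η : ℂ} (hη : IsPrimitiveRoot η (p ^ i * q ^ j))
    (h : ∑ a ∈ S, η ^ f a = 0) :
    Bal (⟨S, fun a => dig p (f a), fun a => dig q (f a)⟩ : Fam p q α) i j := by
  intro w hw z hz
  obtain ⟨T, θ, c, hθ, ew⟩ := test_fourier hw
  obtain ⟨T', θ', c', hθ', ez⟩ := test_fourier hz
  have hd : 0 < p ^ i * q ^ j := Nat.mul_pos (pow_pos hp.out.pos _) (pow_pos hq.out.pos _)
  have : ((∑ a ∈ S, w a * z a : ℤ) : ℂ) = 0 := by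
    push_cast
    simp only [ew, ez, sum_mul_sum]
    rw [sum_comm]
    refine sum_eq_zero fun s hs => ?_
    rw [sum_comm]
    refine sum_eq_zero fun s' hs' => ?_
    have hprim : IsPrimitiveRoot (θ s * θ' s') (p ^ i * q ^ j) := by
      rw [IsPrimitiveRoot.iff_orderOf, (Commute.all _ _).orderOf_mul_eq_mul_orderOf_of_coprime]
      · rw [← (hθ s hs).eq_orderOf, ← (hθ' s' hs').eq_orderOf]
      · rw [← (hθ s hs).eq_orderOf, ← (hθ' s' hs').eq_orderOf]
        exact Nat.Coprime.pow _ _ ((Nat.coprime_primes hp.out hq.out).2 hpq)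
    have h0 := vanishing_conj hd hη hprim h
    calc _ = ∑ a ∈ S, c s * c' s' * (θ s * θ' s') ^ f a :=
          sum_congr rfl fun a _ => by rw [mul_pow]; ring
      _ = 0 := by rw [← mul_sum, h0, mul_zero]
  exact_mod_cast this

section cyclic

variable {N : ℕ} [NeZero N]

/-- The family of digit expansions of a set of residues modulo `N`. -/
def digitFam (p q : ℕ) (A : Finset (ZMod N)) : Fam p q (ZMod N) :=
  ⟨A, fun a => dig p a.val, fun a => dig q a.val⟩

theorem pow_dvd_of_agr [hp : Fact p.Prime] {x y k : ℕ} (h : Agr m k (dig p x) (dig p y)) {s : ℕ}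
    (hs : (p : ℤ) ^ m ∣ s * ((x : ℤ) - y)) : p ^ (m - k) ∣ s := by
  obtain ⟨h1, h2, h3⟩ := agr_dig.1 h
  rcases h2.eq_or_lt with rfl | hlt
  · simp
  have h4 := h3 hlt
  rw [Nat.modEq_iff_dvd] at h1 h4
  obtain ⟨c, hc⟩ := h1
  push_cast at hc h4
  have hpZ : Prime (p : ℤ) := Nat.prime_iff_prime_int.1 hp.out
  have hcp : ¬ (p : ℤ) ∣ c := by
    rintro ⟨e, rfl⟩
    exact h4 ⟨e, by rw [hc]; ring⟩
  have h5 : (p : ℤ) ^ k * p ^ (m - k) ∣ p ^ k * (c * s) := by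
    rw [← pow_add, Nat.add_sub_cancel' h2]
    rw [show (x : ℤ) - y = -(p ^ k * c) by rw [← hc]; ring] at hs
    rw [← dvd_neg, show -((p : ℤ) ^ k * (c * s)) = s * -(p ^ k * c) by ring]
    exact hs
  have h6 := (mul_dvd_mul_iff_left (pow_ne_zero _ hpZ.ne_zero)).1 h5
  exact_mod_cast hpZ.pow_dvd_of_dvd_mul_left _ hcp h6

theorem isPrimitiveRoot_of_agr [hp : Fact p.Prime] [hq : Fact q.Prime] (hpq : p ≠ q)
    (hN : N = p ^ m * q ^ n) {b b' : ZMod N} {k l : ℕ}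
    (hk : Agr m k (dig p b.val) (dig p b'.val)) (hl : Agr n l (dig q b.val) (dig q b'.val)) :
    IsPrimitiveRoot (ZMod.stdAddChar (b - b') : ℂ) (p ^ (m - k) * q ^ (n - l)) := by
  have key : ∀ s : ℕ, (ZMod.stdAddChar (b - b') : ℂ) ^ s = 1 ↔
      (N : ℤ) ∣ s * ((b.val : ℤ) - b'.val) := by
    intro s
    rw [← AddChar.map_nsmul_eq_pow, ← (ZMod.stdAddChar (N := N)).map_zero_eq_one,
      ZMod.injective_stdAddChar.eq_iff, ← ZMod.intCast_zmod_eq_zero_iff_dvd]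
    · simp
  have cop : IsCoprime ((p : ℤ) ^ m) ((q : ℤ) ^ n) := by
    rw [← Nat.cast_pow, ← Nat.cast_pow, Nat.isCoprime_iff_coprime]
    exact Nat.Coprime.pow _ _ ((Nat.coprime_primes hp.out hq.out).2 hpq)
  have hNZ : (N : ℤ) = p ^ m * q ^ n := by rw [hN]; push_cast; rfl
  have hsub : ∀ {r k : ℕ} (M : ℕ), k ≤ M → b.val ≡ b'.val [MOD r ^ k] →
      (r : ℤ) ^ M ∣ r ^ (M - k) * ((b.val : ℤ) - b'.val) := by
    intro r k M hkM h
    have := (Nat.modEq_iff_dvd.1 h.symm)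
    push_cast at this
    calc (r : ℤ) ^ M = r ^ (M - k) * r ^ k := by rw [← pow_add, Nat.sub_add_cancel hkM]
      _ ∣ _ := mul_dvd_mul_left _ this
  rw [IsPrimitiveRoot.iff_def]
  refine ⟨?_, fun s hs => ?_⟩
  · rw [key, hNZ]
    push_cast
    refine cop.mul_dvd ?_ ?_
    · rw [mul_right_comm]
      exact (hsub m hk.2.1 (agr_dig.1 hk).1).mul_right _
    · rw [mul_assoc]
      exact (hsub n hl.2.1 (agr_dig.1 hl).1).mul_left _
  · rw [key, hNZ] at hs
    exact Nat.Coprime.mul_dvd_of_dvd_of_dvd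
      (Nat.Coprime.pow _ _ ((Nat.coprime_primes hp.out hq.out).2 hpq))
      (pow_dvd_of_agr hk ((dvd_mul_right _ _).trans hs))
      (pow_dvd_of_agr hl ((dvd_mul_left _ _).trans hs))

theorem halfSP_of_orthogonal [hp : Fact p.Prime] [hq : Fact q.Prime] (hpq : p ≠ q)
    (hN : N = p ^ m * q ^ n) {A B : Finset (ZMod N)}
    (h : ∀ b ∈ B, ∀ b' ∈ B, b ≠ b' → ∑ a ∈ A, (ZMod.stdAddChar (a * (b - b')) : ℂ) = 0) :
    HalfSP m n (digitFam p q B) (digitFam p q A) := by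
  intro b hb b' hb' hne k l hk hl
  refine bal_of_vanishing hpq (isPrimitiveRoot_of_agr hpq hN hk hl) ?_
  rw [← h b hb b' hb' hne]
  refine sum_congr rfl fun a _ => ?_
  rw [← AddChar.map_nsmul_eq_pow]
  congr 1
  simp

/-- Orthogonality of rows gives orthogonality of columns. -/
theorem orthogonal_symm {A B : Finset (ZMod N)} (hA : A.Nonempty) (hcard : A.card = B.card)
    (h : ∀ b ∈ B, ∀ b' ∈ B, b ≠ b' → ∑ a ∈ A, (ZMod.stdAddChar (a * (b - b')) : ℂ) = 0) :
    ∀ a ∈ A, ∀ a' ∈ A, a ≠ a' → ∑ b ∈ B, (ZMod.stdAddChar (b * (a - a')) : ℂ) = 0 := by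
  have hM : (A.card : ℂ) ≠ 0 := by exact_mod_cast (card_pos.2 hA).ne'
  let X : Matrix B A ℂ := fun b a => ZMod.stdAddChar (a.1 * b.1)
  let Y : Matrix A B ℂ := fun a b => (A.card : ℂ)⁻¹ * ZMod.stdAddChar (-(a.1 * b.1))
  have h1 : X * Y = 1 := by
    ext b b'
    rw [Matrix.mul_apply, Matrix.one_apply]
    have e : ∀ a : A, X b a * Y a b' =
        (A.card : ℂ)⁻¹ * ZMod.stdAddChar (a.1 * (b.1 - b'.1)) := fun a => by
      simp only [X, Y]
      rw [mul_left_comm, ← AddChar.map_add_eq_mul]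
      congr 2
      ring
    simp only [e]
    rw [← mul_sum, sum_coe_sort A fun a => (ZMod.stdAddChar (a * (b.1 - b'.1)) : ℂ)]
    split_ifs with hbb
    · subst hbb
      simp [hM]
    · rw [h b b.2 b' b'.2 fun e => hbb (Subtype.ext e), mul_zero]
  have h2 : Y * X = 1 :=
    (Matrix.mul_eq_one_comm_of_card_eq B A ℂ (by simp [hcard])).1 h1
  intro a ha a' ha' hne
  have h3 := congrFun (congrFun h2 ⟨a', ha'⟩) ⟨a, ha⟩
  rw [Matrix.mul_apply, Matrix.one_apply_ne fun e => hne (congrArg Subtype.val e).symm] at h3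
  have e : ∀ b : B, Y ⟨a', ha'⟩ b * X b ⟨a, ha⟩ =
      (A.card : ℂ)⁻¹ * ZMod.stdAddChar (b.1 * (a - a')) := fun b => by
    simp only [X, Y]
    rw [mul_assoc, ← AddChar.map_add_eq_mul]
    congr 2
    ring
  simp only [e] at h3
  rw [← mul_sum, sum_coe_sort B fun b => (ZMod.stdAddChar (b * (a - a')) : ℂ)] at h3
  exact (mul_eq_zero.1 h3).resolve_left (inv_ne_zero hM)

theorem IsSpectrum.sp [hp : Fact p.Prime] [hq : Fact q.Prime] (hpq : p ≠ q)
    (hN : N = p ^ m * q ^ n) {A B : Finset (ZMod N)} (hA : A.Nonempty) (h : IsSpectrum A B) :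
    SP m n (digitFam p q A) (digitFam p q B) :=
  ⟨h.1, hA, halfSP_of_orthogonal hpq hN (orthogonal_symm hA h.1 h.2),
    halfSP_of_orthogonal hpq hN h.2⟩

/-- The residues whose digits outside `K`, `L` vanish. -/
def digitSet (p q m n N : ℕ) [NeZero N] (K L : Finset ℕ) : Finset (ZMod N) :=
  univ.filter fun x => (∀ t < m, t ∉ K → dig p x.val t = 0) ∧ ∀ t < n, t ∉ L → dig q x.val t = 0

theorem card_digitSet [hp : Fact p.Prime] [hq : Fact q.Prime] (hpq : p ≠ q)
    (hN : N = p ^ m * q ^ n) {K L : Finset ℕ}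
    (hK : K ⊆ range m) (hL : L ⊆ range n) :
    p ^ K.card * q ^ L.card ≤ (digitSet p q m n N K L).card := by
  have hex : ∀ x : (ℕ → ZMod p) × (ℕ → ZMod q), ∃ y : ZMod N,
      (∀ t < m, dig p y.val t = x.1 t) ∧ ∀ t < n, dig q y.val t = x.2 t := by
    intro x
    obtain ⟨X, hX⟩ := exists_dig x.1 m
    obtain ⟨Y, hY⟩ := exists_dig x.2 n
    obtain ⟨Z, hZ1, hZ2⟩ := Nat.chineseRemainder
      (Nat.Coprime.pow m n ((Nat.coprime_primes hp.out hq.out).2 hpq)) X Y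
    have hZN : (Z : ZMod N).val ≡ Z [MOD N] := by rw [ZMod.val_natCast]; exact Nat.mod_modEq _ _
    refine ⟨Z, fun t ht => ?_, fun t ht => ?_⟩
    · rw [← hX t ht]
      refine dig_agree.2 ((hZN.of_dvd ?_).trans hZ1) t ht
      rw [hN]; exact dvd_mul_right _ _
    · rw [← hY t ht]
      refine dig_agree.2 ((hZN.of_dvd ?_).trans hZ2) t ht
      rw [hN]; exact dvd_mul_left _ _
  choose g hg1 hg2 using hex
  let ext : (K → ZMod p) × (L → ZMod q) → (ℕ → ZMod p) × (ℕ → ZMod q) := fun f =>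
    (fun t => if ht : t ∈ K then f.1 ⟨t, ht⟩ else 0, fun t => if ht : t ∈ L then f.2 ⟨t, ht⟩ else 0)
  have := card_le_card_of_injOn (s := (univ : Finset ((K → ZMod p) × (L → ZMod q))))
    (t := digitSet p q m n N K L) (fun f => g (ext f)) (fun f _ => ?_) ?_
  · simpa [ZMod.card] using this
  · refine mem_coe.2 (mem_filter.2 ⟨mem_univ _, fun t ht htK => ?_, fun t ht htL => ?_⟩)
    · rw [hg1 _ t ht]; simp [ext, htK]
    · rw [hg2 _ t ht]; simp [ext, htL]
  · intro f _ f' _ hff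
    simp only at hff
    refine Prod.ext (funext fun t => ?_) (funext fun t => ?_)
    · have h1 := hg1 (ext f) t (mem_range.1 (hK t.2))
      rw [hff, hg1 (ext f') t (mem_range.1 (hK t.2))] at h1
      simpa [ext] using h1.symm
    · have h1 := hg2 (ext f) t (mem_range.1 (hL t.2))
      rw [hff, hg2 (ext f') t (mem_range.1 (hL t.2))] at h1
      simpa [ext] using h1.symm

theorem modEq_sub_of_add_eq {r : ℕ} (hr : r ∣ N) {a a' t t' : ZMod N} (h : a + t = a' + t') :
    a.val ≡ a'.val [MOD r] ↔ t.val ≡ t'.val [MOD r] := by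
  have h1 : a.val + t.val ≡ a'.val + t'.val [MOD r] := by
    refine Nat.ModEq.of_dvd hr ?_
    rw [← ZMod.natCast_eq_natCast_iff]
    simpa using h
  exact ⟨fun h2 => Nat.ModEq.add_left_cancel h2 h1, fun h2 => Nat.ModEq.add_right_cancel h2 h1⟩

/-- If `a + t = a' + t'`, then `a, a'` and `t, t'` first differ at the same levels. For elements of
`digitSet` these lie in `K ∪ {m}` and `L ∪ {n}`, which is excluded for `a ≠ a'`. So all sums are
distinct, and counting shows that they fill the group. -/
theorem DigitTile.tiles [hp : Fact p.Prime] [hq : Fact q.Prime] (hpq : p ≠ q)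
    (hN : N = p ^ m * q ^ n) {A B : Finset (ZMod N)}
    (h : DigitTile m n (digitFam p q A) (digitFam p q B)) : Tiles A := by
  obtain ⟨K, L, hK, hL, hc, hA, -⟩ := h
  set T := digitSet p q m n N K L with hT
  have hpN : ∀ k ≤ m, p ^ k ∣ N := fun k hk => by
    rw [hN]; exact (pow_dvd_pow _ hk).mul_right _
  have hqN : ∀ k ≤ n, q ^ k ∣ N := fun k hk => by
    rw [hN]; exact (pow_dvd_pow _ hk).mul_left _
  have hagr : ∀ {r : ℕ} (M : ℕ), (∀ k ≤ M, r ^ k ∣ N) → ∀ {a a' t t' : ZMod N},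
      a + t = a' + t' → ∀ {k : ℕ}, Agr M k (dig r a.val) (dig r a'.val) →
      Agr M k (dig r t.val) (dig r t'.val) := by
    intro r M hr a a' t t' hat k hk
    rw [agr_dig] at hk ⊢
    refine ⟨(modEq_sub_of_add_eq (hr k hk.2.1) hat).1 hk.1, hk.2.1, fun hkM => ?_⟩
    rw [← modEq_sub_of_add_eq (hr (k + 1) hkM) hat]
    exact hk.2.2 hkM
  have hinj : Set.InjOn (fun y : ZMod N × ZMod N => y.1 + y.2) (A ×ˢ T : Finset _) := by
    rintro ⟨a, t⟩ hat ⟨a', t'⟩ hat' heq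
    simp only [coe_product, Set.mem_prod, mem_coe] at hat hat' heq
    have ht := (mem_filter.1 hat.2).2
    have ht' := (mem_filter.1 hat'.2).2
    have haa : a = a' := by
      by_contra hne
      obtain ⟨k, hk⟩ := exists_agr m (dig p a.val) (dig p a'.val)
      obtain ⟨l, hl⟩ := exists_agr n (dig q a.val) (dig q a'.val)
      refine hA a hat.1 a' hat'.1 hne k l hk hl ⟨?_, ?_⟩
      · rcases hk.2.1.eq_or_lt with e | hlt
        · exact Or.inl e
        · right
          by_contra hkK
          exact (hagr m hpN heq hk).2.2 hlt (by rw [ht.1 k hlt hkK, ht'.1 k hlt hkK])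
      · rcases hl.2.1.eq_or_lt with e | hlt
        · exact Or.inl e
        · right
          by_contra hlL
          exact (hagr n hqN heq hl).2.2 hlt (by rw [ht.2 l hlt hlL, ht'.2 l hlt hlL])
    subst haa
    rw [add_left_cancel heq]
  have himg : (A ×ˢ T).image (fun y : ZMod N × ZMod N => y.1 + y.2) = univ := by
    rw [← card_eq_iff_eq_univ, ZMod.card]
    refine le_antisymm ?_ ?_
    · simpa [ZMod.card] using card_le_univ ((A ×ˢ T).image fun y : ZMod N × ZMod N => y.1 + y.2)
    · rw [card_image_of_injOn hinj, card_product]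
      calc N = A.card * (p ^ K.card * q ^ L.card) := hN.trans hc.symm
        _ ≤ _ := Nat.mul_le_mul_left _ (card_digitSet hpq hN hK hL)
  refine ⟨T, fun x => ?_⟩
  have hx : x ∈ (A ×ˢ T).image (fun y : ZMod N × ZMod N => y.1 + y.2) := himg ▸ mem_univ x
  obtain ⟨y, hy, hyx⟩ := mem_image.1 hx
  have hy' := mem_product.1 hy
  refine ⟨y, ⟨hy'.1, hy'.2, hyx⟩, fun y' ⟨h1, h2, h3⟩ => ?_⟩
  exact hinj (mem_coe.2 (mem_product.2 ⟨h1, h2⟩)) (mem_coe.2 hy) (h3.trans hyx.symm)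

end cyclic

/-! ### Cell counts and the top `q`-digit -/

/-- The number of points in a cell given by the first `i` `p`-digits and first `j` `q`-digits. -/
noncomputable def num (F : Fam p q α) (i : ℕ) (x : ℕ → ZMod p) (j : ℕ) (y : ℕ → ZMod q) : ℤ :=
  ∑ a ∈ F.S, ind i x (F.u a) * ind j y (F.v a)

theorem num_nonneg (F : Fam p q α) (i : ℕ) (x : ℕ → ZMod p) (j : ℕ) (y : ℕ → ZMod q) :
    0 ≤ num F i x j y :=
  sum_nonneg fun _ _ => mul_nonneg (ind_nonneg _ _ _) (ind_nonneg _ _ _)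

theorem num_ne_zero {F : Fam p q α} {i : ℕ} {x : ℕ → ZMod p} {j : ℕ} {y : ℕ → ZMod q} :
    num F i x j y ≠ 0 ↔ ∃ a ∈ F.S, (∀ t < i, F.u a t = x t) ∧ ∀ t < j, F.v a t = y t := by
  constructor
  · intro h
    obtain ⟨a, ha, hne⟩ := exists_ne_zero_of_sum_ne_zero h
    refine ⟨a, ha, ?_, ?_⟩
    · have := left_ne_zero_of_mul hne
      rwa [Ne, ind_eq_zero, not_not] at this
    · have := right_ne_zero_of_mul hne
      rwa [Ne, ind_eq_zero, not_not] at this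
  · rintro ⟨a, ha, h1, h2⟩
    refine (sum_pos' (fun b _ => mul_nonneg (ind_nonneg _ _ _) (ind_nonneg _ _ _))
      ⟨a, ha, ?_⟩).ne'
    rw [ind_eq_one.2 h1, ind_eq_one.2 h2]
    norm_num

theorem num_congr (F : Fam p q α) {i j : ℕ} {x x' : ℕ → ZMod p} {y y' : ℕ → ZMod q}
    (hx : ∀ t < i, x t = x' t) (hy : ∀ t < j, y t = y' t) : num F i x j y = num F i x' j y' :=
  sum_congr rfl fun a _ => by rw [ind_congr hx, ind_congr hy]

theorem num_refine [NeZero p] (F : Fam p q α) (i : ℕ) (x : ℕ → ZMod p) (j : ℕ)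
    (y : ℕ → ZMod q) : num F i x j y = ∑ e, num F (i + 1) (Function.update x i e) j y :=
  sum_ind_refine F.S F.u (fun a => ind j y (F.v a)) i x

theorem num_swap (F : Fam p q α) (i : ℕ) (x : ℕ → ZMod p) (j : ℕ) (y : ℕ → ZMod q) :
    num F.swap j y i x = num F i x j y := sum_congr rfl fun _ _ => mul_comm _ _

theorem num_refine' [NeZero q] (F : Fam p q α) (i : ℕ) (x : ℕ → ZMod p) (j : ℕ)
    (y : ℕ → ZMod q) : num F i x j y = ∑ e, num F i x (j + 1) (Function.update y j e) := by
  rw [← num_swap, num_refine]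
  exact sum_congr rfl fun e _ => num_swap _ _ _ _ _

theorem num_zero (F : Fam p q α) (x : ℕ → ZMod p) (y : ℕ → ZMod q) :
    num F 0 x 0 y = F.S.card := by
  simp [num, ind_zero]

theorem num_eq_card (F : Fam p q α) (i : ℕ) (x : ℕ → ZMod p) (j : ℕ) (y : ℕ → ZMod q) :
    num F i x j y =
      (F.S.filter fun a => (∀ t < i, F.u a t = x t) ∧ ∀ t < j, F.v a t = y t).card := by
  rw [card_filter, num]
  push_cast
  refine sum_congr rfl fun a _ => ?_
  unfold ind
  split_ifs <;> simp_all

theorem Bal.num_eq {F : Fam p q α} {i : ℕ} (h : Bal F (i + 1) 0) {x x' : ℕ → ZMod p}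
    (hx : ∀ t < i, x t = x' t) (y : ℕ → ZMod q) :
    num F (i + 1) x 0 y = num F (i + 1) x' 0 y := by
  have := equi_of_test (S := F.S) (f := fun _ => 1) (fun w hw => h w hw _ rfl) x x' hx
  simpa [num, ind_zero] using this

theorem Bal.num_sub_eq {F : Fam p q α} {i j : ℕ} (h : Bal F (i + 1) (j + 1))
    {x x' : ℕ → ZMod p} (hx : ∀ t < i, x t = x' t) {y y' : ℕ → ZMod q}
    (hy : ∀ t < j, y t = y' t) :
    num F (i + 1) x (j + 1) y - num F (i + 1) x (j + 1) y' =
      num F (i + 1) x' (j + 1) y - num F (i + 1) x' (j + 1) y' := by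
  have := h _ ⟨x, x', hx, rfl⟩ _ ⟨y, y', hy, rfl⟩
  rw [← sub_eq_zero, ← this]
  unfold num
  rw [← sum_sub_distrib, ← sum_sub_distrib, ← sum_sub_distrib]
  exact sum_congr rfl fun a _ => by ring

theorem bal_of_num_eq {F : Fam p q α} {i j : ℕ} (h : ∀ (x : ℕ → ZMod p) (y y' : ℕ → ZMod q),
    (∀ t < j, y t = y' t) → num F i x (j + 1) y = num F i x (j + 1) y') : Bal F i (j + 1) := by
  rintro w hw z ⟨y, y', hy, rfl⟩
  cases i with
  | zero =>
    obtain rfl := hw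
    have := h 0 y y' hy
    rw [← sub_eq_zero] at this
    rw [← this, num, num, ← sum_sub_distrib]
    exact sum_congr rfl fun a _ => by simp [ind_zero]
  | succ i =>
    obtain ⟨x, x', -, rfl⟩ := hw
    have h1 := h x y y' hy
    have h2 := h x' y y' hy
    have : num F (i + 1) x (j + 1) y - num F (i + 1) x (j + 1) y' -
      (num F (i + 1) x' (j + 1) y - num F (i + 1) x' (j + 1) y') = 0 := by rw [h1, h2]; ring
    rw [← this]
    unfold num
    rw [← sum_sub_distrib, ← sum_sub_distrib, ← sum_sub_distrib]
    exact sum_congr rfl fun a _ => by ring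

theorem num_eq_of_le [NeZero p] {F : Fam p q α} {i j : ℕ} {y y' : ℕ → ZMod q}
    (h : ∀ x : ℕ → ZMod p, num F i x j y = num F i x j y') {i' : ℕ} (hi : i' ≤ i)
    (x : ℕ → ZMod p) : num F i' x j y = num F i' x j y' := by
  induction hd : i - i' generalizing i' x with
  | zero => obtain rfl : i' = i := by omega
            exact h x
  | succ d ih =>
    rw [num_refine, num_refine F i' x j y']
    exact sum_congr rfl fun e _ => ih (by omega) _ (by omega)

/-- The cells of the `n`-th `q`-digit over a node of level `i`. -/
noncomputable def cell (F : Fam p q α) (n i : ℕ) (x : ℕ → ZMod p) (y : ℕ → ZMod q)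
    (c : ZMod q) : ℤ := num F i x (n + 1) (Function.update y n c)

/-- The cells over nodes of level `i` are constant or take only the values `0` and `θ`. -/
def TwoVal (F : Fam p q α) (n i : ℕ) (θ : ℤ) : Prop :=
  ∀ x y, (∀ c c', cell F n i x y c = cell F n i x y c') ∨
    ∀ c, cell F n i x y c = 0 ∨ cell F n i x y c = θ

/-- The cells over this node are not constant. -/
def Nonconst (F : Fam p q α) (n i : ℕ) (x : ℕ → ZMod p) (y : ℕ → ZMod q) : Prop :=
  ∃ c c', cell F n i x y c ≠ cell F n i x y c'

section cells

variable {F : Fam p q α} {i : ℕ} {θ : ℤ}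

theorem cell_nonneg (F : Fam p q α) (n i : ℕ) (x : ℕ → ZMod p) (y : ℕ → ZMod q) (c : ZMod q) :
    0 ≤ cell F n i x y c := num_nonneg _ _ _ _ _

theorem cell_congr {x x' : ℕ → ZMod p} (h : ∀ t < i, x t = x' t) (y : ℕ → ZMod q) (c : ZMod q) :
    cell F n i x y c = cell F n i x' y c := num_congr _ h fun _ _ => rfl

theorem cell_refine [NeZero p] (F : Fam p q α) (n i : ℕ) (x : ℕ → ZMod p) (y : ℕ → ZMod q)
    (c : ZMod q) : cell F n i x y c = ∑ e, cell F n (i + 1) (Function.update x i e) y c :=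
  num_refine _ _ _ _ _

theorem cell_ne_zero {x : ℕ → ZMod p} {y : ℕ → ZMod q} {c : ZMod q} :
    cell F n i x y c ≠ 0 ↔ ∃ a ∈ F.S, (∀ t < i, F.u a t = x t) ∧ (∀ t < n, F.v a t = y t) ∧
      F.v a n = c := by
  rw [cell, num_ne_zero]
  refine exists_congr fun a => and_congr_right fun _ => and_congr_right fun _ => ?_
  constructor
  · intro h
    refine ⟨fun t ht => ?_, ?_⟩
    · rw [h t (by omega), Function.update_of_ne ht.ne]
    · rw [h n (by omega), Function.update_self]
  · rintro ⟨h1, h2⟩ t ht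
    rcases Nat.lt_succ_iff_lt_or_eq.1 ht with h | rfl
    · rw [h1 t h, Function.update_of_ne h.ne]
    · rw [h2, Function.update_self]

theorem cell_sub_eq (h : Bal F (i + 1) (n + 1)) {x x' : ℕ → ZMod p} (hx : ∀ t < i, x t = x' t)
    (y : ℕ → ZMod q) (c c' : ZMod q) :
    cell F n (i + 1) x y c - cell F n (i + 1) x y c' =
      cell F n (i + 1) x' y c - cell F n (i + 1) x' y c' :=
  h.num_sub_eq hx (update_agree _ _ _ _)

theorem TwoVal.of_nonconst (h : TwoVal F n i θ) {x : ℕ → ZMod p} {y : ℕ → ZMod q}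
    (hx : Nonconst F n i x y) (c : ZMod q) : cell F n i x y c = 0 ∨ cell F n i x y c = θ := by
  rcases h x y with h | h
  · obtain ⟨c, c', hc⟩ := hx
    exact absurd (h c c') hc
  · exact h c

theorem TwoVal.exists_values (h : TwoVal F n i θ) {x : ℕ → ZMod p} {y : ℕ → ZMod q}
    (hx : Nonconst F n i x y) : (∃ c, cell F n i x y c = 0) ∧ ∃ c, cell F n i x y c = θ := by
  have h2 := h.of_nonconst hx
  obtain ⟨c, c', hc⟩ := hx
  rcases h2 c with h | h <;> rcases h2 c' with h' | h'
  · exact absurd (h.trans h'.symm) hc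
  · exact ⟨⟨c, h⟩, c', h'⟩
  · exact ⟨⟨c', h'⟩, c, h⟩
  · exact absurd (h.trans h'.symm) hc

theorem nonconst_sibling (hb : Bal F (i + 1) (n + 1)) {x x' : ℕ → ZMod p}
    (hx : ∀ t < i, x t = x' t) {y : ℕ → ZMod q} (h : Nonconst F n (i + 1) x y) :
    Nonconst F n (i + 1) x' y := by
  obtain ⟨c, c', hc⟩ := h
  exact ⟨c, c', fun e => hc (by
    have := cell_sub_eq hb hx y c c'
    rwa [e, sub_self, sub_eq_zero] at this)⟩

/-- In the balanced case sibling nodes with non-constant cells have equal cells. -/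
theorem cell_eq_sibling (hθ : 0 < θ) (hb : Bal F (i + 1) (n + 1)) (h2 : TwoVal F n (i + 1) θ)
    {x x' : ℕ → ZMod p} (hx : ∀ t < i, x t = x' t) {y : ℕ → ZMod q}
    (h : Nonconst F n (i + 1) x y) (c : ZMod q) :
    cell F n (i + 1) x y c = cell F n (i + 1) x' y c := by
  have h' := nonconst_sibling hb hx h
  obtain ⟨⟨c0, h0⟩, c1, h1⟩ := h2.exists_values h
  have e := cell_sub_eq hb hx y c1 c0
  have e' := cell_sub_eq hb hx y c c0
  have f0 := h2.of_nonconst h' c0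
  have f1 := h2.of_nonconst h' c1
  have : cell F n (i + 1) x' y c0 = 0 := by omega
  omega

theorem cell_eq_mul [NeZero p] (hθ : 0 < θ) (hb : Bal F (i + 1) (n + 1))
    (h2 : TwoVal F n (i + 1) θ) {x : ℕ → ZMod p} {y : ℕ → ZMod q}
    (h : Nonconst F n (i + 1) x y) (c : ZMod q) :
    cell F n i x y c = p * cell F n (i + 1) x y c := by
  rw [cell_refine, sum_congr rfl fun e _ => (cell_eq_sibling hθ hb h2 (x := x)
    (x' := Function.update x i e) (fun t ht => (Function.update_of_ne ht.ne _ _).symm) h c).symm]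
  simp

theorem Nonconst.of_bal [NeZero p] (hθ : 0 < θ) (hb : Bal F (i + 1) (n + 1))
    (h2 : TwoVal F n (i + 1) θ) {x : ℕ → ZMod p} {y : ℕ → ZMod q}
    (h : Nonconst F n (i + 1) x y) : Nonconst F n i x y := by
  obtain ⟨c, c', hc⟩ := id h
  refine ⟨c, c', ?_⟩
  rw [cell_eq_mul hθ hb h2 h, cell_eq_mul hθ hb h2 h]
  have hp : (p : ℤ) ≠ 0 := by exact_mod_cast NeZero.ne p
  exact fun e => hc (mul_left_cancel₀ hp e)

theorem nonconst_child [NeZero p] {x : ℕ → ZMod p} {y : ℕ → ZMod q} (h : Nonconst F n i x y) :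
    ∃ e, Nonconst F n (i + 1) (Function.update x i e) y := by
  by_contra hne
  simp only [Nonconst, not_exists, not_not] at hne
  obtain ⟨c, c', hc⟩ := h
  refine hc ?_
  rw [cell_refine, cell_refine F n i x y c']
  exact sum_congr rfl fun e _ => hne e c c'

/-- If one child is non-constant, all its siblings have the same cells and the values multiply by
`p`; if all children are constant, so is the parent. -/
theorem TwoVal.of_bal [NeZero p] (hθ : 0 < θ) (hb : Bal F (i + 1) (n + 1))
    (h2 : TwoVal F n (i + 1) θ) : TwoVal F n i (p * θ) := by
  intro x y
  by_cases h : Nonconst F n (i + 1) x y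
  · right
    intro c
    rw [cell_eq_mul hθ hb h2 h]
    rcases h2.of_nonconst h c with e | e <;> simp [e]
  · left
    by_contra hne
    push Not at hne
    obtain ⟨e, he⟩ := nonconst_child hne
    exact h (nonconst_sibling hb (fun t ht => Function.update_of_ne ht.ne _ _) he)

/-- No two points over the same `q`-leaf first differ at the `p`-digit `i`. -/
def Excl (n : ℕ) (F : Fam p q α) (i : ℕ) : Prop :=
  ∀ a ∈ F.S, ∀ a' ∈ F.S, (∀ t < i, F.u a t = F.u a' t) → (∀ t < n, F.v a t = F.v a' t) →
    F.u a i = F.u a' i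

theorem Excl.eq_zero (h : Excl (n + 1) F i) {x : ℕ → ZMod p} {e e' : ZMod p} (he : e ≠ e')
    {y : ℕ → ZMod q} {c : ZMod q} (h1 : cell F n (i + 1) (Function.update x i e) y c ≠ 0) :
    cell F n (i + 1) (Function.update x i e') y c = 0 := by
  by_contra h2
  obtain ⟨a, ha, hau, hav, hac⟩ := cell_ne_zero.1 h1
  obtain ⟨b, hb, hbu, hbv, hbc⟩ := cell_ne_zero.1 h2
  have := h a ha b hb (fun t ht => by
    rw [hau t (by omega), hbu t (by omega), update_agree i x e e' t ht]) (fun t ht => by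
    rcases Nat.lt_succ_iff_lt_or_eq.1 ht with ht | rfl
    · rw [hav t ht, hbv t ht]
    · rw [hac, hbc])
  rw [hau i (by omega), hbu i (by omega), Function.update_self, Function.update_self] at this
  exact he this

theorem Excl.cell_eq [NeZero p] (h : Excl (n + 1) F i) {x : ℕ → ZMod p} {e : ZMod p}
    {y : ℕ → ZMod q} {c : ZMod q} (h1 : cell F n (i + 1) (Function.update x i e) y c ≠ 0) :
    cell F n i x y c = cell F n (i + 1) (Function.update x i e) y c := by
  rw [cell_refine]
  exact sum_eq_single e (fun e' _ he => h.eq_zero he.symm h1) (by simp)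

theorem exists_child [NeZero p] {x : ℕ → ZMod p} {y : ℕ → ZMod q} {c : ZMod q}
    (h : cell F n i x y c ≠ 0) : ∃ e, cell F n (i + 1) (Function.update x i e) y c ≠ 0 := by
  rw [cell_refine] at h
  obtain ⟨e, -, he⟩ := exists_ne_zero_of_sum_ne_zero h
  exact ⟨e, he⟩

/-- Each non-zero cell of the parent comes from a single child. A child with constant non-zero cells
occupies every value `c` and makes the parent constant; otherwise the values are inherited. -/
theorem TwoVal.of_excl [NeZero p] (h : Excl (n + 1) F i) (h2 : TwoVal F n (i + 1) θ) :
    TwoVal F n i θ := by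
  intro x y
  by_cases hc : ∃ e, (∀ c c', cell F n (i + 1) (Function.update x i e) y c =
      cell F n (i + 1) (Function.update x i e) y c') ∧
      cell F n (i + 1) (Function.update x i e) y 0 ≠ 0
  · obtain ⟨e, h1, h0⟩ := hc
    left
    intro c c'
    rw [h.cell_eq (e := e) (by rwa [h1 c 0]), h.cell_eq (e := e) (by rwa [h1 c' 0]), h1 c c']
  · right
    intro c
    by_cases h0 : cell F n i x y c = 0
    · exact Or.inl h0
    · obtain ⟨e, he⟩ := exists_child h0
      rw [h.cell_eq he]
      rcases h2 (Function.update x i e) y with h1 | h1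
      · exact absurd ⟨e, h1, by rwa [h1 0 c]⟩ hc
      · exact h1 c

theorem bal_of_const [NeZero p] (h : ∀ x y, ¬ Nonconst F n i x y) {i' : ℕ} (hi : i' ≤ i) :
    Bal F i' (n + 1) := by
  refine bal_of_num_eq fun x y y' hy => num_eq_of_le (fun x => ?_) hi x
  have := h x y
  simp only [Nonconst, not_exists, not_not] at this
  have e := this (y n) (y' n)
  unfold cell at e
  rw [Function.update_eq_self] at e
  rw [e]
  refine num_congr _ (fun _ _ => rfl) fun t ht => ?_
  rcases Nat.lt_succ_iff_lt_or_eq.1 ht with ht | rfl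
  · rw [Function.update_of_ne ht.ne, hy t ht]
  · rw [Function.update_self]

theorem not_nonconst_zero (h : Bal F 0 (n + 1)) (x : ℕ → ZMod p) (y : ℕ → ZMod q) :
    ¬ Nonconst F n 0 x y := by
  rintro ⟨c, c', hc⟩
  refine hc ?_
  have := h _ rfl _ ⟨_, _, update_agree n y c c', rfl⟩
  rw [← sub_eq_zero, ← this]
  unfold cell num
  rw [← sum_sub_distrib]
  exact sum_congr rfl fun a _ => by simp [ind_zero]

end cells

/-! ### Colours: the first `q`-digit of the dual family -/

/-- The node of `b` of level `k` meets only one value of the first `q`-digit. -/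
def Mono (B : Fam p q β) (k : ℕ) (b : β) : Prop :=
  ∀ b' ∈ B.S, (∀ t < k, B.u b' t = B.u b t) → B.v b' 0 = B.v b 0

theorem Mono.congr {B : Fam p q β} {k : ℕ} {b b' : β} (h : Mono B k b) (hb' : b' ∈ B.S)
    (hbb : ∀ t < k, B.u b' t = B.u b t) : Mono B k b' := fun c hc hcb => by
  rw [h c hc fun t ht => by rw [hcb t ht, hbb t ht], h b' hb' hbb]

theorem Mono.succ {B : Fam p q β} {k : ℕ} {b : β} (h : Mono B k b) : Mono B (k + 1) b :=
  fun b' hb' h' => h b' hb' fun t ht => h' t (by omega)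

theorem num_eq_mul [NeZero p] {B : Fam p q β} {k : ℕ} (h : Bal B (k + 1) 0)
    (x : ℕ → ZMod p) : num B k x 0 0 = p * num B (k + 1) x 0 0 := by
  have := sum_eq_mul_of_test (S := B.S) (f := fun _ => 1) (fun w hw => h w hw _ rfl) x
  simpa [num, ind_zero] using this

theorem dvd_of_nodes {B : Fam p q β} {k : ℕ} {D : Finset β} (hD : D ⊆ B.S)
    (hcl : ∀ b ∈ D, ∀ b' ∈ B.S, (∀ t < k, B.u b' t = B.u b t) → b' ∈ D) {M P : ℤ}
    (h : ∀ b ∈ D, M ∣ P * num B k (B.u b) 0 0) : M ∣ P * D.card := by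
  rw [card_eq_sum_card_image (fun b => fun t : Fin k => B.u b t) D]
  push_cast
  rw [mul_sum]
  refine dvd_sum fun f hf => ?_
  obtain ⟨b, hb, rfl⟩ := mem_image.1 hf
  have e : ((D.filter fun b' => (fun t : Fin k => B.u b' t) = fun t : Fin k => B.u b t).card : ℤ) =
      num B k (B.u b) 0 0 := by
    rw [num_eq_card]
    congr 2
    ext b'
    simp only [mem_filter]
    constructor
    · rintro ⟨h1, h2⟩
      exact ⟨hD h1, fun t ht => congrFun h2 ⟨t, ht⟩, by simp⟩
    · rintro ⟨h1, h2, -⟩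
      exact ⟨hcl b hb b' h1 h2, funext fun t => h2 t t.2⟩
  rw [e]
  exact h b hb

/-- Nodes of level `k` with several values of the first `q`-digit have mass `|B| / p ^ r` and
exist, and the masses of the others are controlled modulo `|B|`. -/
structure Level (B : Fam p q β) (k r : ℕ) : Prop where
  mass : ∀ b ∈ B.S, ¬ Mono B k b → (p : ℤ) ^ r * num B k (B.u b) 0 0 = B.S.card
  ex : ∃ b ∈ B.S, ¬ Mono B k b
  dvd : ∀ c, (B.S.card : ℤ) ∣ (p : ℤ) ^ r * (B.S.filter fun b => B.v b 0 = c ∧ Mono B k b).card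

theorem color_card [NeZero q] {B : Fam p q β} (h : Bal B 0 1) (c : ZMod q) :
    (B.S.card : ℤ) = q * (B.S.filter fun b => B.v b 0 = c).card := by
  have h1 := num_eq_mul (B := B.swap) (k := 0) h.swap (fun _ => c)
  rw [num_zero, num_eq_card] at h1
  simpa [Fam.swap] using h1

/-- Two-coloured nodes split evenly, so each newly monochromatic child has mass `|B| / p ^ (r + 1)`,
which preserves the divisibility. If no two-coloured node survived, `|B| = q * |class|` would divide
`p ^ (r + 1) * |class|` for a whole colour class, forcing `q ∣ p ^ (r + 1)`. -/
theorem Level.run [hp : Fact p.Prime] [hq : Fact q.Prime] (hpq : p ≠ q) {B : Fam p q β}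
    {k r : ℕ} (h : Level B k r) (hb : Bal B (k + 1) 0) (h01 : Bal B 0 1) :
    Level B (k + 1) (r + 1) := by
  have hmass : ∀ b ∈ B.S, ¬ Mono B k b →
      (p : ℤ) ^ (r + 1) * num B (k + 1) (B.u b) 0 0 = B.S.card := fun b hbS hm => by
    rw [← h.mass b hbS hm, num_eq_mul hb, pow_succ]
    ring
  have hdvd : ∀ c, (B.S.card : ℤ) ∣
      (p : ℤ) ^ (r + 1) * (B.S.filter fun b => B.v b 0 = c ∧ Mono B (k + 1) b).card := by
    intro c
    have hsplit : (B.S.filter fun b => B.v b 0 = c ∧ Mono B (k + 1) b) =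
        (B.S.filter fun b => B.v b 0 = c ∧ Mono B k b) ∪
        (B.S.filter fun b => B.v b 0 = c ∧ Mono B (k + 1) b ∧ ¬ Mono B k b) := by
      ext b
      simp only [mem_union, mem_filter]
      have := @Mono.succ p q β B k b
      tauto
    rw [hsplit, card_union_of_disjoint]
    · push_cast
      rw [mul_add]
      refine dvd_add ?_ ?_
      · rw [pow_succ', mul_assoc]
        exact (h.dvd c).mul_left _
      · refine dvd_of_nodes (k := k + 1) (filter_subset _ _) ?_ ?_
        · intro b hb' b' hbS' hbb
          obtain ⟨h1, h2, h3, h4⟩ := mem_filter.1 hb'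
          refine mem_filter.2 ⟨hbS', ?_, h3.congr hbS' hbb, fun h5 => h4 (h5.congr h1
            fun t ht => (hbb t (by omega)).symm)⟩
          rw [h3 b' hbS' hbb, h2]
        · intro b hb'
          obtain ⟨h1, h2, h3, h4⟩ := mem_filter.1 hb'
          rw [hmass b h1 h4]
    · rw [disjoint_left]
      intro b hb1 hb2
      exact (mem_filter.1 hb2).2.2.2 (mem_filter.1 hb1).2.2
  refine ⟨fun b hbS hm => hmass b hbS fun h' => hm h'.succ, ?_, hdvd⟩
  by_contra hall
  push Not at hall
  obtain ⟨b, hbS, -⟩ := h.ex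
  have h1 := hdvd (B.v b 0)
  rw [filter_congr fun b' hb' => and_iff_left (hall b' hb'), color_card h01 (B.v b 0)] at h1
  have hpos : 0 < (B.S.filter fun b' => B.v b' 0 = B.v b 0).card :=
    card_pos.2 ⟨b, mem_filter.2 ⟨hbS, rfl⟩⟩
  have hne : ((B.S.filter fun b' => B.v b' 0 = B.v b 0).card : ℤ) ≠ 0 := by exact_mod_cast hpos.ne'
  have h2 := (mul_dvd_mul_iff_right hne).1 h1
  have h3 : q ∣ p ^ (r + 1) := by exact_mod_cast h2
  exact hpq ((Nat.prime_dvd_prime_iff_eq hq.out hp.out).1 (hq.out.dvd_of_dvd_pow h3)).symm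

theorem Level.gap {B : Fam p q β} {k r : ℕ} (h : Level B k r)
    (hs : ∀ b ∈ B.S, ¬ Mono B k b → ∀ b' ∈ B.S, (∀ t < k, B.u b' t = B.u b t) →
      B.u b' k = B.u b k) : Level B (k + 1) r := by
  have hext : ∀ b ∈ B.S, ¬ Mono B k b → ∀ b' ∈ B.S, (∀ t < k, B.u b' t = B.u b t) →
      ∀ t < k + 1, B.u b' t = B.u b t := by
    intro b hb hm b' hb' hbb t ht
    rcases Nat.lt_succ_iff_lt_or_eq.1 ht with ht | rfl
    · exact hbb t ht
    · exact hs b hb hm b' hb' hbb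
  have hiff : ∀ b ∈ B.S, (Mono B (k + 1) b ↔ Mono B k b) := by
    intro b hb
    refine ⟨fun hm => ?_, Mono.succ⟩
    by_contra hm'
    exact hm' fun b' hb' hbb => hm b' hb' (hext b hb hm' b' hb' hbb)
  refine ⟨fun b hb hm => ?_, ?_, fun c => ?_⟩
  · rw [hiff b hb] at hm
    rw [← h.mass b hb hm, num_eq_card, num_eq_card]
    congr 3
    refine filter_congr fun b' hb' => ?_
    refine and_congr_left fun _ => ⟨fun H t ht => H t (by omega), fun H => hext b hb hm b' hb' H⟩
  · obtain ⟨b, hb, hm⟩ := h.ex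
    exact ⟨b, hb, by rwa [hiff b hb]⟩
  · rw [filter_congr fun b hb => and_congr_right fun _ => hiff b hb]
    exact h.dvd c

/-- Two non-constant functions on a set separate a common pair of points. -/
theorem exists_pair_ne {γ δ ε : Type} {P : γ → Prop} {f : γ → δ} {g : γ → ε} {a a' b b' : γ}
    (ha : P a) (ha' : P a') (hb : P b) (hb' : P b') (hf : f a ≠ f a') (hg : g b ≠ g b') :
    ∃ x y, P x ∧ P y ∧ f x ≠ f y ∧ g x ≠ g y := by
  by_cases h1 : g a = g a'
  · have : ∃ c, P c ∧ g c ≠ g a := by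
      by_cases h2 : g b = g a
      · exact ⟨b', hb', fun h3 => hg (h2.trans h3.symm)⟩
      · exact ⟨b, hb, h2⟩
    obtain ⟨c, hc, hca⟩ := this
    by_cases h3 : f c = f a
    · exact ⟨c, a', hc, ha', h3 ▸ hf, h1 ▸ hca⟩
    · exact ⟨c, a, hc, ha, h3, hca⟩
  · exact ⟨a, a', ha, ha', hf, h1⟩

/-- Inside the node both the next `p`-digit and the colour are non-constant, so one pair is
separated by both. -/
theorem exists_agr_zero {B : Fam p q β} {k : ℕ} (hk : k < m) {b : β} (hm : ¬ Mono B k b)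
    (hb : b ∈ B.S)
    (hs : ∃ b' ∈ B.S, (∀ t < k, B.u b' t = B.u b t) ∧ B.u b' k ≠ B.u b k) :
    ∃ b ∈ B.S, ∃ b' ∈ B.S, Agr m k (B.u b) (B.u b') ∧ Agr (n + 1) 0 (B.v b) (B.v b') := by
  unfold Mono at hm
  push Not at hm
  obtain ⟨c, hc, hcb, hcv⟩ := hm
  obtain ⟨d, hd, hdb, hdu⟩ := hs
  obtain ⟨x, y, ⟨hx, hxb⟩, ⟨hy, hyb⟩, h1, h2⟩ :=
    exists_pair_ne (P := fun a => a ∈ B.S ∧ ∀ t < k, B.u a t = B.u b t)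
      (f := fun a => B.u a k) (g := fun a => B.v a 0) (a := d) (a' := b) (b := c) (b' := b)
      ⟨hd, hdb⟩ ⟨hb, fun _ _ => rfl⟩ ⟨hc, hcb⟩ ⟨hb, fun _ _ => rfl⟩ hdu hcv
  exact ⟨x, hx, y, hy, ⟨fun t ht => by rw [hxb t ht, hyb t ht], hk.le, fun _ => h1⟩,
    by simp, by omega, fun _ => h2⟩

/-! ### Runs and gaps of an irreducible pair -/

section pair

variable {A : Fam p q α} {B : Fam p q β}

theorem SP.inj (h : SP m n A B) {a a' : α} (ha : a ∈ A.S) (ha' : a' ∈ A.S)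
    (hu : ∀ t < m, A.u a t = A.u a' t) (hv : ∀ t < n, A.v a t = A.v a' t) : a = a' := by
  by_contra hne
  have := h.left a ha a' ha' hne m n ⟨hu, le_rfl, by simp⟩ ⟨hv, le_rfl, by simp⟩
  rw [Nat.sub_self, Nat.sub_self] at this
  exact not_bal_zero h.symm.nonempty this

theorem SP.bal (h : SP m n A B) {a a' : α} (ha : a ∈ A.S) (ha' : a' ∈ A.S) {k l : ℕ}
    (hu : Agr m k (A.u a) (A.u a')) (hv : Agr n l (A.v a) (A.v a')) (hkl : k < m ∨ l < n) :
    Bal B (m - k) (n - l) := by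
  refine h.left a ha a' ha' ?_ k l hu hv
  rintro rfl
  rcases hkl with hlt | hlt
  · exact hu.2.2 hlt rfl
  · exact hv.2.2 hlt rfl

theorem SP.num_le_one (h : SP m n A B) (x : ℕ → ZMod p) (y : ℕ → ZMod q) :
    num A m x n y ≤ 1 := by
  rw [num_eq_card]
  norm_cast
  refine card_le_one.2 fun a ha b hb => ?_
  obtain ⟨ha, hau, hav⟩ := mem_filter.1 ha
  obtain ⟨hb, hbu, hbv⟩ := mem_filter.1 hb
  exact h.inj ha hb (fun t ht => by rw [hau t ht, hbu t ht]) fun t ht => by rw [hav t ht, hbv t ht]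

theorem SP.twoVal (h : SP m (n + 1) A B) : TwoVal A n m 1 := fun x y => Or.inr fun c => by
  have h1 := h.num_le_one x (Function.update y n c)
  have h2 := cell_nonneg A n m x y c
  unfold cell at *
  omega

theorem Irr.exists_color (hI : Irr m (n + 1) A B) : ∃ b ∈ B.S, ¬ Mono B 0 b := by
  obtain ⟨b, hb, b', hb', hv⟩ := hI.qB.exists_agr 0 (by omega)
  refine ⟨b, hb, fun hm => hv.2.2 (by omega) (hm b' hb' (by simp)).symm⟩

theorem SP.bal_top (h : SP (m + 1) (n + 1) A B) (hI : Irr (m + 1) (n + 1) A B) :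
    Bal A (m + 1) (n + 1) := by
  obtain ⟨b, hb, hm⟩ := hI.exists_color
  obtain ⟨c, hc, c', hc', hu⟩ := hI.pB.exists_agr 0 (by omega)
  have hne := hu.2.2 (by omega)
  have : ∃ b' ∈ B.S, (∀ t < 0, B.u b' t = B.u b t) ∧ B.u b' 0 ≠ B.u b 0 := by
    by_cases e : B.u c 0 = B.u b 0
    · exact ⟨c', hc', by simp, fun e' => hne (e.trans e'.symm)⟩
    · exact ⟨c, hc, by simp, e⟩
  obtain ⟨x, hx, y, hy, h1, h2⟩ := exists_agr_zero (m := m + 1) (n := n) (by omega) hm hb this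
  exact h.symm.bal hx hy h1 h2 (Or.inl (by omega))

/-- Suppose a leaf is occupied over `x` but empty over a sibling `x'`. Mixed balance at the top
level then forces all leaves over `x` that differ only in the last `q`-digit to be occupied, and two
such points yield the claim. Without such a leaf, the top `p`-digit of `A` would be free. -/
theorem SP.bal_zero_one [hq : Fact q.Prime] (h : SP (m + 1) (n + 1) A B)
    (hI : Irr (m + 1) (n + 1) A B) : Bal B 0 1 := by
  by_contra hno
  have key : ∀ (x x' : ℕ → ZMod p), (∀ t < m, x t = x' t) → ∀ y : ℕ → ZMod q,
      num A (m + 1) x' (n + 1) y < num A (m + 1) x (n + 1) y → False := by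
    intro x x' hx y hlt
    have h1 := h.num_le_one x y
    have h2 := num_nonneg A (m + 1) x' (n + 1) y
    have hall : ∀ c, cell A n (m + 1) x y c ≠ 0 := by
      intro c h0
      have e := cell_sub_eq (h.bal_top hI) hx y c (y n)
      have h3 := cell_nonneg A n (m + 1) x' y c
      unfold cell at e h0 h3
      rw [Function.update_eq_self] at e
      omega
    obtain ⟨a, ha, hau, hav, hac⟩ := cell_ne_zero.1 (hall 0)
    obtain ⟨b, hb, hbu, hbv, hbc⟩ := cell_ne_zero.1 (hall 1)
    have := h.bal ha hb (k := m + 1) (l := n)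
      ⟨fun t ht => by rw [hau t ht, hbu t ht], le_rfl, by simp⟩
      ⟨fun t ht => by rw [hav t ht, hbv t ht], by omega, fun _ => by rw [hac, hbc]; simp⟩
      (Or.inr (by omega))
    rw [Nat.sub_self, Nat.add_sub_cancel_left] at this
    exact hno this
  have heq : ∀ (x x' : ℕ → ZMod p), (∀ t < m, x t = x' t) → ∀ y : ℕ → ZMod q,
      num A (m + 1) x (n + 1) y = num A (m + 1) x' (n + 1) y := fun x x' hx y => by
    rcases lt_trichotomy (num A (m + 1) x (n + 1) y) (num A (m + 1) x' (n + 1) y) with e | e | e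
    · exact (key x' x (fun t ht => (hx t ht).symm) y e).elim
    · exact e
    · exact (key x x' hx y e).elim
  refine hI.pA.not_free m (by omega) fun j hj => ?_
  have : Bal A.swap j (m + 1) := by
    refine bal_of_num_eq fun y x x' hx => num_eq_of_le (i := n + 1) (fun y => ?_) hj y
    rw [num_swap, num_swap]
    exact heq x x' hx y
  exact this.swap

theorem Irr.exists_nonconst [NeZero p] (hI : Irr m (n + 1) A B) :
    ∃ x y, Nonconst A n m x y := by
  by_contra hno
  push Not at hno
  exact hI.qA.not_free n (by omega) fun i hi => (bal_of_const hno hi).swap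

/-- Siblings with equal cells provide two points of `A` that share all `q`-digits and first differ
at the `p`-digit `i`. -/
theorem SP.bal_of_run [hp : Fact p.Prime] (h : SP m (n + 1) A B) {i : ℕ} (hi : i < m) {θ : ℤ}
    (hθ : 0 < θ) (hb : Bal A (i + 1) (n + 1)) (h2 : TwoVal A n (i + 1) θ)
    (hnc : ∃ x y, Nonconst A n (i + 1) x y) : Bal B (m - i) 0 := by
  obtain ⟨x, y, hx⟩ := hnc
  obtain ⟨-, c, hc⟩ := h2.exists_values hx
  have e := cell_eq_sibling hθ hb h2 (x := x) (x' := Function.update x i (x i + 1))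
    (fun t ht => (Function.update_of_ne ht.ne _ _).symm) hx c
  obtain ⟨a, ha, hau, hav, hac⟩ := cell_ne_zero.1 (hc ▸ hθ.ne' : cell A n (i + 1) x y c ≠ 0)
  obtain ⟨b, hb', hbu, hbv, hbc⟩ := cell_ne_zero.1
    (e ▸ (hc ▸ hθ.ne' : cell A n (i + 1) x y c ≠ 0))
  have := h.bal ha hb' (k := i) (l := n + 1)
    ⟨fun t ht => by rw [hau t (by omega), hbu t (by omega), Function.update_of_ne ht.ne],
      hi.le, fun _ => by
        rw [hau i (by omega), hbu i (by omega), Function.update_self]; simp⟩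
    ⟨fun t ht => by
      rcases Nat.lt_succ_iff_lt_or_eq.1 ht with ht | rfl
      · rw [hav t ht, hbv t ht]
      · rw [hac, hbc], le_rfl, by simp⟩ (Or.inl hi)
  rwa [Nat.sub_self] at this

end pair

section

variable {A : Fam p q α} {B : Fam p q β}

/-- The number of levels below `k` at which the top `q`-digit of `A` is balanced. -/
noncomputable def runs (m n : ℕ) (A : Fam p q α) (k : ℕ) : ℕ :=
  ((range k).filter fun j => Bal A (m - j) (n + 1)).card

theorem runs_succ (k : ℕ) :
    runs m n A (k + 1) = if Bal A (m - k) (n + 1) then runs m n A k + 1 else runs m n A k := by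
  unfold runs
  rw [range_add_one, filter_insert]
  split_ifs
  · rw [card_insert_of_notMem (by simp)]
  · rfl

theorem SP.single_of_gap (h : SP m (n + 1) A B) {k : ℕ} (hk : k < m)
    (hg : ¬ Bal A (m - k) (n + 1)) : ∀ b ∈ B.S, ¬ Mono B k b → ∀ b' ∈ B.S,
      (∀ t < k, B.u b' t = B.u b t) → B.u b' k = B.u b k := by
  intro b hb hm b' hb' hbb
  by_contra hne
  obtain ⟨x, hx, y, hy, h1, h2⟩ := exists_agr_zero (n := n) hk hm hb ⟨b', hb', hbb, hne⟩
  exact hg (h.symm.bal hx hy h1 h2 (Or.inl hk))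

/-- Equidistribution would give a two-coloured node all `p` children, but at a gap it has only one.
-/
theorem SP.not_bal_of_gap [hp : Fact p.Prime] (h : SP m (n + 1) A B) {k : ℕ} (hk : k < m)
    (hg : ¬ Bal A (m - k) (n + 1)) (hex : ∃ b ∈ B.S, ¬ Mono B k b) : ¬ Bal B (k + 1) 0 := by
  intro hb
  obtain ⟨b, hbS, hm⟩ := hex
  have e := hb.num_eq (x := B.u b) (x' := Function.update (B.u b) k (B.u b k + 1))
    (fun t ht => (Function.update_of_ne ht.ne _ _).symm) 0
  have h1 : num B (k + 1) (B.u b) 0 0 ≠ 0 := num_ne_zero.2 ⟨b, hbS, by simp, by simp⟩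
  rw [e] at h1
  obtain ⟨b', hb', hbu, -⟩ := num_ne_zero.1 h1
  have := h.single_of_gap hk hg b hbS hm b' hb' fun t ht => by
    rw [hbu t (by omega), Function.update_of_ne ht.ne]
  rw [hbu k (by omega), Function.update_self] at this
  simp at this

theorem SP.excl_of_not_bal (h : SP m (n + 1) A B) {k : ℕ} (hk : k < m)
    (hb : ¬ Bal B (k + 1) 0) : Excl (n + 1) A (m - 1 - k) := by
  intro a ha a' ha' hu hv
  by_contra hne
  have := h.bal ha ha' (k := m - 1 - k) (l := n + 1) ⟨hu, by omega, fun _ => hne⟩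
    ⟨hv, le_rfl, by simp⟩ (Or.inl (by omega))
  rw [Nat.sub_self, show m - (m - 1 - k) = k + 1 by omega] at this
  exact hb this

/-- The lockstep of the two trees. At a run the common cell value of `A` is multiplied by `p` while
the mass of two-coloured nodes of `B` is divided by `p`. At a gap such nodes of `B` do not branch;
hence `B` is unbalanced there, distinct children in `A` share no `q`-leaf, and both quantities stay.
-/
theorem SP.level [hp : Fact p.Prime] [hq : Fact q.Prime] (hpq : p ≠ q) (h : SP m (n + 1) A B)
    (hI : Irr m (n + 1) A B) (h01 : Bal B 0 1) {k : ℕ} (hk : k ≤ m)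
    (hnc : ∀ j < k, ∃ x y, Nonconst A n (m - j) x y) :
    TwoVal A n (m - k) ((p : ℤ) ^ runs m n A k) ∧ Level B k (runs m n A k) := by
  induction k with
  | zero =>
    have h0 : runs m n A 0 = 0 := by simp [runs]
    have hex := hI.exists_color
    refine ⟨by simpa [h0] using h.twoVal, ?_⟩
    rw [h0]
    refine ⟨fun b _ _ => by rw [num_zero, pow_zero, one_mul], hex, fun c => ?_⟩
    rw [filter_false_of_mem, card_empty]
    · simp
    · rintro b' hb' ⟨-, hm⟩
      obtain ⟨b, hb, hmb⟩ := hex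
      exact hmb (hm.congr hb (by simp))
  | succ k ih =>
    obtain ⟨h2, hL⟩ := ih (by omega) fun j hj => hnc j (by omega)
    have hθ : 0 < (p : ℤ) ^ runs m n A k := by
      have := hp.out.pos
      positivity
    rw [show m - k = m - (k + 1) + 1 by omega] at h2
    rw [runs_succ]
    split_ifs with hb
    · have hnck := hnc k (by omega)
      rw [show m - k = m - (k + 1) + 1 by omega] at hb hnck
      have hB := h.bal_of_run (i := m - (k + 1)) (by omega) hθ hb h2 hnck
      rw [show m - (m - (k + 1)) = k + 1 by omega] at hB
      refine ⟨?_, hL.run hpq hB h01⟩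
      rw [pow_succ']
      exact h2.of_bal hθ hb
    · have hB := h.not_bal_of_gap (by omega) hb hL.ex
      have hE := h.excl_of_not_bal (by omega) hB
      rw [show m - 1 - k = m - (k + 1) by omega] at hE
      exact ⟨h2.of_excl hE, hL.gap (h.single_of_gap (by omega) hb)⟩

/-- Mixed balance makes the difference of two colour counts equal on all `p` children, and these
differences add up to zero by induction. -/
theorem num_eq_of_bal [NeZero p] {k : ℕ} (h01 : Bal B 0 1) (h : ∀ j < k, Bal B (j + 1) 1)
    (x : ℕ → ZMod p) (y y' : ℕ → ZMod q) : num B k x 1 y = num B k x 1 y' := by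
  induction k generalizing x with
  | zero =>
    have := h01 _ rfl _ ⟨y, y', by simp, rfl⟩
    rw [← sub_eq_zero, ← this, num, num, ← sum_sub_distrib]
    exact sum_congr rfl fun a _ => by simp [ind_zero]
  | succ k ih =>
    have e := ih (fun j hj => h j (by omega)) x
    rw [num_refine, num_refine B k x 1 y', ← sub_eq_zero, ← sum_sub_distrib,
      sum_congr rfl fun c _ => (h k (by omega)).num_sub_eq (x := Function.update x k c) (x' := x)
        (fun t ht => Function.update_of_ne ht.ne _ _) (y := y) (y' := y') (by simp)] at e
    simpa [NeZero.ne p, sub_eq_zero] using e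

theorem num_mul_pow [NeZero p] {k : ℕ} (h : ∀ j < k, Bal B (j + 1) 0) (x : ℕ → ZMod p) :
    (p : ℤ) ^ k * num B k x 0 0 = B.S.card := by
  induction k with
  | zero => rw [num_zero]; simp
  | succ k ih =>
    rw [← ih fun j hj => h j (by omega), num_eq_mul (h k (by omega)), pow_succ]
    ring

/-- The node has mass `|B| / p ^ k` and lies inside a colour class of mass `|B| / q`. -/
theorem Mono.le_pow [NeZero p] [NeZero q] {k : ℕ} {b : β} (hb : b ∈ B.S) (hm : Mono B k b)
    (h : ∀ j < k, Bal B (j + 1) 0) (h01 : Bal B 0 1) : q ≤ p ^ k := by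
  have h1 := num_mul_pow h (B.u b)
  rw [color_card h01 (B.v b 0)] at h1
  have hpos : num B k (B.u b) 0 0 ≠ 0 := num_ne_zero.2 ⟨b, hb, by simp, by simp⟩
  have hle : num B k (B.u b) 0 0 ≤ ((B.S.filter fun b' => B.v b' 0 = B.v b 0).card : ℤ) := by
    rw [num_eq_card]
    norm_cast
    refine card_le_card fun b' hb' => ?_
    obtain ⟨h1, h2, -⟩ := mem_filter.1 hb'
    exact mem_filter.2 ⟨h1, hm b' h1 h2⟩
  have h0 : 0 < num B k (B.u b) 0 0 := lt_of_le_of_ne (num_nonneg _ _ _ _ _) hpos.symm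
  have : (q : ℤ) ≤ (p : ℤ) ^ k := by
    refine le_of_mul_le_mul_right ?_ h0
    rw [h1]
    exact mul_le_mul_of_nonneg_left hle (by positivity)
  exact_mod_cast this

/-- Over a chain of balanced levels two nonzero values of a non-constant cell produce mixed
balance of `B`. -/
theorem SP.bal_one_of_two [hp : Fact p.Prime] (h : SP m (n + 1) A B) {k : ℕ} (hk : k ≤ m)
    (hrun : ∀ j < k, Bal A (m - j) (n + 1))
    (h2 : ∀ j ≤ k, ∃ θ : ℤ, 0 < θ ∧ TwoVal A n (m - j) θ) {x : ℕ → ZMod p} {y : ℕ → ZMod q}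
    (hx : Nonconst A n (m - k) x y) {c c' : ZMod q} (hc : cell A n (m - k) x y c ≠ 0)
    (hc' : cell A n (m - k) x y c' ≠ 0) (hne : c ≠ c') : ∀ j < k, Bal B (j + 1) 1 := by
  have step : ∀ j, j < k → ∀ x, Nonconst A n (m - (j + 1)) x y →
      cell A n (m - (j + 1)) x y c ≠ 0 → cell A n (m - (j + 1)) x y c' ≠ 0 →
      ∃ x', Nonconst A n (m - (j + 1) + 1) x' y ∧ cell A n (m - (j + 1) + 1) x' y c ≠ 0 ∧
        cell A n (m - (j + 1) + 1) x' y c' ≠ 0 := by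
    intro j hj x hx hc hc'
    obtain ⟨θ, hθ, hT⟩ := h2 j hj.le
    have hb := hrun j hj
    rw [show m - j = m - (j + 1) + 1 by omega] at hT hb
    obtain ⟨e, he⟩ := nonconst_child hx
    have hcong : ∀ c, cell A n (m - (j + 1)) x y c =
        cell A n (m - (j + 1)) (Function.update x (m - (j + 1)) e) y c := fun c =>
      cell_congr (fun t ht => (Function.update_of_ne ht.ne _ _).symm) y c
    rw [hcong, cell_eq_mul hθ hb hT he] at hc hc'
    exact ⟨_, he, right_ne_zero_of_mul hc, right_ne_zero_of_mul hc'⟩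
  have down : ∀ d j, j + d = k → ∃ x, Nonconst A n (m - j) x y ∧ cell A n (m - j) x y c ≠ 0 ∧
      cell A n (m - j) x y c' ≠ 0 := by
    intro d
    induction d with
    | zero => rintro j rfl; exact ⟨x, hx, hc, hc'⟩
    | succ d ih =>
      intro j hj
      obtain ⟨x, hx, h3, h4⟩ := ih (j + 1) (by omega)
      have := step j (by omega) x hx h3 h4
      rwa [show m - (j + 1) + 1 = m - j by omega] at this
  intro j hj
  obtain ⟨x, hx, h3, h4⟩ := down (k - j) j (by omega)
  obtain ⟨θ, hθ, hT⟩ := h2 j hj.le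
  have hb := hrun j hj
  have hi : m - j = m - 1 - j + 1 := by omega
  rw [hi] at hT hb hx h3 h4
  rw [cell_eq_sibling hθ hb hT (x := x) (x' := Function.update x (m - 1 - j) (x (m - 1 - j) + 1))
    (fun t ht => (Function.update_of_ne ht.ne _ _).symm) hx c'] at h4
  obtain ⟨a, ha, hau, hav, hac⟩ := cell_ne_zero.1 h3
  obtain ⟨b, hb', hbu, hbv, hbc⟩ := cell_ne_zero.1 h4
  have := h.bal ha hb' (k := m - 1 - j) (l := n)
    ⟨fun t ht => by rw [hau t (by omega), hbu t (by omega), Function.update_of_ne ht.ne],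
      by omega, fun _ => by
        rw [hau _ (by omega), hbu _ (by omega), Function.update_self]; simp⟩
    ⟨fun t ht => by rw [hav t ht, hbv t ht], by omega, fun _ => by rwa [hac, hbc]⟩
    (Or.inl (by omega))
  rwa [show m - (m - 1 - j) = j + 1 by omega, Nat.add_sub_cancel_left] at this

/-- The number of nonzero cells grows at most by a factor `p` at a gap, and only if `B` has a
mixed balance there. -/
theorem SP.support_gap [hp : Fact p.Prime] [NeZero q] (h : SP m (n + 1) A B) {i : ℕ} (hi : i < m)
    (hE : Excl (n + 1) A i) {θ : ℤ} (hθ : 0 < θ) (h2 : TwoVal A n (i + 1) θ) {s : ℕ}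
    (hs : ∀ x y, Nonconst A n (i + 1) x y →
      (univ.filter fun c => cell A n (i + 1) x y c ≠ 0).card ≤ s)
    {x : ℕ → ZMod p} {y : ℕ → ZMod q} {e₀ : ZMod p}
    (h0 : Nonconst A n (i + 1) (Function.update x i e₀) y) :
    (univ.filter fun c => cell A n i x y c ≠ 0).card ≤
      if Bal B (m - i) 1 then p * s else s := by
  obtain ⟨-, c₀, hc₀⟩ := h2.exists_values h0
  have hc₀' : cell A n (i + 1) (Function.update x i e₀) y c₀ ≠ 0 := hc₀ ▸ hθ.ne'
  have hchild : ∀ e c, cell A n (i + 1) (Function.update x i e) y c ≠ 0 →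
      Nonconst A n (i + 1) (Function.update x i e) y := by
    intro e c hc
    by_contra hno
    simp only [Nonconst, not_exists, not_not] at hno
    have he : e ≠ e₀ := by
      rintro rfl
      obtain ⟨c, c', hcc⟩ := h0
      exact hcc (hno c c')
    exact hc₀' (hE.eq_zero he (by rwa [hno c₀ c]))
  split_ifs with hb
  · calc (univ.filter fun c => cell A n i x y c ≠ 0).card
        ≤ (univ.biUnion fun e => univ.filter fun c =>
            cell A n (i + 1) (Function.update x i e) y c ≠ 0).card := by
          refine card_le_card fun c hc => ?_
          obtain ⟨e, he⟩ := exists_child (mem_filter.1 hc).2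
          exact mem_biUnion.2 ⟨e, mem_univ _, mem_filter.2 ⟨mem_univ _, he⟩⟩
      _ ≤ ∑ e, (univ.filter fun c =>
            cell A n (i + 1) (Function.update x i e) y c ≠ 0).card := card_biUnion_le
      _ ≤ ∑ e : ZMod p, s := by
          refine sum_le_sum fun e _ => ?_
          rcases (univ.filter fun c =>
            cell A n (i + 1) (Function.update x i e) y c ≠ 0).eq_empty_or_nonempty with h3 | ⟨c, hc⟩
          · rw [h3]; simp
          · exact hs _ _ (hchild e c (mem_filter.1 hc).2)
      _ = p * s := by simp [ZMod.card]
  · refine le_trans (card_le_card fun c hc => ?_) (hs _ _ h0)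
    obtain ⟨e, he⟩ := exists_child (mem_filter.1 hc).2
    by_cases hee : e = e₀
    · subst hee
      exact mem_filter.2 ⟨mem_univ _, he⟩
    · exfalso
      obtain ⟨a, ha, hau, hav, hac⟩ := cell_ne_zero.1 he
      obtain ⟨b, hb', hbu, hbv, hbc⟩ := cell_ne_zero.1 hc₀'
      have hcc : c ≠ c₀ := by
        rintro rfl
        exact hc₀' (hE.eq_zero hee he)
      have := h.bal ha hb' (k := i) (l := n)
        ⟨fun t ht => by
          rw [hau t (by omega), hbu t (by omega), update_agree i x e e₀ t ht],
          hi.le, fun _ => by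
            rw [hau _ (by omega), hbu _ (by omega), Function.update_self, Function.update_self]
            exact hee⟩
        ⟨fun t ht => by rw [hav t ht, hbv t ht], by omega, fun _ => by rwa [hac, hbc]⟩
        (Or.inl hi)
      rw [Nat.add_sub_cancel_left] at this
      exact hb this

/-- A two-coloured node of level `τ` has mass `|B| / p ^ r`. Its points are separated by the
`p`-digits from `τ` on and the `q`-digits in `J`, so `|B| ≤ p ^ (r + (m - τ)) * q ^ J.card`. By
duality `q ^ J.card` divides `|B|`, so `p ^ e * q ^ J.card ≤ |B|`. -/
theorem SP.mass_le [hp : Fact p.Prime] [hq : Fact q.Prime] (hpq : p ≠ q) (h : SP m (n + 1) A B)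
    {τ r : ℕ} (hL : Level B τ r) {e : ℕ} (he : p ^ e ∣ B.S.card) : e ≤ r + (m - τ) := by
  set J := (range (n + 1)).filter fun l => Bal A 0 (n + 1 - l) with hJ
  obtain ⟨b, hb, hm⟩ := hL.ex
  have h1 := hL.mass b hb hm
  have e0 : num B τ (B.u b) 0 0 = (B.S.filter fun a => ∀ t < τ, B.u a t = B.u b t).card := by
    rw [num_eq_card]
    congr 2
    exact filter_congr fun a _ => and_iff_left (by simp)
  rw [e0] at h1
  have h2 : (B.S.filter fun a => ∀ t < τ, B.u a t = B.u b t).card ≤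
      p ^ (Ico τ m).card * q ^ J.card := by
    refine card_le_of_separated (u := B.u) (v := B.v) fun c hc c' hc' hu hv => ?_
    obtain ⟨hc, hcb⟩ := mem_filter.1 hc
    obtain ⟨hc', hcb'⟩ := mem_filter.1 hc'
    have hum : ∀ t < m, B.u c t = B.u c' t := fun t ht => by
      by_cases htτ : t < τ
      · rw [hcb t htτ, hcb' t htτ]
      · exact hu t (mem_Ico.2 ⟨by omega, ht⟩)
    by_contra hne
    obtain ⟨l, hl⟩ := exists_agr (n + 1) (B.v c) (B.v c')
    have hbal := h.right c hc c' hc' hne m l ⟨hum, le_rfl, by simp⟩ hl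
    rw [Nat.sub_self] at hbal
    rcases hl.2.1.eq_or_lt with rfl | hlt
    · rw [Nat.sub_self] at hbal
      exact not_bal_zero h.nonempty hbal
    · exact hl.2.2 hlt (hv l (mem_filter.2 ⟨mem_range.2 hlt, hbal⟩))
  have hJsub : J ⊆ range (n + 1) := filter_subset _ _
  have hdvd := pow_dvd_of_test (S := A.S) (u := A.v) (f := fun _ => 1) (D := star (n + 1) J)
    (fun t ht w hw => by
      obtain ⟨h3, h4⟩ := mem_star.1 ht
      have h5 := (mem_filter.1 h4).2
      rw [show n + 1 - (n + 1 - 1 - t) = t + 1 by omega] at h5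
      have := h5 _ rfl w hw
      simpa using this) (n + 1) 0 0
  rw [filter_true_of_mem fun t ht => ⟨Nat.zero_le _, by have := (mem_star.1 ht).1; omega⟩,
    card_star hJsub] at hdvd
  simp only [ind_zero, mul_one, sum_const, nsmul_eq_mul] at hdvd
  have hdvd' : q ^ J.card ∣ B.S.card := by rw [← h.card_eq]; exact_mod_cast hdvd
  have hmul : p ^ e * q ^ J.card ∣ B.S.card := Nat.Coprime.mul_dvd_of_dvd_of_dvd
    (Nat.Coprime.pow _ _ ((Nat.coprime_primes hp.out hq.out).2 hpq)) he hdvd'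
  have hle := Nat.le_of_dvd (card_pos.2 h.symm.nonempty) hmul
  have h1' : p ^ r * (B.S.filter fun a => ∀ t < τ, B.u a t = B.u b t).card = B.S.card := by
    exact_mod_cast h1
  rw [← h1'] at hle
  have hfin : p ^ e * q ^ J.card ≤ p ^ (r + (m - τ)) * q ^ J.card := by
    calc _ ≤ _ := hle
      _ ≤ p ^ r * (p ^ (Ico τ m).card * q ^ J.card) := Nat.mul_le_mul_left _ h2
      _ = _ := by rw [Nat.card_Ico, pow_add]; ring
  have := Nat.le_of_mul_le_mul_right hfin (pow_pos hq.out.pos _)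
  exact (Nat.pow_le_pow_iff_right hp.out.one_lt).1 this

/-- Summary of the analysis of the top `q`-digit of `A` along the levels `0, …, τ` of `B`, with
`Γ` the set of gaps and `k` the first gap. -/
structure Side (m n : ℕ) (A : Fam p q α) (B : Fam p q β) (k τ : ℕ) (Γ : Finset ℕ) : Prop where
  mem : k ∈ Γ
  bounds : ∀ j ∈ Γ, k ≤ j ∧ j < τ
  le : τ ≤ m
  run : ∀ j < τ, j ∉ Γ → Bal B (j + 1) 0
  gap : ∀ j ∈ Γ, ¬ Bal B (j + 1) 0
  top : ∀ j < τ, j ∉ Γ → Bal A (m - j) n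
  not_top : ∀ j ∈ Γ, ¬ Bal A (m - j) n
  zero_one : Bal B 0 1
  mono : ∃ b ∈ B.S, Mono B k b
  le_pow : q ≤ p ^ k
  le_pow_mixed : q ≤ p ^ (Γ.filter fun j => Bal B (j + 1) 1).card
  val : ∀ e, p ^ e ∣ B.S.card → e + Γ.card ≤ m

end

section

variable {A : Fam p q α} {B : Fam p q β}

theorem runs_add_card (m n : ℕ) (A : Fam p q α) (k : ℕ) :
    runs m n A k + ((range k).filter fun j => ¬ Bal A (m - j) (n + 1)).card = k := by
  unfold runs
  rw [card_filter_add_card_filter_not, card_range]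

/-- Here `τ` is the first step at which all cells of `A` have become constant. It exists: otherwise
a two-coloured leaf of `B` would balance the top `q`-digit of `A` over the root. -/
theorem SP.exists_side [hp : Fact p.Prime] [hq : Fact q.Prime] (hpq : p ≠ q)
    (h : SP m (n + 1) A B) (hI : Irr m (n + 1) A B) (hm : 0 < m) :
    ∃ k τ Γ, Side m (n + 1) A B k τ Γ := by
  have h01 : Bal B 0 1 := by
    obtain ⟨m, rfl⟩ : ∃ m', m = m' + 1 := ⟨m - 1, by omega⟩
    exact h.bal_zero_one hI
  have hlev := fun k hk hnc => h.level hpq hI h01 (k := k) hk hnc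
  have hpow : ∀ r : ℕ, 0 < (p : ℤ) ^ r := fun r => by
    have := hp.out.pos
    positivity
  -- the first level at which all cells are constant
  have hτ : ∃ k, k ≤ m ∧ ¬ ∃ x y, Nonconst A n (m - k) x y := by
    by_contra hno
    push Not at hno
    obtain ⟨-, hL⟩ := hlev m le_rfl fun j hj => hno j hj.le
    obtain ⟨b, hb, hmono⟩ := hL.ex
    unfold Mono at hmono
    push Not at hmono
    obtain ⟨c, hc, hcb, hne⟩ := hmono
    have hbal := h.symm.bal hc hb (k := m) (l := 0) ⟨hcb, le_rfl, by simp⟩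
      ⟨by simp, by omega, fun _ => hne⟩ (Or.inr (by omega))
    rw [Nat.sub_self] at hbal
    obtain ⟨x, y, hx⟩ := hno m le_rfl
    rw [Nat.sub_self] at hx
    exact not_nonconst_zero hbal x y hx
  obtain ⟨hτm, hconst⟩ := Nat.find_spec hτ
  have hnc : ∀ j < Nat.find hτ, ∃ x y, Nonconst A n (m - j) x y := fun j hj => by
    have := Nat.find_min hτ hj
    push Not at this
    exact this (by omega)
  set τ := Nat.find hτ with hτdef
  clear_value τ
  have hτ0 : 0 < τ := by
    rcases Nat.eq_zero_or_pos τ with e | e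
    · exact absurd hI.exists_nonconst (by rw [e] at hconst; exact hconst)
    · exact e
  have hlev' : ∀ k ≤ τ, TwoVal A n (m - k) ((p : ℤ) ^ runs m n A k) ∧
      Level B k (runs m n A k) := fun k hk =>
    hlev k (by omega) fun j hj => hnc j (by omega)
  set Γ := (range τ).filter fun j => ¬ Bal A (m - j) (n + 1) with hΓ
  have hrunΨ : ∀ j < τ, j ∉ Γ → Bal A (m - j) (n + 1) := fun j hj hjΓ => by
    by_contra hb
    exact hjΓ (mem_filter.2 ⟨mem_range.2 hj, hb⟩)
  have hrun : ∀ j < τ, j ∉ Γ → Bal B (j + 1) 0 := fun j hj hjΓ => by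
    have e : m - j = m - 1 - j + 1 := by omega
    have hb := hrunΨ j hj hjΓ
    have h2 := (hlev' j hj.le).1
    have h3 := hnc j hj
    rw [e] at hb h2 h3
    have := h.bal_of_run (i := m - 1 - j) (by omega) (hpow _) hb h2 h3
    rwa [show m - (m - 1 - j) = j + 1 by omega] at this
  have hgap : ∀ j ∈ Γ, j < τ ∧ ¬ Bal A (m - j) (n + 1) ∧ ¬ Bal B (j + 1) 0 ∧
      Excl (n + 1) A (m - 1 - j) := fun j hj => by
    obtain ⟨h1, h2⟩ := mem_filter.1 hj
    have h1 := mem_range.1 h1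
    have h3 := h.not_bal_of_gap (by omega) h2 (hlev' j h1.le).2.ex
    exact ⟨h1, h2, h3, h.excl_of_not_bal (by omega) h3⟩
  -- A run preserves non-constancy, so the step that makes everything constant is a gap.
  have hlast : τ - 1 ∈ Γ := by
    by_contra hno
    obtain ⟨x, y, hx⟩ := hnc (τ - 1) (by omega)
    have e : m - (τ - 1) = m - τ + 1 := by omega
    have hb := hrunΨ _ (by omega) hno
    have h2 := (hlev' (τ - 1) (by omega)).1
    rw [e] at hx hb h2
    exact hconst ⟨x, y, hx.of_bal (hpow _) hb h2⟩
  have hΓne : Γ.Nonempty := ⟨_, hlast⟩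
  set k := Γ.min' hΓne with hk
  have hkΓ : k ∈ Γ := min'_mem _ _
  have hkle : ∀ j ∈ Γ, k ≤ j := fun j hj => min'_le _ _ hj
  clear_value k
  have hkτ := (hgap k hkΓ).1
  have hlow : ∀ j < k, j ∉ Γ := fun j hj hjΓ => by have := hkle j hjΓ; omega
  have hlowB : ∀ j < k, Bal B (j + 1) 0 := fun j hj => hrun j (by omega) (hlow j hj)
  -- Irreducibility makes some node of `B` branch at level `k`; at a gap two-coloured nodes do not
  -- branch, so this one is monochromatic.
  obtain ⟨b, hb, hmono⟩ : ∃ b ∈ B.S, Mono B k b := by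
    obtain ⟨b, hb, b', hb', hbb⟩ := hI.pB.exists_agr k (by omega)
    refine ⟨b, hb, ?_⟩
    by_contra hm'
    exact hbb.2.2 (by omega) (h.single_of_gap (by omega) (hgap k hkΓ).2.1 b hb hm' b' hb'
      fun t ht => (hbb.1 t ht).symm).symm
  -- Support sizes of non-constant cells. At the first gap the support is a single value: two would
  -- give mixed balance at all earlier levels, hence equal colour counts in every node of level `k`,
  -- against the monochromatic one.
  have hgrow : ∀ j, k ≤ j → j < τ → ∀ x y, Nonconst A n (m - j) x y →
      (univ.filter fun c => cell A n (m - j) x y c ≠ 0).card ≤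
        p ^ ((range j).filter fun i => i ∈ Γ ∧ Bal B (i + 1) 1).card := by
    intro j hkj
    induction j, hkj using Nat.le_induction with
    | base =>
      intro _ x y hx
      have h1 : 0 < p ^ ((range k).filter fun i => i ∈ Γ ∧ Bal B (i + 1) 1).card :=
        pow_pos hp.out.pos _
      refine le_trans (card_le_one.2 fun c hc c' hc' => ?_) h1
      by_contra hne
      have h2 := h.bal_one_of_two (by omega) (fun j hj => hrunΨ j (by omega) (hlow j hj))
        (fun j hj => ⟨_, hpow _, (hlev' j (by omega)).1⟩) hx (mem_filter.1 hc).2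
        (mem_filter.1 hc').2 hne
      have h3 := num_eq_of_bal h01 h2 (B.u b) (B.v b) (fun _ => B.v b 0 + 1)
      have h4 : num B k (B.u b) 1 (B.v b) ≠ 0 := num_ne_zero.2 ⟨b, hb, by simp, by simp⟩
      rw [h3] at h4
      obtain ⟨b', hb', hbu, hbv⟩ := num_ne_zero.1 h4
      have h5 := hmono b' hb' hbu
      rw [hbv 0 (by omega)] at h5
      simp at h5
    | succ j hkj ih =>
      intro hj x y hx
      have ih := ih (by omega)
      have e : m - j = m - (j + 1) + 1 := by omega
      have h2 := (hlev' j (by omega)).1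
      rw [e] at ih h2
      obtain ⟨c₀, hc₀⟩ := nonconst_child hx
      by_cases hjΓ : j ∈ Γ
      · have hE := (hgap j hjΓ).2.2.2
        rw [show m - 1 - j = m - (j + 1) by omega] at hE
        have h3 := h.support_gap (by omega) hE (hpow _) h2 ih hc₀
        rw [show m - (m - (j + 1)) = j + 1 by omega] at h3
        refine h3.trans ?_
        rw [range_add_one, filter_insert]
        by_cases hb1 : Bal B (j + 1) 1
        · rw [if_pos hb1, if_pos ⟨hjΓ, hb1⟩, card_insert_of_notMem (by simp), pow_succ']
        · rw [if_neg hb1, if_neg fun h => hb1 h.2]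
      · have hb1 := hrunΨ j (by omega) hjΓ
        rw [e] at hb1
        rw [range_add_one, filter_insert, if_neg fun h => hjΓ h.1]
        refine le_trans (card_le_card fun c hc => ?_) (ih _ _ hc₀)
        have h3 := (mem_filter.1 hc).2
        rw [cell_congr (x' := Function.update x (m - (j + 1)) c₀)
          (fun t ht => (Function.update_of_ne ht.ne _ _).symm), cell_eq_mul (hpow _) hb1 h2 hc₀]
          at h3
        exact mem_filter.2 ⟨mem_univ _, right_ne_zero_of_mul h3⟩
  refine ⟨k, τ, Γ, hkΓ, fun j hj => ⟨hkle j hj, (hgap j hj).1⟩, hτm, hrun,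
    fun j hj => (hgap j hj).2.2.1, hrunΨ, fun j hj => (hgap j hj).2.1, h01, ⟨b, hb, hmono⟩,
    hmono.le_pow hb hlowB h01, ?_, ?_⟩
  · obtain ⟨x, y, hx⟩ := hnc (τ - 1) (by omega)
    have e : m - (τ - 1) = m - τ + 1 := by omega
    have h2 := (hlev' (τ - 1) (by omega)).1
    have hg := hgrow (τ - 1) (hkle _ hlast) (by omega)
    have hE := (hgap _ hlast).2.2.2
    rw [show m - 1 - (τ - 1) = m - τ by omega] at hE
    rw [e] at hx h2 hg
    have hx' : Nonconst A n (m - τ + 1) (Function.update x (m - τ) (x (m - τ))) y := by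
      rwa [Function.update_eq_self]
    have h3 := h.support_gap (by omega) hE (hpow _) h2 hg hx'
    rw [show m - (m - τ) = τ - 1 + 1 by omega] at h3
    -- After the last gap the cells are constant and not zero, so all `q` values occur.
    have hfull : (univ.filter fun c => cell A n (m - τ) x y c ≠ 0) = univ := by
      obtain ⟨-, c, hc⟩ := h2.exists_values hx
      have h4 : cell A n (m - τ) x y c ≠ 0 := by
        obtain ⟨a, ha, hau, hav⟩ := cell_ne_zero.1 (hc ▸ (hpow _).ne' :
          cell A n (m - τ + 1) x y c ≠ 0)
        exact cell_ne_zero.2 ⟨a, ha, fun t ht => hau t (by omega), hav⟩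
      refine filter_true_of_mem fun c' _ h5 => h4 ?_
      by_contra h6
      exact hconst ⟨x, y, c, c', by rw [h5]; exact h6⟩
    rw [hfull, card_univ, ZMod.card] at h3
    have hset : (Γ.filter fun j => Bal B (j + 1) 1) =
        (range (τ - 1 + 1)).filter fun i => i ∈ Γ ∧ Bal B (i + 1) 1 := by
      ext j
      simp only [mem_filter, mem_range]
      constructor
      · rintro ⟨h1, h2⟩
        exact ⟨by have := (hgap j h1).1; omega, h1, h2⟩
      · exact fun h => h.2
    rw [hset, range_add_one, filter_insert]
    refine h3.trans ?_
    by_cases hb1 : Bal B (τ - 1 + 1) 1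
    · rw [if_pos hb1, if_pos ⟨hlast, hb1⟩, card_insert_of_notMem (by simp), pow_succ']
    · rw [if_neg hb1, if_neg fun h => hb1 h.2]
  · intro e he
    have h1 := h.mass_le hpq (hlev' τ le_rfl).2 he
    have h2 := runs_add_card m n A τ
    rw [← hΓ] at h2
    omega

end

/-! ### Integrality: masses at complementary levels -/

/-- Complex functions of a digit sequence that are combinations of the test functions of a
level. -/
def Adm [NeZero p] : ℕ → ((ℕ → ZMod p) → ℂ) → Prop
  | 0, φ => φ = fun _ => 1
  | k + 1, φ => (∀ x x' : ℕ → ZMod p, (∀ t < k + 1, x t = x' t) → φ x = φ x') ∧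
      ∀ x : ℕ → ZMod p, ∑ c, φ (Function.update x k c) = 0

theorem Adm.sum_node [NeZero p] {S : Finset α} {u : α → ℕ → ZMod p} {f : α → ℂ} {j : ℕ}
    {φ : (ℕ → ZMod p) → ℂ} (hφ : Adm j φ)
    (h : ∀ w, Test u j w → ∑ a ∈ S, (w a : ℂ) * f a = 0) {i : ℕ} (hi : i < j)
    (x : ℕ → ZMod p) : ∑ a ∈ S, (ind i x (u a) : ℂ) * (φ (u a) * f a) = 0 := by
  obtain ⟨k, rfl⟩ : ∃ k, j = k + 1 := ⟨j - 1, by omega⟩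
  obtain ⟨h1, h2⟩ := hφ
  have hsplit : ∀ (i : ℕ) (x : ℕ → ZMod p), ∑ a ∈ S, (ind i x (u a) : ℂ) * (φ (u a) * f a) =
      ∑ c, ∑ a ∈ S, (ind (i + 1) (Function.update x i c) (u a) : ℂ) * (φ (u a) * f a) := by
    intro i x
    rw [sum_comm]
    refine sum_congr rfl fun a _ => ?_
    rw [← sum_mul, ← sum_ind_update i x (u a)]
    push_cast
    rfl
  induction hd : k - i generalizing i x with
  | zero =>
    obtain rfl : i = k := by omega
    rw [hsplit]
    have e : ∀ c, ∑ a ∈ S, (ind (i + 1) (Function.update x i c) (u a) : ℂ) * (φ (u a) * f a) =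
        φ (Function.update x i c) *
          ∑ a ∈ S, (ind (i + 1) (Function.update x i 0) (u a) : ℂ) * f a := by
      intro c
      have e1 : ∑ a ∈ S, (ind (i + 1) (Function.update x i c) (u a) : ℂ) * f a =
          ∑ a ∈ S, (ind (i + 1) (Function.update x i 0) (u a) : ℂ) * f a := by
        rw [← sub_eq_zero, ← sum_sub_distrib, ← h _ ⟨_, _, update_agree i x c 0, rfl⟩]
        refine sum_congr rfl fun a _ => ?_
        push_cast
        ring
      rw [← e1, mul_sum]
      refine sum_congr rfl fun a _ => ?_
      by_cases ha : ∀ t < i + 1, u a t = Function.update x i c t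
      · rw [h1 _ _ ha]; ring
      · rw [ind_eq_zero.2 ha]; simp
    refine (sum_congr rfl fun c _ => e c).trans ?_
    rw [← sum_mul, h2 x, zero_mul]
  | succ d ih =>
    rw [hsplit]
    exact sum_eq_zero fun c _ => ih (i := i + 1) (Function.update x i c) (by omega) (by omega)

theorem Adm.sum_eq_zero [NeZero p] {S : Finset α} {u : α → ℕ → ZMod p} {f : α → ℂ} {j : ℕ}
    {φ : (ℕ → ZMod p) → ℂ} (hφ : Adm j φ)
    (h : ∀ w, Test u j w → ∑ a ∈ S, (w a : ℂ) * f a = 0) : ∑ a ∈ S, φ (u a) * f a = 0 := by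
  cases j with
  | zero =>
    obtain rfl : φ = fun _ => 1 := hφ
    rw [← h _ rfl]
    simp
  | succ j =>
    have := hφ.sum_node h (i := 0) (by omega) 0
    simpa [ind_zero] using this

theorem Bal.test_sum [NeZero q] {F : Fam p q α} {i j : ℕ} (h : Bal F i j) {φ : (ℕ → ZMod q) → ℂ}
    (hφ : Adm j φ) {w : α → ℤ} (hw : Test F.u i w) :
    ∑ a ∈ F.S, (w a : ℂ) * φ (F.v a) = 0 := by
  rw [← hφ.sum_eq_zero (S := F.S) (u := F.v) (f := fun a => (w a : ℂ)) fun z hz => ?_]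
  · exact sum_congr rfl fun a _ => mul_comm _ _
  · have := h w hw z hz
    rw [← Int.cast_zero, ← this]
    push_cast
    exact sum_congr rfl fun a _ => mul_comm _ _

/-- The pairing of digit sequences of length `m` in which complementary digits are multiplied. -/
def lin (m : ℕ) (x y : ℕ → ZMod p) : ZMod p := ∑ t ∈ range m, x t * y (m - 1 - t)

theorem lin_comm (m : ℕ) (x y : ℕ → ZMod p) : lin m x y = lin m y x := by
  unfold lin
  rw [← sum_range_reflect]
  refine sum_congr rfl fun t ht => ?_
  have := mem_range.1 ht
  rw [show m - 1 - (m - 1 - t) = t by omega, mul_comm]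

/-- The difference involves only the digits of `x` up to `m - 1 - k`, and the last of these enters
with the non-zero coefficient `y k - y' k`. -/
theorem adm_lin [hp : Fact p.Prime] {k : ℕ} {y y' : ℕ → ZMod p} (h : Agr m k y y') :
    Adm (m - k) fun x => (ZMod.stdAddChar (lin m x y - lin m x y') : ℂ) := by
  have e : ∀ x : ℕ → ZMod p, lin m x y - lin m x y' =
      ∑ t ∈ range m, x t * (y (m - 1 - t) - y' (m - 1 - t)) := fun x => by
    unfold lin
    rw [← sum_sub_distrib]
    exact sum_congr rfl fun t _ => by ring
  rcases h.2.1.eq_or_lt with rfl | hlt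
  · rw [Nat.sub_self]
    refine funext fun x => ?_
    rw [e, Finset.sum_eq_zero, AddChar.map_zero_eq_one]
    intro t ht
    have := mem_range.1 ht
    rw [h.1 _ (by omega), sub_self, mul_zero]
  · rw [show m - k = m - 1 - k + 1 by omega]
    refine ⟨fun x x' hx => ?_, fun x => ?_⟩
    · simp only [e]
      congr 1
      refine sum_congr rfl fun t ht => ?_
      have := mem_range.1 ht
      by_cases htk : t < m - 1 - k + 1
      · rw [hx t htk]
      · rw [h.1 _ (by omega), sub_self, mul_zero, mul_zero]
    · have e2 : ∀ c, lin m (Function.update x (m - 1 - k) c) y -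
          lin m (Function.update x (m - 1 - k) c) y' =
          c * (y k - y' k) + ∑ t ∈ (range m).erase (m - 1 - k),
            x t * (y (m - 1 - t) - y' (m - 1 - t)) := fun c => by
        rw [e, ← add_sum_erase _ _ (mem_range.2 (show m - 1 - k < m by omega)),
          Function.update_self, show m - 1 - (m - 1 - k) = k by omega]
        congr 1
        refine sum_congr rfl fun t ht => ?_
        rw [Function.update_of_ne (ne_of_mem_erase ht)]
      simp only [e2, AddChar.map_add_eq_mul]
      rw [← sum_mul, AddChar.sum_mulShift _ (ZMod.isPrimitive_stdAddChar p),
        if_neg (sub_ne_zero.2 (h.2.2 hlt))]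
      simp

/-- The character pairing of two points, and its inverse. -/
noncomputable def chi (m n : ℕ) (F : Fam p q α) (G : Fam p q β) [NeZero p] [NeZero q] (a : α)
    (b : β) : ℂ :=
  ZMod.stdAddChar (lin m (F.u a) (G.u b)) * ZMod.stdAddChar (lin n (F.v a) (G.v b))

section int

variable [hp : Fact p.Prime] [hq : Fact q.Prime] {A : Fam p q α} {B : Fam p q β}

theorem chi_ne_zero (a : α) (b : β) : chi m n A B a b ≠ 0 :=
  mul_ne_zero (AddChar.val_isUnit _ _).ne_zero (AddChar.val_isUnit _ _).ne_zero

theorem chi_comm (a : α) (b : β) : chi m n A B a b = chi m n B A b a := by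
  unfold chi
  rw [lin_comm m, lin_comm n]

theorem chi_mul_inv (a : α) (b b' : β) : chi m n A B a b * (chi m n A B a b')⁻¹ =
    ZMod.stdAddChar (lin m (A.u a) (B.u b) - lin m (A.u a) (B.u b')) *
      ZMod.stdAddChar (lin n (A.v a) (B.v b) - lin n (A.v a) (B.v b')) := by
  unfold chi
  rw [AddChar.map_sub_eq_div, AddChar.map_sub_eq_div, div_eq_mul_inv, div_eq_mul_inv, mul_inv]
  ring

/-- Balance sees only first-difference levels, so orthogonality also holds for the digitwise pairing
`chi`, in place of the characters of the cyclic group. -/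
theorem SP.sum_chi (h : SP m n A B) {b b' : β} (hb : b ∈ B.S) (hb' : b' ∈ B.S) (hne : b ≠ b') :
    ∑ a ∈ A.S, chi m n A B a b * (chi m n A B a b')⁻¹ = 0 := by
  obtain ⟨k, hk⟩ := exists_agr m (B.u b) (B.u b')
  obtain ⟨l, hl⟩ := exists_agr n (B.v b) (B.v b')
  have hbal := h.right b hb b' hb' hne k l hk hl
  simp only [chi_mul_inv]
  exact (adm_lin hk).sum_eq_zero (S := A.S) (u := A.u) fun w hw => hbal.test_sum (adm_lin hl) hw

/-- The `p`-part of the character has level above `i`, so it already cancels within each node of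
level `i`. -/
theorem SP.sum_chi_node (h : SP m n A B) {b b' : β} (hb : b ∈ B.S) (hb' : b' ∈ B.S) {i : ℕ}
    (hbb : ¬ ∀ t < m - i, B.u b t = B.u b' t) (x : ℕ → ZMod p) :
    ∑ a ∈ A.S.filter (fun a => ∀ t < i, A.u a t = x t),
      chi m n A B a b * (chi m n A B a b')⁻¹ = 0 := by
  obtain ⟨k, hk⟩ := exists_agr m (B.u b) (B.u b')
  obtain ⟨l, hl⟩ := exists_agr n (B.v b) (B.v b')
  have hlt : k < m - i := by
    by_contra hno
    exact hbb fun t ht => hk.1 t (by omega)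
  have hbal := h.symm.bal hb hb' hk hl (Or.inl (by omega))
  simp only [chi_mul_inv]
  rw [← (adm_lin hk).sum_node (S := A.S) (u := A.u) (fun w hw => hbal.test_sum (adm_lin hl) hw)
    (show i < m - k by omega) x, sum_filter]
  refine sum_congr rfl fun a _ => ?_
  unfold ind
  split_ifs <;> simp

theorem exists_nat_trace {ι : Type} [Fintype ι] {P : Matrix ι ι ℂ} (hP : P * P = P) :
    ∃ r : ℕ, P.trace = r := by
  have h1 : IsIdempotentElem (Matrix.toLin' P) := by
    change Matrix.toLin' P * Matrix.toLin' P = _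
    rw [Module.End.mul_eq_comp, ← Matrix.toLin'_mul, hP]
  have h2 := (LinearMap.IsIdempotentElem.isProj_range _ h1).trace
  rw [Matrix.trace_toLin'_eq] at h2
  exact ⟨_, h2⟩

/-- The product of the masses of nodes at complementary levels is divisible by the total mass. -/
theorem SP.dvd_mul (h : SP m n A B) (i : ℕ) (x y : ℕ → ZMod p) :
    (A.S.card : ℤ) ∣ num A i x 0 0 * num B (m - i) y 0 0 := by
  set S := A.S.filter fun a => ∀ t < i, A.u a t = x t with hS
  set T := B.S.filter fun b => ∀ t < m - i, B.u b t = y t with hT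
  have eS : num A i x 0 0 = S.card := by
    rw [num_eq_card]; congr 2; exact filter_congr fun a _ => and_iff_left (by simp)
  have eT : num B (m - i) y 0 0 = T.card := by
    rw [num_eq_card]; congr 2; exact filter_congr fun a _ => and_iff_left (by simp)
  rw [eS, eT]
  have hM : (A.S.card : ℂ) ≠ 0 := by exact_mod_cast (card_pos.2 h.nonempty).ne'
  let X := chi m n A B
  let f : β → β → ℂ := fun b b' => (A.S.card : ℂ)⁻¹ * ∑ a ∈ S, X a b * (X a b')⁻¹
  -- The normalised Gram matrix of the columns in `T`, restricted to the rows in `S`; its trace is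
  -- `|S| * |T| / |A|`.
  let P : Matrix T T ℂ := fun b b' => f b b'
  have hrow : ∀ a ∈ A.S, ∀ a' ∈ A.S,
      ∑ b ∈ B.S, (X a b)⁻¹ * X a' b = if a = a' then (A.S.card : ℂ) else 0 := by
    intro a ha a' ha'
    split_ifs with e
    · subst e
      rw [sum_congr rfl fun b _ => inv_mul_cancel₀ (chi_ne_zero a b)]
      simp [h.card_eq]
    · rw [← h.symm.sum_chi ha' ha fun e' => e e'.symm]
      refine sum_congr rfl fun b _ => ?_
      rw [mul_comm, chi_comm b a', chi_comm b a]
  have hP : P * P = P := by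
    ext b b'
    obtain ⟨hb, hby⟩ := mem_filter.1 b.2
    obtain ⟨hb', hby'⟩ := mem_filter.1 b'.2
    rw [Matrix.mul_apply]
    change ∑ c : T, f b c * f c b' = f b b'
    rw [sum_coe_sort T fun c => f b c * f c b']
    -- Entries `f b c` with `c` outside the node `T` vanish, so the middle sum extends to all of
    -- `B`, where the full orthogonality relations make `P` idempotent.
    have e1 : ∑ c ∈ T, f b c * f c b' = ∑ c ∈ B.S, f b c * f c b' := by
      refine sum_subset (filter_subset _ _) fun c hc hcT => ?_
      have : f b c = 0 := by
        simp only [f]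
        rw [h.sum_chi_node hb hc, mul_zero]
        intro H
        exact hcT (mem_filter.2 ⟨hc, fun t ht => by rw [← H t ht, hby t ht]⟩)
      rw [this, zero_mul]
    rw [e1]
    simp only [f]
    calc _ = (A.S.card : ℂ)⁻¹ * (A.S.card : ℂ)⁻¹ * ∑ c ∈ B.S, ∑ a ∈ S, ∑ a' ∈ S,
          X a b * (X a' b')⁻¹ * ((X a c)⁻¹ * X a' c) := by
          rw [mul_sum]
          refine sum_congr rfl fun c _ => ?_
          rw [mul_mul_mul_comm, sum_mul_sum]
          congr 1
          exact sum_congr rfl fun a _ => sum_congr rfl fun a' _ => by ring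
      _ = (A.S.card : ℂ)⁻¹ * (A.S.card : ℂ)⁻¹ * ∑ a ∈ S, ∑ a' ∈ S,
          X a b * (X a' b')⁻¹ * if a = a' then (A.S.card : ℂ) else 0 := by
          congr 1
          rw [sum_comm]
          refine sum_congr rfl fun a ha => ?_
          rw [sum_comm]
          refine sum_congr rfl fun a' ha' => ?_
          rw [← mul_sum, hrow a (mem_filter.1 ha).1 a' (mem_filter.1 ha').1]
      _ = (A.S.card : ℂ)⁻¹ * (A.S.card : ℂ)⁻¹ * ∑ a ∈ S,
          X a b * (X a b')⁻¹ * (A.S.card : ℂ) := by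
          congr 1
          refine sum_congr rfl fun a ha => ?_
          simp [ha]
      _ = _ := by
          rw [← sum_mul]
          field_simp
  obtain ⟨r, hr⟩ := exists_nat_trace hP
  have htr : P.trace = (A.S.card : ℂ)⁻¹ * (S.card * T.card) := by
    change ∑ b : T, f b b = _
    rw [sum_coe_sort T fun b => f b b]
    simp only [f]
    rw [sum_congr rfl fun b _ => by
      rw [sum_congr rfl fun a _ => mul_inv_cancel₀ (chi_ne_zero a b)]]
    simp
    ring
  rw [htr, inv_mul_eq_iff_eq_mul₀ hM] at hr
  exact ⟨r, by exact_mod_cast hr⟩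

end int

/-! ### Valuations of node masses and the exponent bound -/

section

variable {A : Fam p q α} {B : Fam p q β}

theorem pow_dvd_mul_le {π a b : ℤ} (hπ : Prime π) {V f g : ℕ} (h : π ^ V ∣ a * b)
    (ha : ¬ π ^ f ∣ a) (hb : ¬ π ^ g ∣ b) : V + 2 ≤ f + g := by
  induction f generalizing V a with
  | zero => simp at ha
  | succ f ih =>
    have hg : g ≠ 0 := by
      rintro rfl
      simp at hb
    by_cases hd : π ∣ a
    · obtain ⟨a, rfl⟩ := hd
      have ha' : ¬ π ^ f ∣ a := fun hd => ha (by rw [pow_succ']; exact mul_dvd_mul_left _ hd)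
      cases V with
      | zero => omega
      | succ V =>
        rw [pow_succ', mul_assoc] at h
        have := ih ((mul_dvd_mul_iff_left hπ.ne_zero).1 h) ha'
        omega
    · have h1 := hπ.pow_dvd_of_dvd_mul_left _ hd h
      have : V < g := by
        by_contra hno
        exact hb ((pow_dvd_pow _ (not_lt.1 hno)).trans h1)
      omega

theorem num_le {F : Fam p q α} {i i' j j' : ℕ} {x x' : ℕ → ZMod p} {y y' : ℕ → ZMod q}
    (h : ∀ a ∈ F.S, (∀ t < i, F.u a t = x t) → (∀ t < j, F.v a t = y t) →
      (∀ t < i', F.u a t = x' t) ∧ ∀ t < j', F.v a t = y' t) :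
    num F i x j y ≤ num F i' x' j' y' := by
  refine sum_le_sum fun a ha => ?_
  by_cases hx : ∀ t < i, F.u a t = x t
  · by_cases hy : ∀ t < j, F.v a t = y t
    · rw [ind_eq_one.2 hx, ind_eq_one.2 hy, ind_eq_one.2 (h a ha hx hy).1,
        ind_eq_one.2 (h a ha hx hy).2]
    · rw [ind_eq_zero.2 hy, mul_zero]
      exact mul_nonneg (ind_nonneg _ _ _) (ind_nonneg _ _ _)
  · rw [ind_eq_zero.2 hx, zero_mul]
    exact mul_nonneg (ind_nonneg _ _ _) (ind_nonneg _ _ _)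

/-- The levels at which nodes below a monochromatic node split evenly. -/
def Even (B : Fam p q β) (k : ℕ) : Prop := Bal B (k + 1) 0 ∨ Bal B (k + 1) 1

/-- Below a monochromatic node all other colour counts are zero, so mixed balance equates the full
masses of siblings. -/
theorem Mono.num_eq_mul [hp : Fact p.Prime] [hq : Fact q.Prime] {k j : ℕ} {b : β}
    (hm : Mono B k b) (hkj : k ≤ j) (hbal : Bal B (j + 1) 1) {x : ℕ → ZMod p}
    (hx : ∀ t < k, x t = B.u b t) : num B j x 0 0 = p * num B (j + 1) x 0 0 := by
  have hzero : ∀ z : ℕ → ZMod p, (∀ t < k, z t = B.u b t) → ∀ y : ℕ → ZMod q, y 0 ≠ B.v b 0 →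
      num B (j + 1) z 1 y = 0 := by
    intro z hz y hy
    by_contra hne
    obtain ⟨a, ha, hau, hav⟩ := num_ne_zero.1 hne
    refine hy ?_
    rw [← hav 0 (by omega)]
    exact hm a ha fun t ht => by rw [hau t (by omega), hz t ht]
  have hone : ∀ z : ℕ → ZMod p, (∀ t < k, z t = B.u b t) →
      num B (j + 1) z 0 0 = num B (j + 1) z 1 (Function.update 0 0 (B.v b 0)) := by
    intro z hz
    rw [num_refine']
    exact sum_eq_single _ (fun e _ he => hzero z hz _ (by rwa [Function.update_self])) (by simp)
  have hsib : ∀ e, num B (j + 1) (Function.update x j e) 0 0 = num B (j + 1) x 0 0 := by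
    intro e
    have hz : ∀ t < k, Function.update x j e t = B.u b t := fun t ht => by
      rw [Function.update_of_ne (by omega), hx t ht]
    have h1 := hbal.num_sub_eq (x := Function.update x j e) (x' := x)
      (fun t ht => Function.update_of_ne ht.ne _ _) (y := Function.update 0 0 (B.v b 0))
      (y' := fun _ => B.v b 0 + 1) (by simp)
    rw [hzero _ hz (fun _ => B.v b 0 + 1) (by simp), hzero _ hx (fun _ => B.v b 0 + 1) (by simp),
      sub_zero, sub_zero] at h1
    rw [hone _ hz, hone _ hx, h1]
  rw [num_refine, sum_congr rfl fun e _ => hsib e]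
  simp

namespace Side

variable {k τ : ℕ} {Γ : Finset ℕ}

/-- Walk down from the root through the monochromatic node. An even level removes exactly one factor
`p` from the mass; at any other level some child is not divisible by the same power. Levels above
`k` are runs, so the walk can be steered to that node. -/
theorem exists_node [hp : Fact p.Prime] [hq : Fact q.Prime] (h : Side m n A B k τ Γ) {E : ℕ}
    (hE : ¬ p ^ E ∣ B.S.card) (j : ℕ) : ∃ x f, f + ((range j).filter (Even B)).card = E ∧
      ¬ (p : ℤ) ^ f ∣ num B j x 0 0 := by
  obtain ⟨b, hb, hm⟩ := h.mono
  have hp0 : (p : ℤ) ≠ 0 := by exact_mod_cast hp.out.ne_zero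
  suffices ∃ x f, (∀ t < k, x t = B.u b t) ∧ f + ((range j).filter (Even B)).card = E ∧
      ¬ (p : ℤ) ^ f ∣ num B j x 0 0 by
    obtain ⟨x, f, -, h1⟩ := this
    exact ⟨x, f, h1⟩
  induction j with
  | zero =>
    refine ⟨B.u b, E, fun _ _ => rfl, by simp, ?_⟩
    rw [num_zero]
    exact_mod_cast hE
  | succ j ih =>
    obtain ⟨x, f, hx, hf, hd⟩ := ih
    have hrun : j < k → Bal B (j + 1) 0 := fun hj => by
      have h1 := (h.bounds k h.mem).2
      exact h.run j (by omega) fun hjΓ => by have := (h.bounds j hjΓ).1; omega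
    rw [range_add_one, filter_insert]
    by_cases hU : Even B j
    · have e : num B j x 0 0 = p * num B (j + 1) x 0 0 := by
        rcases hU with hU | hU
        · exact _root_.Fuglede.num_eq_mul hU x
        · by_cases hjk : j < k
          · exact _root_.Fuglede.num_eq_mul (hrun hjk) x
          · exact hm.num_eq_mul (by omega) hU hx
      rw [e] at hd
      cases f with
      | zero => simp at hd
      | succ f =>
        refine ⟨x, f, hx, ?_, fun hd' => hd ?_⟩
        · rw [if_pos hU, card_insert_of_notMem (by simp)]
          omega
        · rw [pow_succ']
          exact mul_dvd_mul_left _ hd'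
    · have hjk : ¬ j < k := fun hj => hU (Or.inl (hrun hj))
      rw [num_refine] at hd
      have : ∃ e, ¬ (p : ℤ) ^ f ∣ num B (j + 1) (Function.update x j e) 0 0 := by
        by_contra hno
        push Not at hno
        exact hd (dvd_sum fun e _ => hno e)
      obtain ⟨e, he⟩ := this
      refine ⟨_, f, fun t ht => ?_, ?_, he⟩
      · rw [Function.update_of_ne (by omega), hx t ht]
      · rwa [if_neg hU]

/-- Let `V` be the `p`-adic valuation of `|B|`. Nodes at complementary levels have valuations at
most `V` minus the respective numbers of even levels, and their product is divisible by `p ^ V`. So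
these numbers add up to at most `V`, and `V + Γ.card ≤ m`. -/
theorem even_add_even_le [hp : Fact p.Prime] [hq : Fact q.Prime] (hSP : SP m n A B)
    (h : Side m n A B k τ Γ) {k' τ' : ℕ} {Γ' : Finset ℕ} (h' : Side m n B A k' τ' Γ') {j : ℕ}
    (hj : j ≤ m) : ((range j).filter (Even B)).card + ((range (m - j)).filter (Even A)).card +
      Γ.card ≤ m := by
  obtain ⟨V, c, hc, hV⟩ := Nat.exists_eq_pow_mul_and_not_dvd
    (card_pos.2 hSP.symm.nonempty).ne' p hp.out.ne_one
  have hE : ¬ p ^ (V + 1) ∣ B.S.card := fun hd => by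
    rw [hV, pow_succ] at hd
    exact hc (Nat.dvd_of_mul_dvd_mul_left (pow_pos hp.out.pos _) hd)
  have hpV : p ^ V ∣ B.S.card := hV ▸ dvd_mul_right _ _
  obtain ⟨x, f, hf, hxf⟩ := h.exists_node hE j
  obtain ⟨y, g, hg, hyg⟩ := h'.exists_node (by rwa [hSP.card_eq]) (m - j)
  have h1 := hSP.dvd_mul (m - j) y x
  rw [show m - (m - j) = j by omega] at h1
  have h2 : (p : ℤ) ^ V ∣ A.S.card := by rw [hSP.card_eq]; exact_mod_cast hpV
  have h3 := pow_dvd_mul_le (Nat.prime_iff_prime_int.1 hp.out) (h2.trans h1) hyg hxf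
  have h4 := h.val V hpV
  omega

theorem card_add_le (h : Side m n A B k τ Γ) : k + Γ.card ≤ τ := by
  have h1 : Γ ⊆ Ico k τ := fun j hj => mem_Ico.2 (h.bounds j hj)
  have h2 := card_le_card h1
  rw [Nat.card_Ico] at h2
  have := (h.bounds k h.mem).2
  omega

/-- Below `τ` the levels that are not even are exactly the gaps without mixed balance. -/
theorem even_card (h : Side m n A B k τ Γ) : τ + (Γ.filter fun j => Bal B (j + 1) 1).card =
    ((range τ).filter (Even B)).card + Γ.card := by
  have h1 := card_filter_add_card_filter_not (s := range τ) (Even B)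
  have h2 := card_filter_add_card_filter_not (s := Γ) fun j => Bal B (j + 1) 1
  have h3 : (range τ).filter (fun j => ¬ Even B j) = Γ.filter fun j => ¬ Bal B (j + 1) 1 := by
    ext j
    rw [mem_filter, mem_filter, mem_range]
    constructor
    · rintro ⟨h3, h4⟩
      refine ⟨?_, fun h5 => h4 (Or.inr h5)⟩
      by_contra h5
      exact h4 (Or.inl (h.run j h3 h5))
    · rintro ⟨h3, h4⟩
      exact ⟨(h.bounds j h3).2, fun h5 => h5.elim (h.gap j h3) h4⟩
  rw [h3, card_range] at h1
  omega

theorem le_even_card (h : Side m n A B k τ Γ) (j : ℕ) :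
    j + (Γ.filter fun j => Bal B (j + 1) 1).card ≤
      ((range j).filter (Even B)).card + Γ.card + (j - τ) := by
  have h1 := card_filter_add_card_filter_not (s := range j) (Even B)
  have h2 := card_filter_add_card_filter_not (s := Γ) fun j => Bal B (j + 1) 1
  have h3 : ((range j).filter fun j => ¬ Even B j) ⊆
      (Γ.filter fun j => ¬ Bal B (j + 1) 1) ∪ Ico τ j := by
    intro i hi
    rw [mem_filter, mem_range] at hi
    rw [mem_union, mem_filter, mem_Ico]
    by_cases hiτ : i < τ
    · refine Or.inl ⟨?_, fun h5 => hi.2 (Or.inr h5)⟩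
      by_contra h5
      exact hi.2 (Or.inl (h.run i hiτ h5))
    · exact Or.inr ⟨by omega, hi.1⟩
  have h4 := (card_le_card h3).trans (card_union_le _ _)
  rw [Nat.card_Ico] at h4
  rw [card_range] at h1
  omega

theorem le_even_card' (h : Side m n A B k τ Γ) (j : ℕ) :
    j ≤ ((range j).filter (Even B)).card + (j - k) := by
  have h1 := card_filter_add_card_filter_not (s := range j) (Even B)
  have h3 : ((range j).filter fun j => ¬ Even B j) ⊆ Ico k j := by
    intro i hi
    rw [mem_filter, mem_range] at hi
    refine mem_Ico.2 ⟨?_, hi.1⟩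
    by_contra hik
    have := (h.bounds k h.mem).2
    exact hi.2 (Or.inl (h.run i (by omega) fun hiΓ => by have := (h.bounds i hiΓ).1; omega))
  have h4 := card_le_card h3
  rw [Nat.card_Ico] at h4
  rw [card_range] at h1
  omega

/-- Let `g`, `g'` be the numbers of gaps and `μ`, `μ'` of those with mixed balance, so `μ, μ' ≥ c`.
The valuation bound at `j = τ` leaves at least `μ` uneven levels of `A` below `m - τ`, whence `τ + μ
+ k' ≤ m`, and symmetrically `τ' + μ' + k ≤ m`. If `m - τ ≤ τ'`, those uneven levels are gaps, so
`g' ≥ μ + μ'`; then use `τ' ≥ k' + g'`. Otherwise `m - τ - τ'` makes up for the missing gaps. -/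
theorem exponent_le [hp : Fact p.Prime] [hq : Fact q.Prime] (hSP : SP m n A B)
    (h : Side m n A B k τ Γ) {k' τ' : ℕ} {Γ' : Finset ℕ} (h' : Side m n B A k' τ' Γ') {c : ℕ}
    (hc : ∀ x, q ≤ p ^ x → c ≤ x) : k + k' + 3 * c ≤ m := by
  have a1 := even_add_even_le hSP h h' h.le
  have a2 := even_add_even_le hSP.symm h' h h'.le
  have b1 := h.card_add_le
  have b2 := h'.card_add_le
  have c1 := h.even_card
  have c2 := h'.even_card
  have d1 := h.le_even_card (m - τ')
  have d2 := h'.le_even_card (m - τ)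
  have e1 := h.le_even_card' (m - τ')
  have e2 := h'.le_even_card' (m - τ)
  have f1 := hc _ h.le_pow_mixed
  have f2 := hc _ h'.le_pow_mixed
  have f3 : 0 < (Γ.filter fun j => Bal B (j + 1) 1).card := by
    refine Nat.pos_of_ne_zero fun h0 => ?_
    have := h.le_pow_mixed
    rw [h0, pow_zero] at this
    exact absurd hq.out.one_lt (by omega)
  have f4 : 0 < (Γ'.filter fun j => Bal A (j + 1) 1).card := by
    refine Nat.pos_of_ne_zero fun h0 => ?_
    have := h'.le_pow_mixed
    rw [h0, pow_zero] at this
    exact absurd hq.out.one_lt (by omega)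
  have g1 := card_filter_le Γ fun j => Bal B (j + 1) 1
  have g2 := card_filter_le Γ' fun j => Bal A (j + 1) 1
  have l1 := h.le
  have l2 := h'.le
  omega

theorem ne_pow (hp : p.Prime) (hq : q.Prime) (hpq : p ≠ q) (l : ℕ) : p ≠ q ^ l := by
  intro e
  rcases Nat.eq_zero_or_pos l with rfl | hl
  · exact hp.ne_one (by simpa using e)
  · have : q ∣ p := e ▸ dvd_pow_self q hl.ne'
    exact hpq ((Nat.prime_dvd_prime_iff_eq hq hp).1 this).symm

/-- If `k = 1`, comparing masses and counting points in the two trees forces `p` to be a power of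
`q`, or else frees a `q`-digit of `A`. -/
theorem one_lt_first_gap [hp : Fact p.Prime] [hq : Fact q.Prime] (hpq : p ≠ q) (hSP : SP m n A B)
    (hI : Irr m n A B) (h : Side m n A B k τ Γ) {l σ : ℕ} {Δ : Finset ℕ}
    (h' : Side n m A.swap B.swap l σ Δ) : 2 ≤ k := by
  by_contra hk
  have hk1 : k = 1 := by
    have : k ≠ 0 := by
      rintro rfl
      have := h.le_pow
      rw [pow_zero] at this
      exact absurd hq.out.one_lt (by omega)
    omega
  subst hk1
  have hm := h.le
  have hn := h'.le
  have h1τ := (h.bounds 1 h.mem).2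
  have hlσ := (h'.bounds l h'.mem).2
  have hlΔ : ∀ j < l, j ∉ Δ := fun j hj hjΔ => by have := (h'.bounds j hjΔ).1; omega
  have hB1 : Bal B 1 0 := h.run 0 (by omega) fun h0 => by have := (h.bounds 0 h0).1; omega
  have hex : ∃ l, ∃ b ∈ B.S, ∃ b' ∈ B.S, Agr m 1 (B.u b) (B.u b') ∧ Agr n l (B.v b) (B.v b') := by
    obtain ⟨b, hb, b', hb', hbb⟩ := hI.pB.exists_agr 1 (by omega)
    obtain ⟨l, hl⟩ := exists_agr n (B.v b) (B.v b')
    exact ⟨l, b, hb, b', hb', hbb, hl⟩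
  obtain ⟨b, hb, b', hb', hu, hv⟩ := Nat.find_spec hex
  have hmin : ∀ l < Nat.find hex, ∀ b ∈ B.S, ∀ b' ∈ B.S, Agr m 1 (B.u b) (B.u b') →
      ¬ Agr n l (B.v b) (B.v b') := fun l hl b hb b' hb' h1 h2 =>
    Nat.find_min hex hl ⟨b, hb, b', hb', h1, h2⟩
  -- The least `q`-level of a pair branching at `p`-digit `1`. Because the node of `b` branches
  -- there, all its points share the first `s` `q`-digits.
  set s := Nat.find hex with hs
  clear_value s
  have hpair := hSP.symm.bal hb hb' hu hv (Or.inl (by omega))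
  have hs0 : 0 < s := by
    refine Nat.pos_of_ne_zero fun h0 => h.not_top 1 h.mem ?_
    rwa [h0] at hpair
  have hagree : ∀ c ∈ B.S, ∀ c' ∈ B.S, B.u c 0 = B.u c' 0 → B.u c 1 ≠ B.u c' 1 →
      ∀ t < s, B.v c t = B.v c' t := by
    intro c hc c' hc' h0 h1
    have hA : Agr m 1 (B.u c) (B.u c') :=
      ⟨fun t ht => by obtain rfl : t = 0 := by omega
                      exact h0, by omega, fun _ => h1⟩
    obtain ⟨l', hl'⟩ := exists_agr n (B.v c) (B.v c')
    have : s ≤ l' := by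
      by_contra hlt
      exact hmin l' (by omega) c hc c' hc' hA hl'
    exact fun t ht => hl'.1 t (by omega)
  have hnode : ∀ c ∈ B.S, B.u c 0 = B.u b 0 → ∀ t < s, B.v c t = B.v b t := by
    intro c hc h0 t ht
    by_cases h1 : B.u c 1 = B.u b 1
    · rw [hv.1 t ht]
      exact hagree c hc b' hb' (h0.trans (hu.1 0 (by omega)))
        (fun e => hu.2.2 (by omega) (h1.symm.trans e)) t ht
    · exact hagree c hc b hb h0 h1 t ht
  -- The node of `b` has mass `|B| / p` and lies in a `q`-node of mass `|B| / q ^ j`.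
  have hpow : ∀ j ≤ s, j ≤ l → q ^ j ≤ p := by
    intro j hjs hjl
    have e1 := num_mul_pow (B := B) (k := 1) (fun t ht => by
      obtain rfl : t = 0 := by omega
      exact hB1) (B.u b)
    have e2 := num_mul_pow (B := B.swap) (k := j) (fun t ht =>
      h'.run t (by omega) (hlΔ t (by omega))) (B.v b)
    rw [num_swap] at e2
    rw [pow_one] at e1
    have hle : num B 1 (B.u b) 0 0 ≤ num B 0 0 j (B.v b) :=
      num_le fun c hc h1 _ => ⟨by simp, fun t ht => hnode c hc (h1 0 (by omega)) t (by omega)⟩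
    have hpos : 0 < num B 0 0 j (B.v b) := lt_of_le_of_ne (num_nonneg _ _ _ _ _)
      (num_ne_zero.2 ⟨b, hb, by simp, fun _ _ => rfl⟩).symm
    have : (q : ℤ) ^ j ≤ p := by
      refine le_of_mul_le_mul_right ?_ hpos
      rw [e2.trans e1.symm]
      exact mul_le_mul_of_nonneg_left hle (by positivity)
    exact_mod_cast this
  rcases le_or_gt l s with hls | hsl
  · exact ne_pow hp.out hq.out hpq l (le_antisymm h'.le_pow (hpow l hls le_rfl))
  · have hDs : n - s = n - 1 - s + 1 := by omega
    rw [hDs] at hpair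
    have hle : ∀ (x : ℕ → ZMod p) (y y' : ℕ → ZMod q), (∀ t < n - 1 - s, y t = y' t) →
        ¬ num A (m - 1) x (n - 1 - s + 1) y' < num A (m - 1) x (n - 1 - s + 1) y := by
      intro x y y' hy hlt
      have hm1 : m - 1 = m - 2 + 1 := by omega
      rw [hm1] at hlt hpair
      have hocc : ∀ e, ∃ a ∈ A.S, (∀ t < m - 2 + 1, A.u a t = Function.update x (m - 2) e t) ∧
          ∀ t < n - 1 - s + 1, A.v a t = y t := by
        intro e
        refine num_ne_zero.1 fun h0 => ?_
        have e1 := hpair.num_sub_eq (x := Function.update x (m - 2) e) (x' := x)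
          (fun t ht => Function.update_of_ne ht.ne _ _) hy
        have e2 := num_nonneg A (m - 2 + 1) (Function.update x (m - 2) e) (n - 1 - s + 1) y'
        omega
      choose a haS hau hav using hocc
      -- The `p` points found branch at digit `m - 2`. The gap at `1` forbids two of them to share
      -- all `q`-digits, so the last `s` digits separate them and `p ≤ q ^ s`.
      have hinj : Function.Injective fun e => fun t : Fin s => A.v (a e) (n - 1 - s + 1 + t) := by
        intro e e' hee
        by_contra hne
        have := hSP.bal (haS e) (haS e') (k := m - 2) (l := n)
          ⟨fun t ht => by
            rw [hau e t (by omega), hau e' t (by omega), update_agree _ x e e' t ht],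
            by omega, fun _ => by
              rw [hau e _ (by omega), hau e' _ (by omega), Function.update_self,
                Function.update_self]
              exact hne⟩
          ⟨fun t ht => by
            by_cases htD : t < n - 1 - s + 1
            · rw [hav e t htD, hav e' t htD]
            · have := congrFun hee ⟨t - (n - 1 - s + 1), by omega⟩
              simp only at this
              rwa [Nat.add_sub_cancel' (by omega)] at this, le_rfl, by simp⟩ (Or.inl (by omega))
        rw [Nat.sub_self, show m - (m - 2) = 1 + 1 by omega] at this
        exact h.gap 1 h.mem this
      have hcard := Fintype.card_le_of_injective _ hinj
      simp only [ZMod.card, Fintype.card_fun, Fintype.card_fin] at hcard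
      exact ne_pow hp.out hq.out hpq s (le_antisymm hcard (hpow s le_rfl hsl.le))
    have heq : ∀ (x : ℕ → ZMod p) (y y' : ℕ → ZMod q), (∀ t < n - 1 - s, y t = y' t) →
        num A (m - 1) x (n - 1 - s + 1) y = num A (m - 1) x (n - 1 - s + 1) y' :=
      fun x y y' hy => le_antisymm (not_lt.1 (hle x y y' hy))
        (not_lt.1 (hle x y' y fun t ht => (hy t ht).symm))
    -- The counts make digit `n - 1 - s` balanced at all `p`-levels below `m`; level `m` is a run of
    -- the side for `q`.
    refine hI.qA.not_free (n - 1 - s) (by omega) fun i hi => ?_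
    rcases hi.eq_or_lt with rfl | hi
    · rw [← hDs]
      exact h'.top s (by omega) (hlΔ s hsl)
    · have : Bal A i (n - 1 - s + 1) := bal_of_num_eq fun x y y' hy =>
        num_eq_of_le (fun x => heq x y y' hy) (by omega) x
      exact this.swap

end Side

/-! ### Conclusion -/

/-- Lower bounds for the exponents of an irreducible spectral pair. -/
theorem Irr.exponent_le [hp : Fact p.Prime] [hq : Fact q.Prime] (hpq : p ≠ q) (hSP : SP m n A B)
    (hI : Irr m n A B) (hm : 0 < m) (hn : 0 < n) {c : ℕ} (hc : ∀ x, q ≤ p ^ x → c ≤ x) :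
    3 * c + 4 ≤ m ∧ 5 * c ≤ m := by
  obtain ⟨m, rfl⟩ : ∃ m', m = m' + 1 := ⟨m - 1, by omega⟩
  obtain ⟨n, rfl⟩ : ∃ n', n = n' + 1 := ⟨n - 1, by omega⟩
  obtain ⟨k, τ, Γ, h⟩ := hSP.exists_side hpq hI hm
  obtain ⟨k', τ', Γ', h'⟩ := hSP.symm.exists_side hpq hI.symm hm
  obtain ⟨l, σ, Δ, g⟩ := hSP.swap.exists_side hpq.symm hI.swap hn
  obtain ⟨l', σ', Δ', g'⟩ := hSP.symm.swap.exists_side hpq.symm hI.symm.swap hn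
  have h1 := Side.exponent_le hSP h h' hc
  have h2 := Side.one_lt_first_gap hpq hSP hI h g
  have h3 := Side.one_lt_first_gap hpq hSP.symm hI.symm h' g'
  have h4 := hc k h.le_pow
  have h5 := hc k' h'.le_pow
  omega

theorem Irr.pos (hSP : SP m n A B) (hI : Irr m n A B) (hm : 0 < m) :
    0 < n := by
  refine Nat.pos_of_ne_zero ?_
  rintro rfl
  obtain ⟨b, hb, b', hb', hu⟩ := hI.pB.exists_agr 0 hm
  have := hSP.symm.bal hb hb' hu (l := 0) ⟨by simp, le_rfl, by simp⟩ (Or.inl hm)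
  refine hI.pA.not_free (m - 1) (by omega) fun j hj => ?_
  obtain rfl : j = 0 := by omega
  rw [show m - 1 + 1 = m by omega]
  exact this

/-- No irreducible spectral pair has exponents in the range of the theorem. -/
theorem not_irr [hp : Fact p.Prime] [hq : Fact q.Prime] (hpq : p ≠ q) (hmn : 0 < m + n)
    (h : (p < q ∧ (m ≤ 9 ∨ n ≤ 6)) ∨ p ^ m < p ^ 2 * q ^ 4) (hSP : SP m n A B) :
    ¬ Irr m n A B := by
  intro hI
  have hm : 0 < m := by
    rcases Nat.eq_zero_or_pos m with h0 | h0
    · exact Irr.pos hSP.swap hI.swap (by omega)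
    · exact h0
  have hn := Irr.pos hSP hI hm
  have hone : ∀ {r s : ℕ}, r.Prime → ∀ x, r ≤ s ^ x → 1 ≤ x := fun hr x hx => by
    refine Nat.one_le_iff_ne_zero.2 fun h0 => ?_
    rw [h0, pow_zero] at hx
    have := hr.one_lt
    omega
  rcases lt_or_gt_of_ne hpq with hlt | hlt
  · have hex : ∃ x, q ≤ p ^ x := ⟨q, (Nat.lt_pow_self hp.out.one_lt).le⟩
    have hc := hI.exponent_le hpq hSP hm hn (c := Nat.find hex) fun x hx => Nat.find_min' hex hx
    have hspec := Nat.find_spec hex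
    -- As `p < q`, the least exponent is at least `2`, so `5 * c ≤ m` excludes `m ≤ 9`; for `n` the
    -- bound with `c = 1` gives `n ≥ 7`.
    have hc2 : 2 ≤ Nat.find hex := by
      by_contra hno
      have : p ^ Nat.find hex ≤ p ^ 1 := Nat.pow_le_pow_right hp.out.pos (by omega)
      rw [pow_one] at this
      omega
    have hn7 := hI.swap.exponent_le hpq.symm hSP.swap hn hm (c := 1) (hone hp.out)
    set c := Nat.find hex
    rcases h with ⟨-, h | h⟩ | h
    · omega
    · omega
    · refine absurd h (not_lt.2 ?_)
      calc p ^ 2 * q ^ 4 ≤ p ^ c * (p ^ c) ^ 4 := Nat.mul_le_mul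
            (Nat.pow_le_pow_right hp.out.pos hc2) (Nat.pow_le_pow_left hspec 4)
        _ = p ^ (5 * c) := by ring
        _ ≤ p ^ m := Nat.pow_le_pow_right hp.out.pos hc.2
  · have hm7 := (hI.exponent_le hpq hSP hm hn (c := 1) (hone hq.out)).1
    rcases h with ⟨h, -⟩ | h
    · omega
    · have h1 : p ^ m < p ^ 6 := h.trans (by
        calc p ^ 2 * q ^ 4 < p ^ 2 * p ^ 4 := Nat.mul_lt_mul_of_pos_left
              (Nat.pow_lt_pow_left hlt (by norm_num)) (pow_pos hp.out.pos _)
          _ = p ^ 6 := by ring)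
      have := (Nat.pow_lt_pow_iff_right hp.out.one_lt).1 h1
      omega

end

end Fuglede

theorem theorem1p1 (p q : ℕ) (hp : p.Prime) (hq : q.Prime) (hpq : p ≠ q) (m n : ℕ)
    (N : ℕ) [NeZero N] (hN : N = p ^ m * q ^ n)
    (h : (p < q ∧ (m ≤ 9 ∨ n ≤ 6)) ∨ (p : ℝ) ^ ((m : ℤ) - 2) < (q : ℝ) ^ 4)
    (A : Finset (ZMod N)) (hA : A.Nonempty) (hspec : Fuglede.IsSpectral A) :
    Fuglede.Tiles A := by
  have : Fact p.Prime := ⟨hp⟩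
  have : Fact q.Prime := ⟨hq⟩
  obtain ⟨B, hB⟩ := hspec
  have h' : (p < q ∧ (m ≤ 9 ∨ n ≤ 6)) ∨ p ^ m < p ^ 2 * q ^ 4 := by
    refine h.imp_right fun h => ?_
    have hp0 : (0 : ℝ) < p := by exact_mod_cast hp.pos
    rw [zpow_sub₀ hp0.ne', div_lt_iff₀ (by positivity)] at h
    have h1 : (p : ℝ) ^ m < p ^ 2 * q ^ 4 := by
      rw [mul_comm]
      exact_mod_cast h
    exact_mod_cast h1
  refine Fuglede.DigitTile.tiles hpq hN (B := B) (Fuglede.SP.digitTile hpq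
    (P := fun m n => (p < q ∧ (m ≤ 9 ∨ n ≤ 6)) ∨ p ^ m < p ^ 2 * q ^ 4) ?_ ?_
    (fun m n A B hmn hP hSP => Fuglede.not_irr hpq hmn hP hSP) h' _ _ (hB.sp hpq hN hA))
  · rintro m n (⟨h1, h2⟩ | h2)
    · exact Or.inl ⟨h1, by omega⟩
    · exact Or.inr ((Nat.pow_le_pow_right hp.pos (Nat.le_succ m)).trans_lt h2)
  · rintro m n (⟨h1, h2⟩ | h2)
    · exact Or.inl ⟨h1, by omega⟩
    · exact Or.inr h2
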